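/- **Setting.** Let $a=\mathrm{diag}(id_1,\dots,id_n)\in u(n)$ with $d_1,\dots,d_n\in\mathbb R$, let $M$ be the adjoint $U(n)$-orbit of $a$, let $u(n)_a$ be the centralizer of $a$ in $u(n)$, $u(n)_a^\perp$ its orthogonal complement, and $\pi_a,\pi_a^\perp$ the orthogonal projections onto them. Let $C_a(\mathbb R,M)$ be the space of smooth $\gamma:\mathbb R\to M$ with $\gamma(-\infty)=a$ and $\gamma_x$ in the Schwartz class; its tangent vectors at $\gamma$ are the Schwartz fields along $\gamma$ tangent to $M$. For $\gamma\in C_a(\mathbb R,M)$ let $g:\mathbb R\to U(n)$ be the unique smooth map with $\gamma=gag^{-1}$, $g(-\infty)=I$, $g^{-1}g_x\in u(n)_a^\perp$, and put $\Phi(\gamma)=g^{-1}g_x$. For $u=\Phi(\gamma)$ let $Q_j(u)$ ($j\ge 0$) be the unique sequence of smooth $u(n)$-valued functions with $$(Q_j)_x+[u,Q_j]=[Q_{j+1},a],\qquad Q_0=a,\qquad Q_j(-\infty)=0\ (j\ge1),$$ and let $$H_j(\gamma)=F_j(\Phi(\gamma))=-\frac1{j+1}\int_{-\infty}^\infty \mathrm{tr}\big(Q_{j+2}(\Phi(\gamma))\,a\big)\,dx\qquad(j\ge0).$$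 The gradient $\nabla H(\gamma)$ of a functional $H$ is the tangent vector at $\gamma$ with $dH_\gamma(\delta\gamma)=\int\mathrm{tr}(\nabla H(\gamma)\,\delta\gamma)\,dx$ for all variations $\delta\gamma$ of $\gamma$ in $C_a(\mathbb R,M)$. Here a variation is $\delta\gamma=\partial_\epsilon\Gamma_\epsilon|_{\epsilon=0}$ for a smooth family of paths $\Gamma_\epsilon$ in $C_a(\mathbb R,M)$ with $\Gamma_0=\gamma$ such that all $x$-derivatives of $\partial_x\Gamma_\epsilon$ and $\partial_x\partial_\epsilon\Gamma_\epsilon$ decay rapidly, uniformly for $|\epsilon|\le 1$, and $dH_\gamma(\delta\gamma)=\frac{d}{d\epsilon}H(\Gamma_\epsilon)|_{\epsilon=0}$. For $v\in\mathcal S(\mathbb R,u(n)_a^\perp)$ let $P_u(v)=v_x+\pi_a^\perp([u,v])-[u,T_u(v)]$ with $T_u(v)(x)=\int_{-\infty}^x\pi_a([u,v])\,dy$, and let $L_\gamma(gvg^{-1})=gP_u(v)g^{-1}$, where $u=\Phi(\gamma)$. Let $$(\tau_0)_\gamma(X,V)=\hat\tau_\gamma(X,V)=\int_{-\infty}^\infty\mathrm{tr}\big(-\mathrm{ad}(\gamma)^{-1}(X)\,V\big)dx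 .$$ Let $(\tau_1)_\gamma(X,V)=\int_{-\infty}^\infty\mathrm{tr}(\xi V)\,dx$, defined for those tangent vectors $X$ at $\gamma$ that are of the form $X=\xi_x$ with $\xi\in\mathcal S(\mathbb R,u(n))$. A Hamiltonian vector of $H$ at $\gamma$ with respect to $\tau_k$ is a tangent vector $X$ in the domain of $\tau_k$ with $(\tau_k)_\gamma(X,\delta\gamma)=dH_\gamma(\delta\gamma)$ for all variations $\delta\gamma$ of $\gamma$ in $C_a(\mathbb R,M)$. The Hamiltonian equation of $H$ with respect to $\tau_k$ is $\gamma_t=X$ with $X$ such a vector. **Corollary 5.4.** Let $j\ge1$. All the objects above exist and are unique as stated, the integrals defining all $H_i$ $(i\ge 0)$ converge absolutely, $H_j$ and $H_{j-1}$ have gradients, and every $X$ in the domain of $\tau_1$ at $\gamma$ is $L_\gamma(\eta)$ for a unique tangent vector $\eta=L_\gamma^{-1}(X)$, with $(\tau_1)_\gamma(X,V)=\int\mathrm{tr}(L_\gamma^{-1}(X)\,V)\,dx$ for all tangent vectors $V$. For every $\gamma\in C_a(\mathbb R,M)$: 1. $[\nabla H_j(\gamma),\gamma]$ is the unique Hamiltonian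 vector of $H_j$ at $\gamma$ with respect to $\tau_0=\hat\tau$; 2. $[\nabla H_j(\gamma),\gamma]=L_\gamma(\nabla H_{j-1}(\gamma))$; 3. a field $X$ along $\gamma$ is a Hamiltonian vector of $H_j$ with respect to $\tau_0$ if and only if it is a Hamiltonian vector of $H_{j-1}$ with respect to $\tau_1$. Consequently, for curves $t\mapsto\gamma(\cdot,t)$ in $C_a(\mathbb R,M)$, the Hamiltonian equation of $H_j$ with respect to $\tau_0$, the equation $\gamma_t=[\nabla H_j(\gamma),\gamma]$, the equation $\gamma_t=L_\gamma(\nabla H_{j-1}(\gamma))$, and the Hamiltonian equation of $H_{j-1}$ with respect to $\tau_1$ are equivalent. -/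

import Mathlib

open scoped Matrix Matrix.Norms.Operator ContDiff Topology
open MeasureTheory Filter

noncomputable section

namespace GNLS

/-- Complex `n × n` matrices. The norm in force is an operator norm; only the topology and the class
of Schwartz functions depend on it, and all norms on this space give the same ones. -/
abbrev Mat (n : ℕ) : Type := Matrix (Fin n) (Fin n) ℂ

variable {n : ℕ}

/-- The diagonal matrix `a = diag (i d₁, …, i dₙ)` of `u(n)`, for real `d₁, …, dₙ`. -/
def base (d : Fin n → ℝ) : Mat n := Matrix.diagonal fun k => Complex.I * (d k : ℂ)

/-- Membership in `u(n)`. -/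
def IsSkew (X : Mat n) : Prop := Xᴴ = -X

/-- The orthogonal projection `π_a` onto the centralizer of `a`: it keeps the entries `(k, l)` at
which `a` has equal eigenvalues. -/
def projC (d : Fin n → ℝ) (X : Mat n) : Mat n :=
  Matrix.of fun k l => if d k = d l then X k l else 0

/-- The complementary orthogonal projection `π_a^⊥`. -/
def projP (d : Fin n → ℝ) (X : Mat n) : Mat n := X - projC d X

/-- Membership in `u(n)_a^⊥`. -/
def IsPerp (d : Fin n → ℝ) (X : Mat n) : Prop := IsSkew X ∧ projC d X = 0

/-- `ad(a)⁻¹` on `u(n)_a^⊥` (extended by `0` on the centralizer): the `(k, l)` entry of `[a, X]` is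
`i (d k - d l) X k l`. -/
def adInv (d : Fin n → ℝ) (X : Mat n) : Mat n :=
  Matrix.of fun k l => if d k = d l then 0 else X k l / (Complex.I * ((d k : ℂ) - (d l : ℂ)))

/-- The trace form `tr (X Y)`, which is real on `u(n)`. -/
def trForm (X Y : Mat n) : ℝ := (Matrix.trace (X * Y)).re

/-- Matrix valued functions on the line in the Schwartz class. -/
def IsSchwartz (f : ℝ → Mat n) : Prop := ∃ s : SchwartzMap ℝ (Mat n), ∀ x, s x = f x

/-- The path space `C_a(ℝ, M)`, where `M` is the adjoint `U(n)`-orbit of `a`. -/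
structure InPathSpace (d : Fin n → ℝ) (γ : ℝ → Mat n) : Prop where
  smooth : ContDiff ℝ ∞ γ
  orbit : ∀ x, ∃ U ∈ Matrix.unitaryGroup (Fin n) ℂ, γ x = U * base d * Uᴴ
  lim : Tendsto γ atBot (𝓝 (base d))
  schwartz : IsSchwartz (deriv γ)

/-- The tangent space of `C_a(ℝ, M)` at `γ`: Schwartz fields along `γ` that are tangent to `M`,
where the tangent space of the adjoint orbit `M` at `y` is `{[Z, y] | Z ∈ u(n)}`. -/
structure IsTangent (γ X : ℝ → Mat n) : Prop where
  schwartz : IsSchwartz X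
  tangent : ∀ x, ∃ Z : Mat n, IsSkew Z ∧ X x = ⁅Z, γ x⁆

/-- `g : ℝ → U(n)` with `γ = g a g⁻¹`, `g(-∞) = 1` and `g⁻¹ g_x ∈ u(n)_a^⊥`. -/
structure IsFrame (d : Fin n → ℝ) (γ g : ℝ → Mat n) : Prop where
  smooth : ContDiff ℝ ∞ g
  unitary : ∀ x, g x ∈ Matrix.unitaryGroup (Fin n) ℂ
  conj : ∀ x, γ x = g x * base d * (g x)ᴴ
  lim : Tendsto g atBot (𝓝 1)
  perp : ∀ x, IsPerp d ((g x)ᴴ * deriv g x)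

/-- The frame of a path. -/
def frame (d : Fin n → ℝ) (γ : ℝ → Mat n) : ℝ → Mat n := Classical.epsilon (IsFrame d γ)

/-- The development map `Φ(γ) = g⁻¹ g_x`. -/
def devMap (d : Fin n → ℝ) (γ : ℝ → Mat n) : ℝ → Mat n :=
  fun x => (frame d γ x)ᴴ * deriv (frame d γ) x

/-- `T_u(v)(x) = ∫_{-∞}^x π_a [u, v] dy`. -/
def opT (d : Fin n → ℝ) (u v : ℝ → Mat n) : ℝ → Mat n :=
  fun x => ∫ y in Set.Iic x, projC d ⁅u y, v y⁆

/-- `P_u(v) = v_x + π_a^⊥ [u, v] - [u, T_u(v)]`. -/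
def opP (d : Fin n → ℝ) (u v : ℝ → Mat n) : ℝ → Mat n :=
  fun x => deriv v x + projP d ⁅u x, v x⁆ - ⁅u x, opT d u v x⁆

/-- `L_γ(g v g⁻¹) = g P_u(v) g⁻¹`, where `g` is the frame of `γ` and `u = Φ(γ)`. -/
def opL (d : Fin n → ℝ) (γ η : ℝ → Mat n) : ℝ → Mat n :=
  fun x => frame d γ x *
    opP d (devMap d γ) (fun y => (frame d γ y)ᴴ * η y * frame d γ y) x * (frame d γ x)ᴴ

/-- The recursion `(Q_j)_x + [u, Q_j] = [Q_{j+1}, a]`, `Q_0 = a`, `Q_j(-∞) = 0` for `j ≥ 1`, for a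
sequence of smooth functions with values in `u(n)`. -/
structure IsHierarchy (d : Fin n → ℝ) (u : ℝ → Mat n) (Q : ℕ → ℝ → Mat n) : Prop where
  zero : ∀ x, Q 0 x = base d
  smooth : ∀ j, ContDiff ℝ ∞ (Q j)
  skew : ∀ j x, IsSkew (Q j x)
  step : ∀ j x, deriv (Q j) x + ⁅u x, Q j x⁆ = ⁅Q (j + 1) x, base d⁆
  lim : ∀ j, Tendsto (Q (j + 1)) atBot (𝓝 0)

/-- The sequence `Q_j(u)`, obtained by solving the recursion: the part of `Q_{j+1}` in `u(n)_a^⊥` is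
`p = -ad(a)⁻¹ ((Q_j)_x + [u, Q_j])`, and the part in `u(n)_a` is `-T_u(p)`, because the left side of
the next equation has to lie in `u(n)_a^⊥`. -/
def Q (d : Fin n → ℝ) (u : ℝ → Mat n) : ℕ → ℝ → Mat n
  | 0 => fun _ => base d
  | j + 1 =>
    let p : ℝ → Mat n := fun x => -adInv d (deriv (Q d u j) x + ⁅u x, Q d u j x⁆)
    fun x => p x - opT d u p x

/-- `F_j(u) = -1/(j+1) ∫ tr (Q_{j+2}(u) a) dx`. -/
def F (d : Fin n → ℝ) (j : ℕ) (u : ℝ → Mat n) : ℝ :=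
  -(1 / ((j : ℝ) + 1)) * ∫ x, trForm (Q d u (j + 2) x) (base d)

/-- `H_j = F_j ∘ Φ`. -/
def H (d : Fin n → ℝ) (j : ℕ) (γ : ℝ → Mat n) : ℝ := F d j (devMap d γ)

/-- A variation of `γ` in `C_a(ℝ, M)`: a smooth family of paths `Γ ε`, with `Γ 0 = γ`, such that all
`x`-derivatives of `∂_x Γ` and of `∂_x ∂_ε Γ` decay rapidly, uniformly for `ε` near `0`. -/
structure IsVariation (d : Fin n → ℝ) (γ : ℝ → Mat n) (Γ : ℝ → ℝ → Mat n) : Prop where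
  start : Γ 0 = γ
  mem : ∀ ε, InPathSpace d (Γ ε)
  smooth : ContDiff ℝ ∞ fun p : ℝ × ℝ => Γ p.1 p.2
  decay : ∀ k m : ℕ, ∃ C : ℝ, ∀ ε ∈ Set.Icc (-1 : ℝ) 1, ∀ x : ℝ,
    |x| ^ k * ‖iteratedDeriv (m + 1) (Γ ε) x‖ ≤ C
  decay_deriv : ∀ k m : ℕ, ∃ C : ℝ, ∀ ε ∈ Set.Icc (-1 : ℝ) 1, ∀ x : ℝ,
    |x| ^ k * ‖iteratedDeriv (m + 1) (fun y => deriv (fun e => Γ e y) ε) x‖ ≤ C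

/-- The variation field `δγ = ∂_ε Γ` at `ε = 0`. -/
def velocity (Γ : ℝ → ℝ → Mat n) : ℝ → Mat n := fun x => deriv (fun ε => Γ ε x) 0

/-- `G` is an `L²` gradient of the functional `h` at `γ`: it is tangent at `γ` and
`dh_γ(δγ) = ∫ tr (G δγ) dx` for all variations of `γ`. -/
def IsGradient (d : Fin n → ℝ) (h : (ℝ → Mat n) → ℝ) (γ G : ℝ → Mat n) : Prop :=
  IsTangent γ G ∧ ∀ Γ, IsVariation d γ Γ →
    HasDerivAt (fun ε => h (Γ ε)) (∫ x, trForm (G x) (velocity Γ x)) 0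

/-- The gradient `∇h(γ)`. -/
def grad (d : Fin n → ℝ) (h : (ℝ → Mat n) → ℝ) (γ : ℝ → Mat n) : ℝ → Mat n :=
  Classical.epsilon (IsGradient d h γ)

/-- `ad(γ)⁻¹` on fields tangent to `M` along `γ = g a g⁻¹`: `g v g⁻¹ ↦ g (ad(a)⁻¹ v) g⁻¹`. -/
def adPathInv (d : Fin n → ℝ) (γ X : ℝ → Mat n) : ℝ → Mat n :=
  fun x => frame d γ x * adInv d ((frame d γ x)ᴴ * X x * frame d γ x) * (frame d γ x)ᴴ

/-- `τ_0 = τ̂`: `(τ_0)_γ(X, V) = ∫ tr (-ad(γ)⁻¹(X) V) dx`. -/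
def tauZero (d : Fin n → ℝ) (γ X V : ℝ → Mat n) : ℝ :=
  ∫ x, trForm (-adPathInv d γ X x) (V x)

/-- Tangent vectors at `γ` on which `τ_1` is defined: those of the form `X = ξ_x`, with `ξ` a
Schwartz function with values in `u(n)` (up to sign, the directions generated at `d_x + γ λ`
by the coadjoint action of the loops `ξ λ + O(λ²)`). -/
def IsTangentOne (γ X : ℝ → Mat n) : Prop :=
  IsTangent γ X ∧ ∃ ξ : ℝ → Mat n, IsSchwartz ξ ∧ ∀ x, IsSkew (ξ x) ∧ HasDerivAt ξ (X x) x

/-- `(τ_1)_γ(X, V) = ∫ tr (ξ V) dx`, where `ξ_x = X` and `ξ(-∞) = 0`. -/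
def tauOne (_γ X V : ℝ → Mat n) : ℝ :=
  ∫ x, trForm (∫ y in Set.Iic x, X y) (V x)

/-- `X` is a Hamiltonian vector of `h` at `γ` with respect to the form `τ`, whose domain in the first
variable is `D`: `τ_γ(X, δγ) = dh_γ(δγ)` for all variations of `γ`. -/
def IsHamVec (d : Fin n → ℝ) (D : (ℝ → Mat n) → (ℝ → Mat n) → Prop)
    (τ : (ℝ → Mat n) → (ℝ → Mat n) → (ℝ → Mat n) → ℝ)
    (h : (ℝ → Mat n) → ℝ) (γ X : ℝ → Mat n) : Prop :=
  D γ X ∧ ∀ Γ, IsVariation d γ Γ →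
    HasDerivAt (fun ε => h (Γ ε)) (τ γ X (velocity Γ)) 0

/-- The curve `t ↦ c t` in `C_a(ℝ, M)` satisfies the evolution equation `γ_t = X`, `X` related to
`γ` by `R γ X`, at the times in `I`. -/
def IsFlow (d : Fin n → ℝ) (R : (ℝ → Mat n) → (ℝ → Mat n) → Prop)
    (I : Set ℝ) (c : ℝ → ℝ → Mat n) : Prop :=
  ∀ t ∈ I, InPathSpace d (c t) ∧
    ∃ X, R (c t) X ∧ ∀ x, HasDerivAt (fun s => c s x) (X x) t

end GNLS

end

/-! Conjugation by the frame `g` turns the recursion for `Q_j` into `q_j' = [q_{j+1}, γ]` with `q_j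
= g Q_j g⁻¹` and `q_0 = γ`. The point is that the `q_j` are local, although `Q_j` is built from
integrals. For each eigenvalue `c_r` of `a` there is a formal series `e = ∑ e_k z^k` with `e² = e`
and `z e_x = [e, γ]` that starts with the spectral projection of `γ`. Its coefficients (`series`)
arise from `γ` by products, `x`-derivatives and inversion of `ad γ`, without integration. The
combination `∑ c_r e_k` (`localQ`) is `q_k` (`InPathSpace.Q_eq`). Hence `q_k` is a Schwartz function
for `k ≥ 1`, and everything about `H_j` can be computed from `∫ tr (q_{j+2} γ)`.

The gradient comes from a trace identity for idempotents (`trace_variation`): up to an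
`x`-derivative, `tr (γ δe) + z tr (e_z δγ)` vanishes. Its coefficient at `z^{j+2}`, summed over the
eigenvalues and integrated, reads `∫ tr (γ δq_{j+2}) = -(j+2) ∫ tr (q_{j+2} δγ)`. So `δ ∫ tr
(q_{j+2} γ) = -(j+1) ∫ tr (q_{j+2} δγ)`. The factor `-1/(j+1)` in `H_j` cancels this constant, and
`∇H_j` is the part of `q_{j+2}` tangent to the orbit (`gradQ`). Compactly supported rotations of `γ`
supply enough variations for uniqueness (`InPathSpace.tangent_ext`).

Two facts finish the proof. The recursion gives `[∇H_j, γ] = [q_{j+2}, γ] = (q_{j+1})_x`. And `L_γ`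
sends the off-diagonal part of a Schwartz function `ξ` to `ξ_x` whenever `ξ_x` is tangent
(`InPathSpace.opL_eq`), because `T_u` restores the block diagonal part of `ξ`, up to sign, from the
off-diagonal one. With `ξ = q_{j+1}` this says `L_γ(∇H_{j-1}) = (q_{j+1})_x`. The form `τ_1` pairs
`ξ`, hence its off-diagonal part `L_γ⁻¹(ξ_x)`, with tangent fields, so Hamiltonian vectors for `τ_1`
are images of gradients under `L_γ`; those for `τ_0` are brackets of gradients with `γ`. -/

noncomputable section

namespace GNLS

variable {n : ℕ}

/-! ### Block decomposition with respect to spectral projections, and one step of the recursion for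
idempotent series. -/

section SpectralAlgebra

variable {ι R : Type*} [Fintype ι] [Ring R]

theorem ring_lie_skew (X Y : R) : ⁅X, Y⁆ = -⁅Y, X⁆ := by
  simp [Ring.lie_def]

/-- The block diagonal part of `X` with respect to the projections `P`. -/
def blockDiag (P : ι → R) (X : R) : R := ∑ i, P i * X * P i

theorem blockDiag_neg (P : ι → R) (X : R) : blockDiag P (-X) = -blockDiag P X := by
  simp [blockDiag]

theorem blockDiag_sub (P : ι → R) (X Y : R) :
    blockDiag P (X - Y) = blockDiag P X - blockDiag P Y := by
  simp [blockDiag, mul_sub, sub_mul]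

variable [Algebra ℂ R]

/-- The inverse of `ad y` on block off-diagonal elements. -/
def adI (c : ι → ℂ) (P : ι → R) (X : R) : R := ∑ i, ∑ j, (c i - c j)⁻¹ • (P i * X * P j)

theorem adI_neg (c : ι → ℂ) (P : ι → R) (X : R) : adI c P (-X) = -adI c P X := by
  simp [adI]

variable [DecidableEq ι]

/-- `P` is the family of spectral projections of `y`, with distinct eigenvalues `c`. -/
structure IsSpectral (c : ι → ℂ) (P : ι → R) (y : R) : Prop where
  inj : Function.Injective c
  sum : ∑ i, P i = 1
  mul : ∀ i j, P i * P j = if i = j then P i else 0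
  eq : y = ∑ i, c i • P i

namespace IsSpectral

variable {c : ι → ℂ} {P : ι → R} {y : R} (h : IsSpectral c P y)
include h

theorem proj_mul (i : ι) : P i * y = c i • P i := by
  simp [h.eq, Finset.mul_sum, h.mul]

theorem mul_proj (i : ι) : y * P i = c i • P i := by
  simp [h.eq, Finset.sum_mul, h.mul]

theorem proj_blockDiag (i : ι) (X : R) : P i * blockDiag P X = P i * X * P i := by
  simp only [blockDiag, Finset.mul_sum, ← mul_assoc, h.mul, ite_mul, zero_mul]
  simp

theorem blockDiag_proj (i : ι) (X : R) : blockDiag P X * P i = P i * X * P i := by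
  simp only [blockDiag, Finset.sum_mul, mul_assoc, h.mul, mul_ite, mul_zero]
  simp

theorem decomp (X : R) : X = ∑ i, ∑ j, P i * X * P j := by
  simp only [← Finset.mul_sum, h.sum, mul_one, ← Finset.sum_mul, one_mul]

theorem ext_blocks {X Y : R} (hXY : ∀ i j, P i * X * P j = P i * Y * P j) : X = Y := by
  rw [h.decomp X, h.decomp Y]
  simp only [hXY]

theorem proj_blockDiag_proj (i j : ι) (X : R) :
    P i * blockDiag P X * P j = if i = j then P i * X * P i else 0 := by
  rw [h.proj_blockDiag, mul_assoc, h.mul]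
  split_ifs <;> simp

theorem proj_adI_proj (i j : ι) (X : R) :
    P i * adI c P X * P j = (c i - c j)⁻¹ • (P i * X * P j) := by
  have h1 : P i * adI c P X = ∑ j, (c i - c j)⁻¹ • (P i * X * P j) := by
    simp only [adI, Finset.mul_sum, mul_smul_comm, ← mul_assoc, h.mul, ite_mul, zero_mul,
      smul_ite, smul_zero]
    rw [Finset.sum_comm]
    simp
  rw [h1]
  simp only [Finset.sum_mul, smul_mul_assoc, mul_assoc, h.mul, mul_ite, mul_zero, smul_ite,
    smul_zero]
  simp

theorem proj_lie_proj (i j : ι) (X : R) :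
    P i * ⁅y, X⁆ * P j = (c i - c j) • (P i * X * P j) := by
  have h1 : P i * ⁅y, X⁆ * P j = (P i * y) * X * P j - P i * X * (y * P j) := by
    rw [Ring.lie_def]; noncomm_ring
  rw [h1, h.proj_mul, h.mul_proj, sub_smul]
  simp [mul_assoc]

theorem lie_adI (X : R) : ⁅y, adI c P X⁆ = X - blockDiag P X := by
  refine h.ext_blocks fun i j => ?_
  rw [h.proj_lie_proj, h.proj_adI_proj, mul_sub, sub_mul, h.proj_blockDiag_proj]
  split_ifs with hij
  · subst hij; simp
  · rw [smul_smul, mul_inv_cancel₀ (sub_ne_zero.2 fun e => hij (h.inj e))]; simp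

theorem adI_lie (X : R) : adI c P ⁅y, X⁆ = X - blockDiag P X := by
  refine h.ext_blocks fun i j => ?_
  rw [h.proj_adI_proj, h.proj_lie_proj, mul_sub, sub_mul, h.proj_blockDiag_proj]
  split_ifs with hij
  · subst hij; simp
  · rw [smul_smul, inv_mul_cancel₀ (sub_ne_zero.2 fun e => hij (h.inj e))]; simp

theorem blockDiag_lie (X : R) : blockDiag P ⁅y, X⁆ = 0 := by
  simp [blockDiag, h.proj_lie_proj]

theorem blockDiag_lie' (X : R) : blockDiag P ⁅X, y⁆ = 0 := by
  rw [ring_lie_skew, blockDiag_neg, h.blockDiag_lie, neg_zero]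

theorem blockDiag_adI (X : R) : blockDiag P (adI c P X) = 0 := by
  simp [blockDiag, h.proj_adI_proj]

theorem blockDiag_blockDiag (X : R) : blockDiag P (blockDiag P X) = blockDiag P X := by
  refine h.ext_blocks fun i j => ?_
  simp [h.proj_blockDiag_proj]

theorem lie_blockDiag (X : R) : ⁅y, blockDiag P X⁆ = 0 := by
  refine h.ext_blocks fun i j => ?_
  rw [h.proj_lie_proj, h.proj_blockDiag_proj]
  split_ifs with hij
  · simp [hij]
  · simp

theorem eq_blockDiag_of_lie {X : R} (hX : ⁅y, X⁆ = 0) : X = blockDiag P X := by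
  have := h.adI_lie X
  rw [hX] at this
  simpa [adI, eq_comm, sub_eq_zero] using this

/-- The derivative `X` of the coefficient of an idempotent series at the order where the relation
with `ad y` is still to be established has no block diagonal part. -/
theorem blockDiag_eq_zero {r : ι} {X S : R} (hX : X * P r + P r * X + ⁅S, y⁆ = X) :
    blockDiag P X = 0 := by
  have key : ∀ i, P i * X * P i = 0 := by
    intro i
    have h0 : P i * ⁅S, y⁆ * P i = 0 := by
      rw [ring_lie_skew, mul_neg, neg_mul, h.proj_lie_proj]; simp
    have h1 := congrArg (fun Z => P i * Z * P i) hX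
    simp only [mul_add, add_mul, h0, add_zero] at h1
    have h2 : P i * (X * P r) * P i = P i * X * (P r * P i) := by noncomm_ring
    have h3 : P i * (P r * X) * P i = (P i * P r) * X * P i := by noncomm_ring
    rw [h2, h3, h.mul, h.mul] at h1
    by_cases hir : i = r
    · subst hir; simpa using h1
    · simpa [hir, Ne.symm hir] using h1.symm
  simp [blockDiag, key]

/-- The bracket with `y` sees only off-diagonal blocks. There `-adI c P X` solves the equation,
because `X` has no diagonal blocks; the block diagonal term is free and is chosen for the sake of
`idem_step`. -/
theorem lie_step {r : ι} {X S : R} (hX : X * P r + P r * X + ⁅S, y⁆ = X) :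
    ⁅-adI c P X + (1 - 2 * P r) * blockDiag P S, y⁆ = X := by
  have hr : ⁅P r, y⁆ = 0 := by rw [Ring.lie_def, h.proj_mul, h.mul_proj, sub_self]
  have h1 : ⁅blockDiag P S, y⁆ = 0 := by rw [ring_lie_skew, h.lie_blockDiag, neg_zero]
  have h2 : ⁅adI c P X, y⁆ = -X := by
    rw [ring_lie_skew, h.lie_adI, h.blockDiag_eq_zero hX, sub_zero]
  rw [Ring.lie_def] at *
  have h3 : (1 - 2 * P r) * blockDiag P S * y - y * ((1 - 2 * P r) * blockDiag P S)
      = (1 - 2 * P r) * (blockDiag P S * y - y * blockDiag P S)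
        - 2 * (P r * y - y * P r) * blockDiag P S := by noncomm_ring
  have h4 : (-adI c P X + (1 - 2 * P r) * blockDiag P S) * y
      - y * (-adI c P X + (1 - 2 * P r) * blockDiag P S)
      = -(adI c P X * y - y * adI c P X)
        + ((1 - 2 * P r) * blockDiag P S * y - y * ((1 - 2 * P r) * blockDiag P S)) := by
    noncomm_ring
  rw [h4, h3, h1, h2, hr]
  simp

/-- The defect commutes with `y`, by `lie_step` and `hX`, so only its diagonal blocks matter. The
sign `1 - 2 * P r` is made for them: the block of the new coefficient is `-S` at `r`, where the
relation reads `2E + S = E`, and `S` at the other indices, where it reads `S = E`. -/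
theorem idem_step {r : ι} {X S : R} (hX : X * P r + P r * X + ⁅S, y⁆ = X) :
    (-adI c P X + (1 - 2 * P r) * blockDiag P S) * P r
      + P r * (-adI c P X + (1 - 2 * P r) * blockDiag P S) + S
      = -adI c P X + (1 - 2 * P r) * blockDiag P S := by
  have hE := h.lie_step hX
  set E := -adI c P X + (1 - 2 * P r) * blockDiag P S with hEdef
  have hr : ⁅P r, y⁆ = 0 := by rw [Ring.lie_def, h.proj_mul, h.mul_proj, sub_self]
  have hW : ⁅E * P r + P r * E + S - E, y⁆ = 0 := by
    have : ⁅E * P r + P r * E + S - E, y⁆ = ⁅E, y⁆ * P r + P r * ⁅E, y⁆ + ⁅S, y⁆ - ⁅E, y⁆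
        + (E * ⁅P r, y⁆ + ⁅P r, y⁆ * E) := by
      simp only [Ring.lie_def]; noncomm_ring
    rw [this, hE, hr, hX]; simp
  have hW' := h.eq_blockDiag_of_lie (X := E * P r + P r * E + S - E)
    (by rw [ring_lie_skew, hW, neg_zero])
  refine sub_eq_zero.1 (hW'.trans ?_)
  have hPE : ∀ i, P i * E * P i = P i * S * P i - 2 * (P i * P r) * (P i * S * P i) := by
    intro i
    have h0 : P i * adI c P X * P i = 0 := by rw [h.proj_adI_proj]; simp
    have : P i * E * P i = -(P i * adI c P X * P i) + P i * (blockDiag P S * P i)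
      - 2 * (P i * P r) * (blockDiag P S * P i) := by rw [hEdef]; noncomm_ring
    rw [this, h0, h.blockDiag_proj]
    have h5 : P i * (P i * S * P i) = P i * S * P i := by
      rw [← mul_assoc, ← mul_assoc, h.mul]; simp
    rw [h5]; simp
  refine Finset.sum_eq_zero fun i _ => ?_
  have h6 : P i * (E * P r + P r * E + S - E) * P i
    = P i * E * (P r * P i) + (P i * P r) * E * P i + P i * S * P i - P i * E * P i := by
    noncomm_ring
  rw [h6, h.mul, h.mul]
  by_cases hir : i = r
  · subst hir
    have h5 : P i * (P i * S * P i) = P i * S * P i := by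
      rw [← mul_assoc, ← mul_assoc, h.mul]; simp
    have h7 := hPE i
    rw [h.mul, if_pos rfl, mul_assoc 2, h5] at h7
    simp only [if_true]
    rw [h7]; noncomm_ring
  · have h7 := hPE i
    rw [h.mul, if_neg hir] at h7
    simp [hir, Ne.symm hir, h7]

end IsSpectral

end SpectralAlgebra

/-! ### A trace identity for derivations of an idempotent. -/

section TraceIdentity

variable {R M : Type*} [Ring R] [AddCommGroup M]

/-- The identity behind the variational formula: if `e` is idempotent, `z ∂e = [e, γ]`, and the
derivations `∂ = ∂_x`, `δ`, `∂_z` act compatibly, then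
`tr (γ δe) + z tr (∂_z e δγ) = z² ∂ tr (y δe)` with `y = [∂_z e, e]`. -/
theorem trace_variation (T : R →+ M) (hT : ∀ a b, T (a * b) = T (b * a))
    {z e ex ed exd ez ezx γ γd : R} (hz : ∀ a, z * a = a * z)
    (he : e * e = e) (hex : ex * e + e * ex = ex) (hed : ed * e + e * ed = ed)
    (hez : ez * e + e * ez = ez) (hezx : ezx * e + ez * ex + ex * ez + e * ezx = ezx)
    (h1 : z * ex = e * γ - γ * e)
    (h2 : z * exd = ed * γ - γ * ed + (e * γd - γd * e))
    (h3 : ex + z * ezx = ez * γ - γ * ez) :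
    T (γ * ed) + T (z * ez * γd) =
      T (z * z * ((ezx * e - e * ezx + (ez * ex - ex * ez)) * ed + (ez * e - e * ez) * exd)) := by
  -- A derivative of an idempotent is off-diagonal with respect to it, so it is recovered from its
  -- commutator with `e` by one more bracket: `∂_z e = [y, e]`, and likewise for `δe`.
  set y := ez * e - e * ez with hy
  set yx := ezx * e - e * ezx + (ez * ex - ex * ez) with hyx
  have hee : e * ez * e = 0 := by
    have h := congrArg (fun a => e * a * e) hez
    have h' : e * (ez * e + e * ez) * e = e * ez * (e * e) + (e * e) * ez * e := by noncomm_ring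
    simp only [h', he] at h
    simpa using h
  have hez' : ez = y * e - e * y := by
    have : y * e - e * y = ez * (e * e) + (e * e) * ez - 2 * (e * ez * e) := by
      rw [hy]; noncomm_ring
    rw [this, he, hee, hez]; simp
  have hed' : ed = (ed * e - e * ed) * e - e * (ed * e - e * ed) := by
    have h := congrArg (fun a => e * a * e) hed
    have h' : e * (ed * e + e * ed) * e = e * ed * (e * e) + (e * e) * ed * e := by noncomm_ring
    simp only [h', he] at h
    have h0 : e * ed * e = 0 := by simpa using h
    have : (ed * e - e * ed) * e - e * (ed * e - e * ed)
        = ed * (e * e) + (e * e) * ed - 2 * (e * ed * e) := by noncomm_ring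
    rw [this, he, h0, hed]; simp
  have hezx' : ezx = yx * e - e * yx + (y * ex - ex * y) := by
    have h1 : e * ez * ex * e = e * ez * ex := by
      have : e * ez * ex * e = e * ez * (ex * e + e * ex) - (e * ez * e) * ex := by noncomm_ring
      rw [this, hex, hee]; simp
    have h2 : e * ex * ez * e = ex * ez * e := by
      have : e * ex * ez * e = (ex * e + e * ex) * ez * e - ex * (e * ez * e) := by noncomm_ring
      rw [this, hex, hee]; simp
    have hD : e * ezx * e + e * ez * ex + ex * ez * e = 0 := by
      have h := congrArg (fun a => e * a * e) hezx
      have h' : e * (ezx * e + ez * ex + ex * ez + e * ezx) * e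
          = e * ezx * (e * e) + e * ez * ex * e + e * ex * ez * e + (e * e) * ezx * e := by
        noncomm_ring
      simp only [h', he, h1, h2] at h
      rw [← sub_eq_zero] at h
      rw [← h]; noncomm_ring
    have : yx * e - e * yx + (y * ex - ex * y)
        = ezx * (e * e) + (e * e) * ezx + ez * (ex * e + e * ex) + (ex * e + e * ex) * ez
          - 2 * (e * ezx * e + e * ez * ex + ex * ez * e) := by
      rw [hy, hyx]; noncomm_ring
    rw [this, hD, he, hex]
    nth_rewrite 1 [← hezx]
    noncomm_ring
  -- Differentiating `∂_z e = [y, e]` in `x` and inserting `h1` and `h3` shows that this element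
  -- commutes with `e`. It is therefore trace-orthogonal to `δe`, which is a commutator with `e`.
  set C := z * z * yx - z * (y * γ - γ * y) - γ with hC
  have hCe : C * e = e * C := by
    have h4 : z * (yx * e - e * yx) = ez * γ - γ * ez - ex - z * (y * ex - ex * y) := by
      rw [← h3, hezx']; noncomm_ring
    have h5 : z * (y * ex - ex * y) = y * (z * ex) - (z * ex) * y := by
      rw [← mul_assoc y z, ← hz y]; noncomm_ring
    have h6 : z * (z * (yx * e - e * yx))
        = z * (ez * γ - γ * ez) - z * ex - z * (y * (z * ex) - (z * ex) * y) := by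
      rw [h4, h5]; noncomm_ring
    rw [h1] at h6
    have h7 : ez * γ - γ * ez = (y * e - e * y) * γ - γ * (y * e - e * y) := by rw [← hez']
    rw [h7] at h6
    refine sub_eq_zero.1 ?_
    have h8 : C * e - e * C = z * (z * (yx * e - e * yx))
        - z * ((y * γ - γ * y) * e - e * (y * γ - γ * y)) - (γ * e - e * γ)
        - ((e * z - z * e) * (z * yx) + z * (e * z - z * e) * yx
          - (e * z - z * e) * (y * γ - γ * y)) := by
      rw [hC]; noncomm_ring
    rw [h8, h6, hz e]
    noncomm_ring
  have hT0 : T (C * ed) = 0 := by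
    have : C * ed = C * (ed * e - e * ed) * e - e * (C * (ed * e - e * ed)) := by
      rw [← mul_assoc, ← hCe]
      nth_rewrite 1 [hed']
      noncomm_ring
    rw [this, map_sub, hT _ e, sub_self]
  have hTC : T (C * ed) = T (z * z * (yx * ed)) - T (z * (y * γ - γ * y) * ed) - T (γ * ed) := by
    rw [← map_sub, ← map_sub, hC]; congr 1; noncomm_ring
  -- Moving the bracket with `e` from `y` to `δγ` produces `[e, δγ]`, which `h2` expresses through
  -- `δe` and its `x`-derivative.
  have h9 : T (z * ez * γd) = T (z * (y * (e * γd - γd * e))) := by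
    have h10 : T (z * e * y * γd) = T (z * (y * γd * e)) := by
      rw [hz e, mul_assoc, mul_assoc, hT e]; congr 1; noncomm_ring
    have h11 : z * ez * γd = z * (y * e * γd) - z * e * y * γd := by
      nth_rewrite 1 [hez']; noncomm_ring
    rw [h11, map_sub, h10, ← map_sub]; congr 1; noncomm_ring
  have h12 : z * (y * (e * γd - γd * e)) = z * z * (y * exd) - z * y * ed * γ + z * y * γ * ed := by
    have h13 : e * γd - γd * e = z * exd - (ed * γ - γ * ed) := by rw [h2]; noncomm_ring
    have h14 : y * (z * exd) = z * (y * exd) := by rw [← mul_assoc, ← hz y, mul_assoc]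
    rw [h13, mul_sub, h14]; noncomm_ring
  have h15 : T (z * y * ed * γ) = T (z * γ * y * ed) := by
    rw [hT, ← mul_assoc, ← mul_assoc, ← hz γ]
  have h16 : T (z * (y * γ - γ * y) * ed) = T (z * y * γ * ed) - T (z * γ * y * ed) := by
    rw [← map_sub]; congr 1; noncomm_ring
  have h17 : z * z * (yx * ed + y * exd) = z * z * (yx * ed) + z * z * (y * exd) := by
    noncomm_ring
  rw [hT0, h16] at hTC
  rw [h9, h12, map_add, map_sub, h15, h17, map_add]
  rw [sub_sub, eq_comm, sub_eq_zero] at hTC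
  rw [hTC]
  abel

end TraceIdentity

/-! ### Spectral projections of the points of the adjoint orbit. -/

/-- The set of the values `d k`. -/
abbrev Spec (d : Fin n → ℝ) : Type := {r : ℝ // r ∈ Finset.univ.image d}

/-- The eigenvalues of `a`. -/
def eig (d : Fin n → ℝ) (r : Spec d) : ℂ := Complex.I * (r.1 : ℂ)

/-- The polynomial in `y` which is a spectral projection if `y` lies on the orbit of `a`. -/
def specProj (d : Fin n → ℝ) (y : Mat n) (r : Spec d) : Mat n :=
  Polynomial.aeval y (Lagrange.basis Finset.univ (eig d) r)

theorem eig_injective (d : Fin n → ℝ) : Function.Injective (eig d) := by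
  intro r s h
  exact Subtype.ext (Complex.ofReal_injective (mul_left_cancel₀ Complex.I_ne_zero h))

/-- The value `d k` as an element of `Spec d`. -/
def specOf (d : Fin n → ℝ) (k : Fin n) : Spec d := ⟨d k, by simp⟩

theorem base_eq (d : Fin n → ℝ) : base d = Matrix.diagonal fun k => eig d (specOf d k) := rfl

theorem specProj_base (d : Fin n → ℝ) (r : Spec d) :
    specProj d (base d) r = Matrix.diagonal fun k => if specOf d k = r then 1 else 0 := by
  have h : ∀ p : Polynomial ℂ, Polynomial.aeval (base d) p
      = Matrix.diagonal fun k => p.eval (eig d (specOf d k)) := by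
    intro p
    have := Polynomial.aeval_algHom_apply (Matrix.diagonalAlgHom ℂ (n := Fin n) (α := ℂ))
      (fun k => eig d (specOf d k)) p
    rw [base_eq]
    refine this.trans ?_
    show Matrix.diagonal _ = _
    congr 1
    ext k
    have := Polynomial.aeval_algHom_apply (Pi.evalAlgHom ℂ (fun _ : Fin n => ℂ) k)
      (fun k => eig d (specOf d k)) p
    rw [Pi.evalAlgHom_apply, Pi.evalAlgHom_apply] at this
    rw [← this, Polynomial.coe_aeval_eq_eval]
  rw [specProj, h]
  congr 1
  ext k
  split_ifs with hk
  · rw [hk, Lagrange.eval_basis_self (eig_injective d).injOn (Finset.mem_univ _)]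
  · rw [Lagrange.eval_basis_of_ne (Ne.symm hk) (Finset.mem_univ _)]

/-- The adjoint orbit of `a`. -/
def InOrbit (d : Fin n → ℝ) (y : Mat n) : Prop :=
  ∃ U ∈ Matrix.unitaryGroup (Fin n) ℂ, y = U * base d * Uᴴ

theorem unitary_star_mul {U : Mat n} (hU : U ∈ Matrix.unitaryGroup (Fin n) ℂ) : Uᴴ * U = 1 :=
  Matrix.mem_unitaryGroup_iff'.1 hU

theorem unitary_mul_star {U : Mat n} (hU : U ∈ Matrix.unitaryGroup (Fin n) ℂ) : U * Uᴴ = 1 :=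
  Matrix.mem_unitaryGroup_iff.1 hU

/-- Conjugation by a unitary matrix, as an algebra homomorphism. -/
def conjHom (U : Mat n) (hU : U ∈ Matrix.unitaryGroup (Fin n) ℂ) : Mat n →ₐ[ℂ] Mat n :=
  ((Unitary.conjStarAlgAut ℂ (Mat n) ⟨U, hU⟩ : Mat n ≃⋆ₐ[ℂ] Mat n) : Mat n →⋆ₐ[ℂ] Mat n).toAlgHom

theorem conjHom_apply (U : Mat n) (hU : U ∈ Matrix.unitaryGroup (Fin n) ℂ) (X : Mat n) :
    conjHom U hU X = U * X * Uᴴ := rfl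

/-- Polynomials in `y` commute with algebra homomorphisms. This transports the spectral calculus
from the diagonal matrix `a` to its whole orbit without choosing the conjugating unitary. -/
theorem specProj_conj (d : Fin n → ℝ) {U : Mat n} (hU : U ∈ Matrix.unitaryGroup (Fin n) ℂ)
    (y : Mat n) (r : Spec d) : specProj d (U * y * Uᴴ) r = U * specProj d y r * Uᴴ := by
  rw [← conjHom_apply U hU, ← conjHom_apply U hU]
  exact Polynomial.aeval_algHom_apply (conjHom U hU) y _

theorem isSpectral_base (d : Fin n → ℝ) : IsSpectral (eig d) (specProj d (base d)) (base d) where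
  inj := eig_injective d
  sum := by
    ext k l
    simp only [specProj_base, Matrix.sum_apply, Matrix.diagonal_apply, Matrix.one_apply]
    split_ifs with h <;> simp
  mul i j := by
    rw [specProj_base, specProj_base, Matrix.diagonal_mul_diagonal]
    split_ifs with h
    · subst h; simp
    · ext k l
      simp only [Matrix.diagonal_apply, Matrix.zero_apply]
      split_ifs <;> simp_all
  eq := by
    nth_rewrite 1 [base_eq]
    ext k l
    simp only [specProj_base, Matrix.sum_apply, Matrix.smul_apply, Matrix.diagonal_apply]
    split_ifs with h <;> simp

theorem IsSpectral.map {ι R S : Type*} [Fintype ι] [DecidableEq ι] [Ring R] [Algebra ℂ R] [Ring S]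
    [Algebra ℂ S] {c : ι → ℂ} {P : ι → R} {y : R} (h : IsSpectral c P y) (f : R →ₐ[ℂ] S) :
    IsSpectral c (fun i => f (P i)) (f y) where
  inj := h.inj
  sum := by rw [← map_sum, h.sum, map_one]
  mul i j := by rw [← map_mul, h.mul]; split_ifs <;> simp
  eq := by nth_rewrite 1 [h.eq]; simp

theorem InOrbit.isSpectral {d : Fin n → ℝ} {y : Mat n} (hy : InOrbit d y) :
    IsSpectral (eig d) (specProj d y) y := by
  obtain ⟨U, hU, rfl⟩ := hy
  have := (isSpectral_base d).map (conjHom U hU)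
  have h : specProj d (U * base d * Uᴴ) = fun r => conjHom U hU (specProj d (base d) r) := by
    ext1 r; rw [specProj_conj d hU, conjHom_apply]
  rw [h]
  exact this

theorem InOrbit.star_specProj {d : Fin n → ℝ} {y : Mat n} (hy : InOrbit d y) (r : Spec d) :
    (specProj d y r)ᴴ = specProj d y r := by
  obtain ⟨U, hU, rfl⟩ := hy
  rw [specProj_conj d hU, specProj_base]
  simp only [Matrix.conjTranspose_mul, Matrix.conjTranspose_conjTranspose,
    Matrix.diagonal_conjTranspose, mul_assoc]
  congr 3
  ext k
  simp only [Pi.star_apply]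
  split_ifs <;> simp

theorem base_skew (d : Fin n → ℝ) : IsSkew (base d) := by
  ext k l
  simp only [base, Matrix.conjTranspose_apply, Matrix.diagonal_apply, Matrix.neg_apply]
  by_cases h : k = l
  · subst h; simp
  · simp [h, Ne.symm h]

theorem IsSkew.conj {X U : Mat n} (hX : IsSkew X) : IsSkew (U * X * Uᴴ) := by
  unfold IsSkew at *
  simp [Matrix.conjTranspose_mul, hX, mul_assoc]

theorem InOrbit.isSkew {d : Fin n → ℝ} {y : Mat n} (hy : InOrbit d y) : IsSkew y := by
  obtain ⟨U, hU, rfl⟩ := hy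
  exact (base_skew d).conj

/-- Block diagonal part with respect to the eigenspaces of `y`. -/
abbrev bd (d : Fin n → ℝ) (y X : Mat n) : Mat n := blockDiag (specProj d y) X

/-- Inverse of `ad y` on block off-diagonal matrices. -/
abbrev adY (d : Fin n → ℝ) (y X : Mat n) : Mat n := adI (eig d) (specProj d y) X

theorem bd_base (d : Fin n → ℝ) (X : Mat n) : bd d (base d) X = projC d X := by
  ext k l
  simp only [bd, blockDiag, specProj_base, Matrix.sum_apply, Matrix.diagonal_mul,
    Matrix.mul_diagonal, projC, Matrix.of_apply]
  simp [specOf]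
  split_ifs <;> simp_all [eq_comm]

theorem adY_base (d : Fin n → ℝ) (X : Mat n) : adY d (base d) X = adInv d X := by
  ext k l
  simp only [adY, adI, specProj_base, Matrix.sum_apply, Matrix.smul_apply, Matrix.diagonal_mul,
    Matrix.mul_diagonal, adInv, Matrix.of_apply]
  rw [Finset.sum_eq_single (specOf d k) (fun r _ hr => by simp [Ne.symm hr]) (by simp),
    Finset.sum_eq_single (specOf d l) (fun r _ hr => by simp [Ne.symm hr]) (by simp)]
  simp only [eig, specOf, if_true, one_mul, mul_one, smul_eq_mul]
  split_ifs with h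
  · simp [h]
  · rw [← mul_sub, div_eq_mul_inv, mul_comm]

theorem bd_conj (d : Fin n → ℝ) {U : Mat n} (hU : U ∈ Matrix.unitaryGroup (Fin n) ℂ)
    (y X : Mat n) : bd d (U * y * Uᴴ) X = U * bd d y (Uᴴ * X * U) * Uᴴ := by
  simp only [bd, blockDiag, specProj_conj d hU, Finset.mul_sum, Finset.sum_mul]
  simp only [mul_assoc]

theorem adY_conj (d : Fin n → ℝ) {U : Mat n} (hU : U ∈ Matrix.unitaryGroup (Fin n) ℂ)
    (y X : Mat n) : adY d (U * y * Uᴴ) X = U * adY d y (Uᴴ * X * U) * Uᴴ := by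
  simp only [adY, adI, specProj_conj d hU, Finset.mul_sum, Finset.sum_mul, mul_smul_comm,
    smul_mul_assoc]
  simp only [mul_assoc]

theorem conj_conj' {U : Mat n} (hU : U ∈ Matrix.unitaryGroup (Fin n) ℂ) (X : Mat n) :
    Uᴴ * (U * X * Uᴴ) * U = X := by
  have : Uᴴ * (U * X * Uᴴ) * U = (Uᴴ * U) * X * (Uᴴ * U) := by noncomm_ring
  rw [this, unitary_star_mul hU]; simp

theorem conj_conj {U : Mat n} (hU : U ∈ Matrix.unitaryGroup (Fin n) ℂ) (X : Mat n) :
    U * (Uᴴ * X * U) * Uᴴ = X := by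
  have : U * (Uᴴ * X * U) * Uᴴ = (U * Uᴴ) * X * (U * Uᴴ) := by noncomm_ring
  rw [this, unitary_mul_star hU]; simp

theorem projC_conj (d : Fin n → ℝ) {U : Mat n} (hU : U ∈ Matrix.unitaryGroup (Fin n) ℂ)
    (X : Mat n) : projC d (Uᴴ * X * U) = Uᴴ * bd d (U * base d * Uᴴ) X * U := by
  rw [bd_conj d hU, conj_conj' hU, bd_base]

theorem InOrbit.skew_bd {d : Fin n → ℝ} {y X : Mat n} (hy : InOrbit d y) (hX : IsSkew X) :
    IsSkew (bd d y X) := by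
  unfold IsSkew at *
  simp [bd, blockDiag, Matrix.conjTranspose_sum, Matrix.conjTranspose_mul, hX, hy.star_specProj,
    mul_assoc]

theorem InOrbit.star_bd {d : Fin n → ℝ} {y X : Mat n} (hy : InOrbit d y) :
    (bd d y X)ᴴ = bd d y Xᴴ := by
  simp [bd, blockDiag, Matrix.conjTranspose_sum, Matrix.conjTranspose_mul, hy.star_specProj,
    mul_assoc]

/-- Transposition swaps the blocks `(i, j)` and `(j, i)` and conjugates `(c i - c j)⁻¹`. Since the
eigenvalues are imaginary, the two sign changes cancel. -/
theorem InOrbit.star_adY {d : Fin n → ℝ} {y X : Mat n} (hy : InOrbit d y) :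
    (adY d y X)ᴴ = adY d y Xᴴ := by
  simp only [adY, adI, Matrix.conjTranspose_sum, Matrix.conjTranspose_smul,
    Matrix.conjTranspose_mul, hy.star_specProj]
  rw [Finset.sum_comm]
  refine Finset.sum_congr rfl fun i _ => Finset.sum_congr rfl fun j _ => ?_
  rw [← mul_assoc]
  congr 1
  simp only [eig, star_inv₀, star_sub, RCLike.star_def, map_mul, Complex.conj_I,
    Complex.conj_ofReal]
  congr 1
  ring

theorem InOrbit.tangent_iff {d : Fin n → ℝ} {y X : Mat n} (hy : InOrbit d y) :
    (∃ Z : Mat n, IsSkew Z ∧ X = ⁅Z, y⁆) ↔ IsSkew X ∧ bd d y X = 0 := by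
  constructor
  · rintro ⟨Z, hZ, rfl⟩
    refine ⟨?_, hy.isSpectral.blockDiag_lie' Z⟩
    have := hy.isSkew
    unfold IsSkew at *
    simp [Ring.lie_def, Matrix.conjTranspose_mul, this, hZ]
  · rintro ⟨hX, h0⟩
    refine ⟨-adY d y X, ?_, ?_⟩
    · unfold IsSkew at *
      simp only [Matrix.conjTranspose_neg, hy.star_adY, hX, adI_neg, adY]
    · rw [ring_lie_skew, Ring.lie_def, mul_neg, neg_mul, ← neg_sub', neg_neg, ← Ring.lie_def,
        hy.isSpectral.lie_adI, show blockDiag _ X = _ from h0, sub_zero]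

/-- Block diagonal matrices are trace-orthogonal to block off-diagonal ones. -/
theorem trForm_bd {d : Fin n → ℝ} {y X V : Mat n} (hV : bd d y V = 0) :
    trForm (bd d y X) V = 0 := by
  have : Matrix.trace (bd d y X * V) = Matrix.trace (X * bd d y V) := by
    simp only [bd, blockDiag, Finset.sum_mul, Finset.mul_sum, Matrix.trace_sum]
    refine Finset.sum_congr rfl fun i _ => ?_
    rw [mul_assoc, mul_assoc, Matrix.trace_mul_comm]
    simp only [mul_assoc]
  rw [trForm, this, hV]; simp

theorem trForm_conj {U : Mat n} (hU : U ∈ Matrix.unitaryGroup (Fin n) ℂ) (X Y : Mat n) :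
    trForm (Uᴴ * X * U) (Uᴴ * Y * U) = trForm X Y := by
  have : Uᴴ * X * U * (Uᴴ * Y * U) = Uᴴ * (X * (U * Uᴴ) * Y * U) := by noncomm_ring
  rw [trForm, this, unitary_mul_star hU, Matrix.trace_mul_comm, mul_assoc, mul_assoc,
    unitary_mul_star hU, mul_one, mul_one, trForm]

/-! ### Smooth one-parameter families with uniform decay in `x`. -/

theorem iteratedDeriv_succ_mat (m : ℕ) (f : ℝ → Mat n) :
    iteratedDeriv (m + 1) f = iteratedDeriv m (deriv f) := iteratedDeriv_succ'

/-- The `x`-derivative of a family. -/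
def dX (F : ℝ → ℝ → Mat n) : ℝ → ℝ → Mat n := fun ε x => deriv (F ε) x

/-- The derivative of a family in the parameter. -/
def dE (F : ℝ → ℝ → Mat n) : ℝ → ℝ → Mat n := fun ε x => deriv (fun e => F e x) ε

/-- Joint smoothness of a family. -/
def SmoothFam (F : ℝ → ℝ → Mat n) : Prop := ContDiff ℝ ∞ fun p : ℝ × ℝ => F p.1 p.2

namespace SmoothFam

variable {F G : ℝ → ℝ → Mat n} (hF : SmoothFam F) (hG : SmoothFam G)
include hF

theorem differentiable : Differentiable ℝ fun p : ℝ × ℝ => F p.1 p.2 :=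
  ContDiff.differentiable hF (by simp)

theorem slice (ε : ℝ) : ContDiff ℝ ∞ (F ε) :=
  ContDiff.comp (g := fun p : ℝ × ℝ => F p.1 p.2) hF (contDiff_const.prodMk contDiff_id)

theorem slice' (x : ℝ) : ContDiff ℝ ∞ (fun ε => F ε x) :=
  ContDiff.comp (g := fun p : ℝ × ℝ => F p.1 p.2) hF (contDiff_id.prodMk contDiff_const)

theorem hasDerivAt_fderiv (ε x : ℝ) :
    HasDerivAt (F ε) (fderiv ℝ (fun p : ℝ × ℝ => F p.1 p.2) (ε, x) (0, 1)) x :=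
  (hF.differentiable (ε, x)).hasFDerivAt.comp_hasDerivAt x
    ((hasDerivAt_const x ε).prodMk (hasDerivAt_id x))

theorem hasDerivAt_fderiv' (ε x : ℝ) :
    HasDerivAt (fun e => F e x) (fderiv ℝ (fun p : ℝ × ℝ => F p.1 p.2) (ε, x) (1, 0)) ε :=
  (hF.differentiable (ε, x)).hasFDerivAt.comp_hasDerivAt (f := fun e => (e, x)) ε
    ((hasDerivAt_id ε).prodMk (hasDerivAt_const ε x))

theorem hasDerivAt_dX (ε x : ℝ) : HasDerivAt (F ε) (dX F ε x) x :=
  (hF.hasDerivAt_fderiv ε x).differentiableAt.hasDerivAt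

theorem hasDerivAt_dE (ε x : ℝ) : HasDerivAt (fun e => F e x) (dE F ε x) ε :=
  (hF.hasDerivAt_fderiv' ε x).differentiableAt.hasDerivAt

theorem dX_eq : dX F = fun ε x => fderiv ℝ (fun p : ℝ × ℝ => F p.1 p.2) (ε, x) (0, 1) := by
  ext1 ε; ext1 x; exact (hF.hasDerivAt_fderiv ε x).deriv

theorem dE_eq : dE F = fun ε x => fderiv ℝ (fun p : ℝ × ℝ => F p.1 p.2) (ε, x) (1, 0) := by
  ext1 ε; ext1 x; exact (hF.hasDerivAt_fderiv' ε x).deriv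

theorem dX : SmoothFam (dX F) := by
  rw [hF.dX_eq]
  exact (ContDiff.fderiv_right hF (by simp)).clm_apply contDiff_const

theorem dE : SmoothFam (dE F) := by
  rw [hF.dE_eq]
  exact (ContDiff.fderiv_right hF (by simp)).clm_apply contDiff_const

/-- Symmetry of the second Fréchet derivative of the jointly smooth function, evaluated on the two
coordinate vectors. -/
theorem dE_dX : GNLS.dE (GNLS.dX F) = GNLS.dX (GNLS.dE F) := by
  have h2 : Differentiable ℝ (fderiv ℝ fun p : ℝ × ℝ => F p.1 p.2) :=
    (ContDiff.fderiv_right hF (m := ∞) (by simp)).differentiable (by simp)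
  have h3 : ∀ (v : ℝ × ℝ) (p : ℝ × ℝ), HasFDerivAt
      (fun q => fderiv ℝ (fun p : ℝ × ℝ => F p.1 p.2) q v)
      ((fderiv ℝ (fderiv ℝ fun p : ℝ × ℝ => F p.1 p.2) p).flip v) p := by
    intro v p
    refine ((h2 p).hasFDerivAt.clm_apply (hasFDerivAt_const v p)).congr_fderiv ?_
    refine ContinuousLinearMap.ext fun w => ?_
    simp only [_root_.add_apply, add_eq_right]
    exact map_zero (fderiv ℝ (fun p : ℝ × ℝ => F p.1 p.2) p)
  rw [hF.dX.dE_eq, hF.dE.dX_eq]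
  ext1 ε; ext1 x
  have e1 : (fun p : ℝ × ℝ => GNLS.dX F p.1 p.2)
      = fun q => fderiv ℝ (fun p : ℝ × ℝ => F p.1 p.2) q (0, 1) := by rw [hF.dX_eq]
  have e2 : (fun p : ℝ × ℝ => GNLS.dE F p.1 p.2)
      = fun q => fderiv ℝ (fun p : ℝ × ℝ => F p.1 p.2) q (1, 0) := by rw [hF.dE_eq]
  rw [e1, e2]
  have hs : IsSymmSndFDerivAt ℝ (fun p : ℝ × ℝ => F p.1 p.2) (ε, x) :=
    ContDiffAt.isSymmSndFDerivAt (n := ∞) (ContDiff.contDiffAt hF)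
      (by rw [minSmoothness_of_isRCLikeNormedField]; exact WithTop.coe_le_coe.2 le_top)
  exact (congrArg (fun L => L (1, 0)) (h3 (0, 1) (ε, x)).fderiv).trans
    ((hs (1, 0) (0, 1)).trans (congrArg (fun L => L (0, 1)) (h3 (1, 0) (ε, x)).fderiv).symm)

include hG

theorem add : SmoothFam fun ε x => F ε x + G ε x := ContDiff.add hF hG

theorem mul : SmoothFam fun ε x => F ε x * G ε x := ContDiff.mul hF hG

theorem dX_add : GNLS.dX (fun ε x => F ε x + G ε x) = fun ε x => GNLS.dX F ε x + GNLS.dX G ε x := by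
  ext1 ε; ext1 x; exact ((hF.hasDerivAt_dX ε x).add (hG.hasDerivAt_dX ε x)).deriv

theorem dX_mul : GNLS.dX (fun ε x => F ε x * G ε x)
    = fun ε x => GNLS.dX F ε x * G ε x + F ε x * GNLS.dX G ε x := by
  ext1 ε; ext1 x; exact ((hF.hasDerivAt_dX ε x).mul (hG.hasDerivAt_dX ε x)).deriv

theorem dE_add : GNLS.dE (fun ε x => F ε x + G ε x) = fun ε x => GNLS.dE F ε x + GNLS.dE G ε x := by
  ext1 ε; ext1 x; exact ((hF.hasDerivAt_dE ε x).add (hG.hasDerivAt_dE ε x)).deriv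

theorem dE_mul : GNLS.dE (fun ε x => F ε x * G ε x)
    = fun ε x => GNLS.dE F ε x * G ε x + F ε x * GNLS.dE G ε x := by
  ext1 ε; ext1 x; exact ((hF.hasDerivAt_dE ε x).mul (hG.hasDerivAt_dE ε x)).deriv

end SmoothFam

/-- All `x`-derivatives of the family are `O(|x|^{-k})`, for the `k` in `K`, uniformly for
parameters in `[-1, 1]`. -/
def XBound (K : Set ℕ) (F : ℝ → ℝ → Mat n) : Prop :=
  ∀ k ∈ K, ∀ m : ℕ, ∃ C : ℝ, ∀ ε ∈ Set.Icc (-1 : ℝ) 1, ∀ x : ℝ,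
    |x| ^ k * ‖iteratedDeriv m (F ε) x‖ ≤ C

theorem XBound.dX {K : Set ℕ} {F : ℝ → ℝ → Mat n} (h : XBound K F) : XBound K (dX F) := by
  intro k hk m
  obtain ⟨C, hC⟩ := h k hk (m + 1)
  refine ⟨C, fun ε hε x => ?_⟩
  have := hC ε hε x
  rwa [iteratedDeriv_succ_mat] at this

theorem XBound.mono {K K' : Set ℕ} {F : ℝ → ℝ → Mat n} (h : XBound K F) (hK : K' ⊆ K) :
    XBound K' F := fun k hk => h k (hK hk)

theorem XBound.add {K : Set ℕ} {F G : ℝ → ℝ → Mat n} (hF : SmoothFam F) (hG : SmoothFam G)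
    (h : XBound K F) (h' : XBound K G) : XBound K (fun ε x => F ε x + G ε x) := by
  intro k hk m
  obtain ⟨C, hC⟩ := h k hk m
  obtain ⟨C', hC'⟩ := h' k hk m
  refine ⟨C + C', fun ε hε x => ?_⟩
  have e : iteratedDeriv m (fun x => F ε x + G ε x) x
      = iteratedDeriv m (F ε) x + iteratedDeriv m (G ε) x :=
    iteratedDeriv_fun_add ((hF.slice ε).contDiffAt.of_le (by exact_mod_cast le_top))
      ((hG.slice ε).contDiffAt.of_le (by exact_mod_cast le_top))
  rw [e]
  calc _ ≤ |x| ^ k * (‖iteratedDeriv m (F ε) x‖ + ‖iteratedDeriv m (G ε) x‖) := by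
        gcongr; exact norm_add_le _ _
    _ ≤ _ := by rw [mul_add]; exact add_le_add (hC ε hε x) (hC' ε hε x)

/-- Leibniz rule by induction on the order of the derivative: one factor carries the weight `|x| ^
k`, the other needs only boundedness. Both orders of the product are treated together because
matrices do not commute. -/
theorem XBound.mul_aux {k : ℕ} (m : ℕ) : ∀ {F G : ℝ → ℝ → Mat n}, SmoothFam F → SmoothFam G →
    XBound {k} F → XBound {0} G →
    ∃ C : ℝ, ∀ ε ∈ Set.Icc (-1 : ℝ) 1, ∀ x : ℝ,
      |x| ^ k * ‖iteratedDeriv m (fun y => F ε y * G ε y) x‖ ≤ C ∧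
      |x| ^ k * ‖iteratedDeriv m (fun y => G ε y * F ε y) x‖ ≤ C := by
  induction m with
  | zero =>
    intro F G _ _ h h'
    obtain ⟨C, hC⟩ := h k rfl 0
    obtain ⟨C', hC'⟩ := h' 0 rfl 0
    refine ⟨C * C', fun ε hε x => ?_⟩
    have h1 := hC ε hε x
    have h2 := hC' ε hε x
    simp only [iteratedDeriv_zero, pow_zero, one_mul] at h1 h2 ⊢
    have hp : 0 ≤ |x| ^ k * ‖F ε x‖ := by positivity
    have hk : (0 : ℝ) ≤ |x| ^ k := by positivity
    have h3 : |x| ^ k * ‖F ε x‖ * ‖G ε x‖ ≤ C * C' :=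
      mul_le_mul h1 h2 (norm_nonneg _) (hp.trans h1)
    constructor
    · calc _ ≤ |x| ^ k * (‖F ε x‖ * ‖G ε x‖) := by gcongr; exact norm_mul_le _ _
        _ ≤ _ := by rw [← mul_assoc]; exact h3
    · calc _ ≤ |x| ^ k * (‖G ε x‖ * ‖F ε x‖) := by gcongr; exact norm_mul_le _ _
        _ ≤ _ := by rw [mul_comm ‖G ε x‖, ← mul_assoc]; exact h3
  | succ m ih =>
    intro F G hF hG h h'
    obtain ⟨C, hC⟩ := ih hF.dX hG h.dX h'
    obtain ⟨C', hC'⟩ := ih hF hG.dX h h'.dX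
    refine ⟨C + C', fun ε hε x => ?_⟩
    have e1 : deriv (fun y => F ε y * G ε y) = fun y => GNLS.dX F ε y * G ε y + F ε y * GNLS.dX G ε y := by
      ext1 y; exact ((hF.hasDerivAt_dX ε y).mul (hG.hasDerivAt_dX ε y)).deriv
    have e2 : deriv (fun y => G ε y * F ε y) = fun y => GNLS.dX G ε y * F ε y + G ε y * GNLS.dX F ε y := by
      ext1 y; exact ((hG.hasDerivAt_dX ε y).mul (hF.hasDerivAt_dX ε y)).deriv
    have c : ∀ {A B : ℝ → ℝ → Mat n}, SmoothFam A → SmoothFam B →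
        ContDiffAt ℝ m (fun y => A ε y * B ε y) x := fun hA hB =>
      ((hA.mul hB).slice ε).contDiffAt.of_le (by exact_mod_cast le_top)
    rw [iteratedDeriv_succ_mat, iteratedDeriv_succ_mat, e1, e2,
      iteratedDeriv_fun_add (c hF.dX hG) (c hF hG.dX), iteratedDeriv_fun_add (c hG.dX hF) (c hG hF.dX)]
    have hk : (0 : ℝ) ≤ |x| ^ k := by positivity
    obtain ⟨a1, a2⟩ := hC ε hε x
    obtain ⟨b1, b2⟩ := hC' ε hε x
    constructor
    · refine (mul_le_mul_of_nonneg_left (norm_add_le _ _) hk).trans ?_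
      rw [mul_add]; exact add_le_add a1 b1
    · refine (mul_le_mul_of_nonneg_left (norm_add_le _ _) hk).trans ?_
      rw [mul_add, add_comm C]; exact add_le_add b2 a2

theorem XBound.mul_left {K : Set ℕ} {F G : ℝ → ℝ → Mat n} (hF : SmoothFam F) (hG : SmoothFam G)
    (h : XBound K F) (h' : XBound {0} G) : XBound K (fun ε x => F ε x * G ε x) := by
  intro k hk m
  obtain ⟨C, hC⟩ := XBound.mul_aux m hF hG (h.mono (Set.singleton_subset_iff.2 hk)) h'
  exact ⟨C, fun ε hε x => (hC ε hε x).1⟩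

theorem XBound.mul_right {K : Set ℕ} {F G : ℝ → ℝ → Mat n} (hF : SmoothFam F) (hG : SmoothFam G)
    (h : XBound {0} F) (h' : XBound K G) : XBound K (fun ε x => F ε x * G ε x) := by
  intro k hk m
  obtain ⟨C, hC⟩ := XBound.mul_aux m hG hF (h'.mono (Set.singleton_subset_iff.2 hk)) h
  exact ⟨C, fun ε hε x => (hC ε hε x).2⟩

/-- Smooth families bounded, with all their `x`-derivatives and the first parameter derivative of
these, by `C |x|^{-k}` for the `k` in `K`. -/
structure Ctrl (K : Set ℕ) (F : ℝ → ℝ → Mat n) : Prop where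
  smooth : SmoothFam F
  bound : XBound K F
  bound_dE : XBound K (dE F)

/-- Families bounded together with their derivatives. -/
abbrev Tame (F : ℝ → ℝ → Mat n) : Prop := Ctrl {0} F

/-- Families of Schwartz functions. -/
abbrev Rapid (F : ℝ → ℝ → Mat n) : Prop := Ctrl Set.univ F

namespace Ctrl

variable {K : Set ℕ} {F G : ℝ → ℝ → Mat n}

theorem mono {K' : Set ℕ} (h : Ctrl K F) (hK : K' ⊆ K) : Ctrl K' F :=
  ⟨h.smooth, h.bound.mono hK, h.bound_dE.mono hK⟩

theorem tame (h : Rapid F) : Tame F := h.mono (Set.subset_univ _)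

theorem dX (h : Ctrl K F) : Ctrl K (dX F) :=
  ⟨h.smooth.dX, h.bound.dX, by rw [h.smooth.dE_dX]; exact h.bound_dE.dX⟩

theorem add (h : Ctrl K F) (h' : Ctrl K G) : Ctrl K fun ε x => F ε x + G ε x :=
  ⟨h.smooth.add h'.smooth, h.bound.add h.smooth h'.smooth h'.bound, by
    rw [h.smooth.dE_add h'.smooth]
    exact h.bound_dE.add h.smooth.dE h'.smooth.dE h'.bound_dE⟩

theorem mul_tame (h : Ctrl K F) (h' : Tame G) : Ctrl K fun ε x => F ε x * G ε x :=
  ⟨h.smooth.mul h'.smooth, h.bound.mul_left h.smooth h'.smooth h'.bound, by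
    rw [h.smooth.dE_mul h'.smooth]
    exact (h.bound_dE.mul_left h.smooth.dE h'.smooth h'.bound).add
      (h.smooth.dE.mul h'.smooth) (h.smooth.mul h'.smooth.dE)
      (h.bound.mul_left h.smooth h'.smooth.dE h'.bound_dE)⟩

theorem tame_mul (h : Tame F) (h' : Ctrl K G) : Ctrl K fun ε x => F ε x * G ε x :=
  ⟨h.smooth.mul h'.smooth, XBound.mul_right h.smooth h'.smooth h.bound h'.bound, by
    rw [h.smooth.dE_mul h'.smooth]
    exact (XBound.mul_right h.smooth.dE h'.smooth h.bound_dE h'.bound).add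
      (h.smooth.dE.mul h'.smooth) (h.smooth.mul h'.smooth.dE)
      (XBound.mul_right h.smooth h'.smooth.dE h.bound h'.bound_dE)⟩

theorem zero : Ctrl K fun _ _ => (0 : Mat n) := by
  have : dE (fun _ _ => (0 : Mat n)) = fun _ _ => 0 := by
    ext1 ε; ext1 x; exact deriv_const _ _
  have h0 : XBound K fun _ _ => (0 : Mat n) := by
    intro k _ m
    exact ⟨0, fun ε _ x => by simp⟩
  exact ⟨contDiff_const, h0, by rw [this]; exact h0⟩

theorem const (A : Mat n) : Tame fun _ _ => A := by
  refine ⟨contDiff_const, ?_, ?_⟩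
  · intro k hk m
    obtain rfl : k = 0 := hk
    cases m with
    | zero => exact ⟨‖A‖, fun ε _ x => by simp⟩
    | succ m => exact ⟨0, fun ε _ x => by simp [iteratedDeriv_const]⟩
  · have : dE (fun _ _ => A) = fun _ _ => 0 := by
      ext1 ε; ext1 x; exact deriv_const _ _
    rw [this]
    exact zero.bound

theorem smul (c : ℂ) (h : Ctrl K F) : Ctrl K fun ε x => c • F ε x := by
  simpa using (const (c • (1 : Mat n))).tame_mul h

theorem neg (h : Ctrl K F) : Ctrl K fun ε x => -F ε x := by
  simpa using h.smul (-1)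

theorem sub (h : Ctrl K F) (h' : Ctrl K G) : Ctrl K fun ε x => F ε x - G ε x := by
  simpa [sub_eq_add_neg] using h.add h'.neg

theorem sum {ι : Type*} (s : Finset ι) {f : ι → ℝ → ℝ → Mat n} (h : ∀ i ∈ s, Ctrl K (f i)) :
    Ctrl K fun ε x => ∑ i ∈ s, f i ε x := by
  classical
  induction s using Finset.induction_on with
  | empty => simpa using zero
  | insert a s ha ih =>
    simp only [Finset.sum_insert ha]
    exact (h a (by simp)).add (ih fun i hi => h i (by simp [hi]))

end Ctrl

/-- Tame families with rapidly decreasing `x`-derivative. -/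
structure Asym (F : ℝ → ℝ → Mat n) : Prop where
  tame : Tame F
  rapid : Rapid (dX F)

namespace Asym

variable {F G : ℝ → ℝ → Mat n}

theorem const (A : Mat n) : Asym fun _ _ => A := by
  refine ⟨.const A, ?_⟩
  have : dX (fun _ _ => A) = fun _ _ => 0 := by ext1 ε; ext1 x; exact deriv_const _ _
  rw [this]; exact .zero

theorem add (h : Asym F) (h' : Asym G) : Asym fun ε x => F ε x + G ε x :=
  ⟨h.tame.add h'.tame, by
    rw [h.tame.smooth.dX_add h'.tame.smooth]; exact h.rapid.add h'.rapid⟩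

theorem mul (h : Asym F) (h' : Asym G) : Asym fun ε x => F ε x * G ε x :=
  ⟨h.tame.mul_tame h'.tame, by
    rw [h.tame.smooth.dX_mul h'.tame.smooth]
    exact (h.rapid.mul_tame h'.tame).add (h.tame.tame_mul h'.rapid)⟩

theorem aeval (h : Asym F) (p : Polynomial ℂ) : Asym fun ε x => Polynomial.aeval (F ε x) p := by
  induction p using Polynomial.induction_on with
  | C a => simpa using const (algebraMap ℂ (Mat n) a)
  | add p q hp hq => simpa using hp.add hq
  | monomial k a hk =>
    have := hk.mul h
    simpa [pow_succ, mul_assoc] using this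

end Asym

/-! ### Schwartz functions, paths and variations as controlled families. -/

theorem isSchwartz_iff {f : ℝ → Mat n} : IsSchwartz f ↔ ContDiff ℝ ∞ f ∧
    ∀ k m : ℕ, ∃ C : ℝ, ∀ x : ℝ, |x| ^ k * ‖iteratedDeriv m f x‖ ≤ C := by
  constructor
  · rintro ⟨s, hs⟩
    obtain rfl : (s : ℝ → Mat n) = f := funext hs
    refine ⟨s.smooth', fun k m => ?_⟩
    obtain ⟨C, hC⟩ := s.decay' k m
    refine ⟨C, fun x => ?_⟩
    have := hC x
    rwa [norm_iteratedFDeriv_eq_norm_iteratedDeriv, Real.norm_eq_abs] at this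
  · rintro ⟨h1, h2⟩
    refine ⟨⟨f, h1, fun k m => ?_⟩, fun _ => rfl⟩
    obtain ⟨C, hC⟩ := h2 k m
    refine ⟨C, fun x => ?_⟩
    rw [norm_iteratedFDeriv_eq_norm_iteratedDeriv, Real.norm_eq_abs]
    exact hC x

theorem Ctrl.isSchwartz {F : ℝ → ℝ → Mat n} (h : Rapid F) {ε : ℝ} (hε : ε ∈ Set.Icc (-1 : ℝ) 1) :
    IsSchwartz (F ε) :=
  isSchwartz_iff.2 ⟨h.smooth.slice ε, fun k m => by
    obtain ⟨C, hC⟩ := h.bound k trivial m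
    exact ⟨C, hC ε hε⟩⟩

theorem IsSchwartz.rapid {f : ℝ → Mat n} (h : IsSchwartz f) : Rapid fun _ => f := by
  obtain ⟨h1, h2⟩ := isSchwartz_iff.1 h
  have : dE (fun _ : ℝ => f) = fun _ _ => 0 := by
    ext1 ε; ext1 x; exact deriv_const _ _
  refine ⟨ContDiff.comp h1 contDiff_snd, fun k _ m => ?_, by rw [this]; exact Ctrl.zero.bound⟩
  obtain ⟨C, hC⟩ := h2 k m
  exact ⟨C, fun ε _ => hC⟩

theorem zero_mem_Icc : (0 : ℝ) ∈ Set.Icc (-1 : ℝ) 1 := by simp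

/-- A family with integrably decaying `x`-derivative is bounded. -/
theorem SmoothFam.bounded {F : ℝ → ℝ → Mat n} (hF : SmoothFam F)
    (h : ∀ k : ℕ, ∃ C : ℝ, ∀ ε ∈ Set.Icc (-1 : ℝ) 1, ∀ x : ℝ, |x| ^ k * ‖GNLS.dX F ε x‖ ≤ C) :
    ∃ C : ℝ, ∀ ε ∈ Set.Icc (-1 : ℝ) 1, ∀ x : ℝ, ‖F ε x‖ ≤ C := by
  obtain ⟨A, hA⟩ := h 0
  obtain ⟨B, hB⟩ := h 2
  obtain ⟨D, hD⟩ := (isCompact_Icc (a := (-1 : ℝ)) (b := 1)).exists_bound_of_continuousOn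
    (hF.slice' 0).continuous.continuousOn
  have hAB : 0 ≤ A + B := by
    have h1 := hA 0 zero_mem_Icc 0
    have h2 := hB 0 zero_mem_Icc 0
    have h3 : 0 ≤ |(0 : ℝ)| ^ 0 * ‖GNLS.dX F 0 0‖ := by positivity
    have h4 : 0 ≤ |(0 : ℝ)| ^ 2 * ‖GNLS.dX F 0 0‖ := by positivity
    linarith
  -- `D` bounds the values at `x = 0`. The derivative is at most `(A + B) / (1 + y²)`, whose
  -- integral from `0` to `x` is `(A + B) arctan x`.
  refine ⟨D + (A + B) * Real.pi, fun ε hε x => ?_⟩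
  have hb : ∀ y, ‖GNLS.dX F ε y‖ ≤ (A + B) * (1 + y ^ 2)⁻¹ := by
    intro y
    have h1 := hA ε hε y
    have h2 := hB ε hε y
    rw [sq_abs] at h2
    rw [← div_eq_mul_inv, le_div_iff₀ (by positivity)]
    nlinarith
  have hi : ∫ y in (0 : ℝ)..x, GNLS.dX F ε y = F ε x - F ε 0 :=
    intervalIntegral.integral_eq_sub_of_hasDerivAt (fun y _ => hF.hasDerivAt_dX ε y)
      ((hF.dX.slice ε).continuous.intervalIntegrable _ _)
  have hc : Continuous fun y : ℝ => (A + B) * (1 + y ^ 2)⁻¹ := by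
    refine continuous_const.mul (Continuous.inv₀ (by fun_prop) fun y => by positivity)
  have hn : ‖F ε x - F ε 0‖ ≤ (A + B) * Real.pi := by
    rw [← hi]
    refine (intervalIntegral.norm_integral_le_abs_of_norm_le (Eventually.of_forall fun y => hb y)
      (hc.intervalIntegrable _ _)).trans ?_
    rw [intervalIntegral.integral_const_mul, integral_inv_one_add_sq, Real.arctan_zero, sub_zero,
      abs_mul, abs_of_nonneg hAB]
    gcongr
    have h1 := Real.arctan_lt_pi_div_two x
    have h2 := Real.neg_pi_div_two_lt_arctan x
    have h3 := Real.pi_pos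
    exact abs_le.2 ⟨by linarith, by linarith⟩
  calc ‖F ε x‖ = ‖F ε 0 + (F ε x - F ε 0)‖ := by congr 1; abel
    _ ≤ ‖F ε 0‖ + ‖F ε x - F ε 0‖ := norm_add_le _ _
    _ ≤ _ := add_le_add (hD ε hε) hn

/-- The decay conditions start at the first `x`-derivative. Boundedness of `Γ` and `∂_ε Γ`
themselves is recovered by integrating from `x = 0` (`SmoothFam.bounded`). -/
theorem IsVariation.asym {d : Fin n → ℝ} {γ : ℝ → Mat n} {Γ : ℝ → ℝ → Mat n}
    (h : IsVariation d γ Γ) : Asym Γ := by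
  have hs : SmoothFam Γ := h.smooth
  have b1 : XBound Set.univ (dX Γ) := by
    intro k _ m
    obtain ⟨C, hC⟩ := h.decay k m
    refine ⟨C, fun ε hε x => ?_⟩
    have := hC ε hε x
    rwa [iteratedDeriv_succ_mat] at this
  have b2 : XBound Set.univ (dX (dE Γ)) := by
    intro k _ m
    obtain ⟨C, hC⟩ := h.decay_deriv k m
    refine ⟨C, fun ε hε x => ?_⟩
    have := hC ε hε x
    rwa [iteratedDeriv_succ_mat] at this
  have key : ∀ {F : ℝ → ℝ → Mat n}, SmoothFam F → XBound Set.univ (dX F) → XBound {0} F := by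
    intro F hF hb k hk m
    obtain rfl : k = 0 := hk
    cases m with
    | zero =>
      obtain ⟨C, hC⟩ := hF.bounded fun k => by simpa using hb k trivial 0
      exact ⟨C, fun ε hε x => by simpa using hC ε hε x⟩
    | succ m =>
      obtain ⟨C, hC⟩ := hb 0 trivial m
      refine ⟨C, fun ε hε x => ?_⟩
      rw [iteratedDeriv_succ_mat]
      exact hC ε hε x
  exact ⟨⟨hs, key hs b1, key hs.dE b2⟩, ⟨hs.dX, b1, by rw [hs.dE_dX]; exact b2⟩⟩

/-- Constant families make every estimate for variations available for a single path. -/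
theorem InPathSpace.isVariation {d : Fin n → ℝ} {γ : ℝ → Mat n} (h : InPathSpace d γ) :
    IsVariation d γ fun _ => γ where
  start := rfl
  mem _ := h
  smooth := h.smooth.comp contDiff_snd
  decay k m := by
    obtain ⟨C, hC⟩ := (isSchwartz_iff.1 h.schwartz).2 k m
    refine ⟨C, fun ε _ x => ?_⟩
    rw [iteratedDeriv_succ_mat]
    exact hC x
  decay_deriv k m := by
    refine ⟨0, fun ε _ x => ?_⟩
    have : (fun y => deriv (fun _ : ℝ => γ y) ε) = fun _ => 0 := by
      ext1 y; exact deriv_const _ _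
    rw [this]
    simp

/-- A linear map on matrices, as a continuous one. -/
def matCLM {V : Type*} [NormedAddCommGroup V] [NormedSpace ℝ V] (L : Mat n →ₗ[ℝ] V) :
    Mat n →L[ℝ] V :=
  LinearMap.toContinuousLinearMap L

/-- The conjugate transpose as a continuous real linear map. -/
def starCLM : Mat n →L[ℝ] Mat n :=
  matCLM
    { toFun := fun X => Xᴴ
      map_add' := Matrix.conjTranspose_add
      map_smul' := fun c X => by simp [Matrix.conjTranspose_smul] }

theorem hasDerivAt_conjTranspose {f : ℝ → Mat n} {f' : Mat n} {x : ℝ} (h : HasDerivAt f f' x) :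
    HasDerivAt (fun x => (f x)ᴴ) f'ᴴ x :=
  (starCLM (n := n)).hasFDerivAt.comp_hasDerivAt x h

/-! ### The idempotent series of a path and the local form of the hierarchy. -/

/-- The coefficients of the formal series `e = ∑ e_k z^k` with `e² = e`, `z e_x = [e, γ]` that
starts with a spectral projection of `γ`. They are differential polynomials in `γ`. -/
def series (d : Fin n → ℝ) (r : Spec d) (γ : ℝ → Mat n) : ℕ → ℝ → Mat n
  | 0 => fun x => specProj d (γ x) r
  | k + 1 => fun x => -adY d (γ x) (deriv (series d r γ k) x)
      + (1 - 2 * specProj d (γ x) r) *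
        bd d (γ x) (∑ i : Fin k, series d r γ (i + 1) x * series d r γ (k - i) x)
  termination_by k => k
  decreasing_by all_goals omega

/-- The quadratic expression in the coefficients of index between `1` and `k`. -/
def seriesMid (d : Fin n → ℝ) (r : Spec d) (γ : ℝ → Mat n) (k : ℕ) (x : ℝ) : Mat n :=
  ∑ i ∈ Finset.range k, series d r γ (i + 1) x * series d r γ (k - i) x

theorem series_zero (d : Fin n → ℝ) (r : Spec d) (γ : ℝ → Mat n) (x : ℝ) :
    series d r γ 0 x = specProj d (γ x) r := by
  rw [series]

/-- The definition sums over `Fin k`, which carries the index bounds needed for termination; from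
here on the sum over `Finset.range` in `seriesMid` is used. -/
theorem series_succ (d : Fin n → ℝ) (r : Spec d) (γ : ℝ → Mat n) (k : ℕ) (x : ℝ) :
    series d r γ (k + 1) x = -adY d (γ x) (deriv (series d r γ k) x)
      + (1 - 2 * specProj d (γ x) r) * bd d (γ x) (seriesMid d r γ k x) := by
  rw [series, seriesMid, Finset.sum_range]

section Families

variable {K : Set ℕ} {d : Fin n → ℝ} {Γ F : ℝ → ℝ → Mat n}

theorem Asym.specProj (h : Asym Γ) (r : Spec d) : Asym fun ε x => specProj d (Γ ε x) r :=
  h.aeval _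

theorem Ctrl.bd (h : Ctrl K F) (hΓ : Asym Γ) : Ctrl K fun ε x => bd d (Γ ε x) (F ε x) :=
  Ctrl.sum _ fun r _ => ((hΓ.specProj r).tame.tame_mul h).mul_tame (hΓ.specProj r).tame

theorem Ctrl.adY (h : Ctrl K F) (hΓ : Asym Γ) : Ctrl K fun ε x => adY d (Γ ε x) (F ε x) :=
  Ctrl.sum _ fun r _ => Ctrl.sum _ fun s _ =>
    (((hΓ.specProj r).tame.tame_mul h).mul_tame (hΓ.specProj s).tame).smul _

/-- The coefficient of index `0` is a spectral projection, which does not decay but has a rapidly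
decreasing derivative. From index `1` on, every term contains the derivative of an earlier
coefficient or coefficients of positive index, so it decays. -/
theorem Asym.series (h : Asym Γ) (r : Spec d) (k : ℕ) :
    Rapid (dX fun ε x => series d r (Γ ε) k x) ∧
      (1 ≤ k → Rapid fun ε x => series d r (Γ ε) k x) := by
  induction k using Nat.strong_induction_on with
  | _ k ih =>
    cases k with
    | zero =>
      simp only [series_zero]
      exact ⟨(h.specProj r).rapid, fun h => absurd h (by simp)⟩
    | succ k =>
      have hR : Rapid fun ε x => GNLS.series d r (Γ ε) (k + 1) x := by
        simp only [series_succ]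
        simp only [seriesMid]
        refine ((ih k (by omega)).1.adY h).neg.add (Ctrl.tame_mul ?_ (Ctrl.bd (Ctrl.sum _ ?_) h))
        · exact (Ctrl.const 1).sub ((Ctrl.const 2).mul_tame (h.specProj r).tame)
        · intro i hi
          have hi' := Finset.mem_range.1 hi
          exact ((ih (i + 1) (by omega)).2 (by omega)).mul_tame
            ((ih (k - i) (by omega)).2 (by omega)).tame
      exact ⟨hR.dX, fun _ => hR⟩

theorem Asym.series_rapid (h : Asym Γ) (r : Spec d) (k : ℕ) :
    Rapid fun ε x => GNLS.series d r (Γ ε) (k + 1) x := (h.series r (k + 1)).2 (by simp)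

theorem Asym.series_tame (h : Asym Γ) (r : Spec d) (k : ℕ) :
    Tame fun ε x => GNLS.series d r (Γ ε) k x := by
  cases k with
  | zero => simp only [series_zero]; exact (h.specProj r).tame
  | succ k => exact (h.series_rapid r k).tame

end Families

section Path

variable {d : Fin n → ℝ} {γ : ℝ → Mat n} (h : InPathSpace d γ)
include h

theorem InPathSpace.asym : Asym fun _ : ℝ => γ := h.isVariation.asym

theorem InPathSpace.inOrbit (x : ℝ) : InOrbit d (γ x) := h.orbit x

theorem InPathSpace.spectral (x : ℝ) : IsSpectral (eig d) (specProj d (γ x)) (γ x) :=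
  (h.inOrbit x).isSpectral

theorem InPathSpace.series_hasDerivAt (r : Spec d) (k : ℕ) (x : ℝ) :
    HasDerivAt (series d r γ k) (deriv (series d r γ k) x) x :=
  (h.asym.series_tame r k).smooth.hasDerivAt_dX 0 x

/-- Differentiate the order `k` part of `e² = e`. The two terms in which the coefficient of index
`k` is differentiated meet the spectral projection; in all others `hI` replaces derivatives by
brackets with `γ`, and these add up to the bracket of `seriesMid` with `γ`. The result is the
hypothesis of `lie_step` and `idem_step`. -/
theorem InPathSpace.series_key (r : Spec d) (k : ℕ)
    (hJ : ∀ x, ∑ p ∈ Finset.HasAntidiagonal.antidiagonal k, series d r γ p.1 x * series d r γ p.2 x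
      = series d r γ k x)
    (hI : ∀ i < k, ∀ x, ⁅series d r γ (i + 1) x, γ x⁆ = deriv (series d r γ i) x) (x : ℝ) :
    deriv (series d r γ k) x * specProj d (γ x) r + specProj d (γ x) r * deriv (series d r γ k) x
      + ⁅seriesMid d r γ k x, γ x⁆ = deriv (series d r γ k) x := by
  have h1 : HasDerivAt (series d r γ k) (∑ p ∈ Finset.HasAntidiagonal.antidiagonal k,
      (deriv (series d r γ p.1) x * series d r γ p.2 x
        + series d r γ p.1 x * deriv (series d r γ p.2) x)) x := by
    have e : series d r γ k = fun x => ∑ p ∈ Finset.HasAntidiagonal.antidiagonal k,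
      series d r γ p.1 x * series d r γ p.2 x := funext fun x => (hJ x).symm
    rw [e]
    exact HasDerivAt.fun_sum fun p _ =>
      (h.series_hasDerivAt r p.1 x).mul (h.series_hasDerivAt r p.2 x)
  have h2 := (h.series_hasDerivAt r k x).unique h1
  rw [Finset.sum_add_distrib,
    Finset.Nat.sum_antidiagonal_eq_sum_range_succ
      (fun i j => deriv (series d r γ i) x * series d r γ j x),
    Finset.Nat.sum_antidiagonal_eq_sum_range_succ
      (fun i j => series d r γ i x * deriv (series d r γ j) x),
    Finset.sum_range_succ, Finset.sum_range_succ' _ k] at h2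
  simp only [Nat.sub_self, Nat.sub_zero, series_zero] at h2
  have h3 : ⁅seriesMid d r γ k x, γ x⁆
      = ∑ i ∈ Finset.range k, deriv (series d r γ i) x * series d r γ (k - i) x
        + ∑ i ∈ Finset.range k, series d r γ (i + 1) x * deriv (series d r γ (k - (i + 1))) x := by
    rw [seriesMid, Ring.lie_def, Finset.sum_mul, Finset.mul_sum, ← Finset.sum_sub_distrib,
      ← Finset.sum_add_distrib]
    refine Finset.sum_congr rfl fun i hi => ?_
    have hi' := Finset.mem_range.1 hi
    rw [← hI i hi' x, ← hI (k - (i + 1)) (by omega) x, show k - (i + 1) + 1 = k - i by omega]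
    simp only [Ring.lie_def]
    noncomm_ring
  rw [h3]
  nth_rewrite 3 [h2]
  abel

/-- The two relations need a joint induction: both at order `k` give `series_key`, from which
`idem_step` and `lie_step` produce the next ones. -/
theorem InPathSpace.series_rel (r : Spec d) (k : ℕ) :
    (∀ x, ∑ p ∈ Finset.HasAntidiagonal.antidiagonal k, series d r γ p.1 x * series d r γ p.2 x
      = series d r γ k x) ∧
    ∀ i < k, ∀ x, ⁅series d r γ (i + 1) x, γ x⁆ = deriv (series d r γ i) x := by
  induction k with
  | zero =>
    refine ⟨fun x => ?_, fun i hi => absurd hi (by simp)⟩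
    simp [series_zero, (h.spectral x).mul]
  | succ k ih =>
    have key := h.series_key r k ih.1 ih.2
    constructor
    · intro x
      rw [Finset.Nat.sum_antidiagonal_eq_sum_range_succ
        (fun i j => series d r γ i x * series d r γ j x), Finset.sum_range_succ,
        Finset.sum_range_succ' _ k]
      simp only [Nat.sub_self, Nat.sub_zero, Nat.add_sub_add_right]
      have := (h.spectral x).idem_step (key x)
      rw [← series_succ] at this
      rw [← seriesMid, series_zero]
      nth_rewrite 3 [← this]
      abel
    · intro i hi x
      rcases Nat.lt_succ_iff_lt_or_eq.1 hi with h' | rfl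
      · exact ih.2 i h' x
      · rw [series_succ]
        exact (h.spectral x).lie_step (key x)

theorem InPathSpace.series_lie (r : Spec d) (k : ℕ) (x : ℝ) :
    ⁅series d r γ (k + 1) x, γ x⁆ = deriv (series d r γ k) x :=
  (h.series_rel r (k + 1)).2 k (by simp) x

theorem InPathSpace.series_idem (r : Spec d) (k : ℕ) (x : ℝ) :
    ∑ p ∈ Finset.HasAntidiagonal.antidiagonal k, series d r γ p.1 x * series d r γ p.2 x = series d r γ k x :=
  (h.series_rel r k).1 x

/-- The recursion is invariant under the conjugate transpose: the quadratic sum is mapped to itself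
with its terms reversed, and `1 - 2 * specProj` commutes with block diagonal matrices. -/
theorem InPathSpace.series_star (r : Spec d) (k : ℕ) (x : ℝ) :
    (series d r γ k x)ᴴ = series d r γ k x := by
  induction k using Nat.strong_induction_on generalizing x with
  | _ k ih =>
    cases k with
    | zero => rw [series_zero, (h.inOrbit x).star_specProj]
    | succ k =>
      have h1 : (deriv (series d r γ k) x)ᴴ = deriv (series d r γ k) x := by
        have h2 := hasDerivAt_conjTranspose (h.series_hasDerivAt r k x)
        have h3 : (fun x => (series d r γ k x)ᴴ) = series d r γ k :=
          funext fun x => ih k (by omega) x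
        rw [h3] at h2
        exact h2.unique (h.series_hasDerivAt r k x)
      have h4 : (seriesMid d r γ k x)ᴴ = seriesMid d r γ k x := by
        rw [seriesMid, Matrix.conjTranspose_sum, ← Finset.sum_range_reflect]
        refine Finset.sum_congr rfl fun i hi => ?_
        have hi' := Finset.mem_range.1 hi
        rw [Matrix.conjTranspose_mul, ih _ (by omega), ih _ (by omega)]
        congr 2 <;> omega
      rw [series_succ, Matrix.conjTranspose_add, Matrix.conjTranspose_neg, (h.inOrbit x).star_adY,
        h1, Matrix.conjTranspose_mul, (h.inOrbit x).star_bd, h4]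
      congr 1
      rw [Matrix.conjTranspose_sub, Matrix.conjTranspose_mul, (h.inOrbit x).star_specProj,
        mul_sub, sub_mul]
      have h5 := (h.spectral x).proj_blockDiag r (seriesMid d r γ k x)
      rw [← (h.spectral x).blockDiag_proj] at h5
      have h6 : ((2 : Mat n))ᴴ = 2 := by
        have := Matrix.conjTranspose_natCast (α := ℂ) (n := Fin n) 2
        exact_mod_cast this
      rw [h6, mul_assoc 2, h5]
      simp only [Matrix.conjTranspose_one]
      noncomm_ring

end Path

/-- The functions `g Q_j g⁻¹`, which are differential polynomials in `γ`. -/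
def localQ (d : Fin n → ℝ) (γ : ℝ → Mat n) (k : ℕ) (x : ℝ) : Mat n :=
  ∑ r, eig d r • series d r γ k x

theorem Asym.localQ_rapid {d : Fin n → ℝ} {Γ : ℝ → ℝ → Mat n} (h : Asym Γ) (k : ℕ) :
    Rapid fun ε x => localQ d (Γ ε) (k + 1) x :=
  Ctrl.sum _ fun r _ => (h.series_rapid r k).smul _

theorem Asym.localQ_tame {d : Fin n → ℝ} {Γ : ℝ → ℝ → Mat n} (h : Asym Γ) (k : ℕ) :
    Tame fun ε x => localQ d (Γ ε) k x :=
  Ctrl.sum _ fun r _ => (h.series_tame r k).smul _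

section Path

variable {d : Fin n → ℝ} {γ : ℝ → Mat n} (h : InPathSpace d γ)
include h

theorem InPathSpace.localQ_zero (x : ℝ) : localQ d γ 0 x = γ x := by
  simp only [localQ, series_zero]
  exact (h.spectral x).eq.symm

theorem InPathSpace.localQ_smooth (k : ℕ) : ContDiff ℝ ∞ (localQ d γ k) :=
  (h.asym.localQ_tame k).smooth.slice 0

theorem InPathSpace.localQ_schwartz (k : ℕ) : IsSchwartz (localQ d γ (k + 1)) :=
  (h.asym.localQ_rapid k).isSchwartz zero_mem_Icc

/-- The recursion for `Q_j` after conjugation by the frame: `∂_x + ad u` becomes `∂_x`, and `a`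
becomes `γ`. -/
theorem InPathSpace.localQ_hasDerivAt (k : ℕ) (x : ℝ) :
    HasDerivAt (localQ d γ k) ⁅localQ d γ (k + 1) x, γ x⁆ x := by
  have e : ⁅localQ d γ (k + 1) x, γ x⁆ = ∑ r, eig d r • deriv (series d r γ k) x := by
    simp only [← h.series_lie, localQ, Ring.lie_def, Finset.sum_mul, Finset.mul_sum,
      ← Finset.sum_sub_distrib, smul_mul_assoc, mul_smul_comm, smul_sub]
  rw [e]
  exact HasDerivAt.fun_sum fun r _ => (h.series_hasDerivAt r k x).const_smul (eig d r)

theorem InPathSpace.localQ_skew (k : ℕ) (x : ℝ) : IsSkew (localQ d γ k x) := by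
  unfold IsSkew
  simp only [localQ, Matrix.conjTranspose_sum, Matrix.conjTranspose_smul, h.series_star,
    ← Finset.sum_neg_distrib, ← neg_smul]
  refine Finset.sum_congr rfl fun r _ => ?_
  congr 1
  simp [eig]

/-- `γ_x` is tangent to the orbit. -/
theorem InPathSpace.bd_deriv (x : ℝ) : bd d (γ x) (deriv γ x) = 0 := by
  have h1 := h.localQ_hasDerivAt 0 x
  rw [show localQ d γ 0 = γ from funext h.localQ_zero] at h1
  have h2 : deriv γ x = _ := h1.deriv
  rw [h2]
  exact (h.spectral x).blockDiag_lie' _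

end Path

/-! ### Linear differential equations with initial value at `-∞`. -/

section LinearODE

theorem hasDerivAt_integral_Iic {E : Type*} [NormedAddCommGroup E] [NormedSpace ℝ E]
    [CompleteSpace E] {f : ℝ → E} (hf : Continuous f) (hi : Integrable f) (x : ℝ) :
    HasDerivAt (fun x => ∫ y in Set.Iic x, f y) (f x) x := by
  have e : (fun x => ∫ y in Set.Iic x, f y)
      = fun x => (∫ y in Set.Iic 0, f y) + ∫ y in (0 : ℝ)..x, f y := by
    ext1 x
    rw [← intervalIntegral.integral_Iic_sub_Iic hi.integrableOn hi.integrableOn]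
    abel
  rw [e]
  exact (hf.integral_hasStrictDerivAt 0 x).hasDerivAt.const_add _

theorem eq_of_hasDerivAt_zero {E : Type*} [NormedAddCommGroup E] [NormedSpace ℝ E] {f : ℝ → E}
    {c : E} (h : ∀ x, HasDerivAt f 0 x) (hl : Tendsto f atBot (𝓝 c)) (x : ℝ) : f x = c := by
  have h1 : ∀ y, f y = f x := fun y =>
    is_const_of_deriv_eq_zero (fun z => (h z).differentiableAt) (fun z => (h z).deriv) y x
  have h2 : f = fun _ => f x := funext h1
  rw [h2] at hl
  exact tendsto_nhds_unique tendsto_const_nhds hl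

/-- The weight function that makes the Volterra operator a contraction. -/
def odeWeight (C x : ℝ) : ℝ := Real.exp (2 * C * Real.arctan x)

theorem odeWeight_pos (C x : ℝ) : 0 < odeWeight C x := Real.exp_pos _

theorem odeWeight_continuous (C : ℝ) : Continuous (odeWeight C) := by
  unfold odeWeight
  have := Real.continuous_arctan
  fun_prop

theorem odeWeight_le {C : ℝ} (hC : 0 ≤ C) (x : ℝ) : odeWeight C x ≤ Real.exp (C * Real.pi) := by
  refine Real.exp_le_exp.2 ?_
  have := Real.arctan_lt_pi_div_two x
  nlinarith

theorem le_odeWeight {C : ℝ} (hC : 0 ≤ C) (x : ℝ) : Real.exp (-(C * Real.pi)) ≤ odeWeight C x := by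
  refine Real.exp_le_exp.2 ?_
  have := Real.neg_pi_div_two_lt_arctan x
  nlinarith

theorem odeWeight_integrable {C : ℝ} (hC : 0 ≤ C) :
    Integrable fun y => C * (1 + y ^ 2)⁻¹ * odeWeight C y := by
  refine (integrable_inv_one_add_sq.const_mul (C * Real.exp (C * Real.pi))).mono' ?_ ?_
  · refine Continuous.aestronglyMeasurable ?_
    exact (continuous_const.mul (Continuous.inv₀ (by fun_prop) fun y => by positivity)).mul
      (odeWeight_continuous C)
  · refine Eventually.of_forall fun y => ?_
    have h1 := odeWeight_le hC y
    have h2 : 0 ≤ C * (1 + y ^ 2)⁻¹ := by positivity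
    rw [Real.norm_of_nonneg (mul_nonneg h2 (odeWeight_pos C y).le)]
    calc _ ≤ C * (1 + y ^ 2)⁻¹ * Real.exp (C * Real.pi) := mul_le_mul_of_nonneg_left h1 h2
      _ = _ := by ring

/-- The integrand is exactly the derivative of `odeWeight C / 2`; the factor `2` in the exponent of
the weight is what yields the contraction constant `1/2`. -/
theorem integral_odeWeight_le {C : ℝ} (hC : 0 ≤ C) (x : ℝ) :
    ∫ y in Set.Iic x, C * (1 + y ^ 2)⁻¹ * odeWeight C y ≤ odeWeight C x / 2 := by
  have hd : ∀ y ∈ Set.Iic x, HasDerivAt (fun y => odeWeight C y / 2)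
      (C * (1 + y ^ 2)⁻¹ * odeWeight C y) y := by
    intro y _
    have h1 := ((((Real.hasDerivAt_arctan y).const_mul (2 * C))).exp).div_const 2
    refine h1.congr_deriv ?_
    unfold odeWeight
    rw [one_div]
    ring
  have hl : Tendsto (fun y => odeWeight C y / 2) atBot
      (𝓝 (Real.exp (2 * C * (-(Real.pi / 2))) / 2)) := by
    refine Tendsto.div_const ?_ 2
    exact (Real.continuous_exp.tendsto _).comp
      ((tendsto_nhds_of_tendsto_nhdsWithin Real.tendsto_arctan_atBot).const_mul _)
  rw [integral_Iic_of_hasDerivAt_of_tendsto' hd (odeWeight_integrable hC).integrableOn hl]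
  have := Real.exp_pos (2 * C * (-(Real.pi / 2)))
  linarith

/-- A linear differential equation with an integrably decaying coefficient has a solution with
value `1` at `-∞`. -/
theorem exists_linearODE {𝔸 : Type*} [NormedRing 𝔸] [NormedAlgebra ℝ 𝔸] [CompleteSpace 𝔸] {A : ℝ → 𝔸} (hA : Continuous A) {C : ℝ} (hC : 0 ≤ C)
    (hb : ∀ x, ‖A x‖ ≤ C * (1 + x ^ 2)⁻¹) :
    ∃ g : ℝ → 𝔸, (∀ x, HasDerivAt g (A x * g x) x) ∧ Tendsto g atBot (𝓝 1) := by
  have hint : ∀ h : BoundedContinuousFunction ℝ 𝔸,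
      Continuous (fun y => A y * (odeWeight C y • h y)) ∧
      (∀ y, ‖A y * (odeWeight C y • h y)‖ ≤ ‖h‖ * (C * (1 + y ^ 2)⁻¹ * odeWeight C y)) ∧
      Integrable (fun y => A y * (odeWeight C y • h y)) := by
    intro h
    have h1 : Continuous (fun y => A y * (odeWeight C y • h y)) :=
      hA.mul ((odeWeight_continuous C).smul h.continuous)
    have h2 : ∀ y, ‖A y * (odeWeight C y • h y)‖ ≤ ‖h‖ * (C * (1 + y ^ 2)⁻¹ * odeWeight C y) := by
      intro y
      have hw := (odeWeight_pos C y).le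
      calc _ ≤ ‖A y‖ * ‖odeWeight C y • h y‖ := norm_mul_le _ _
        _ ≤ (C * (1 + y ^ 2)⁻¹) * (odeWeight C y * ‖h‖) := by
          rw [norm_smul, Real.norm_of_nonneg hw]
          exact mul_le_mul (hb y) (mul_le_mul_of_nonneg_left (h.norm_coe_le_norm y) hw)
            (by positivity) (by positivity)
        _ = _ := by ring
    exact ⟨h1, h2, ((odeWeight_integrable hC).const_mul ‖h‖).mono' h1.aestronglyMeasurable
      (Eventually.of_forall h2)⟩
  have hbound : ∀ (h : BoundedContinuousFunction ℝ 𝔸) (x : ℝ),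
      ‖∫ y in Set.Iic x, A y * (odeWeight C y • h y)‖ ≤ ‖h‖ * (odeWeight C x / 2) := by
    intro h x
    refine (norm_integral_le_of_norm_le ((odeWeight_integrable hC).const_mul ‖h‖).integrableOn
      (Eventually.of_forall (hint h).2.1)).trans ?_
    rw [integral_const_mul]
    exact mul_le_mul_of_nonneg_left (integral_odeWeight_le hC x) (norm_nonneg _)
  -- The Volterra equation `g = 1 + ∫ A g`, written for the bounded unknown `h = g / odeWeight C`.
  let T : BoundedContinuousFunction ℝ 𝔸 → BoundedContinuousFunction ℝ 𝔸 := fun h =>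
    BoundedContinuousFunction.ofNormedAddCommGroup
      (fun x => (odeWeight C x)⁻¹ • (1 + ∫ y in Set.Iic x, A y * (odeWeight C y • h y)))
      (Continuous.smul ((odeWeight_continuous C).inv₀ fun x => (odeWeight_pos C x).ne')
        (continuous_const.add (continuous_iff_continuousAt.2 fun x =>
          (hasDerivAt_integral_Iic (hint h).1 (hint h).2.2 x).continuousAt)))
      (Real.exp (C * Real.pi) * ‖(1 : 𝔸)‖ + ‖h‖ / 2) (by
        intro x
        have hw := odeWeight_pos C x
        rw [norm_smul, norm_inv, Real.norm_of_nonneg hw.le]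
        have h1 : (odeWeight C x)⁻¹ ≤ Real.exp (C * Real.pi) := by
          rw [inv_le_comm₀ hw (Real.exp_pos _), ← Real.exp_neg]
          exact le_odeWeight hC x
        calc _ ≤ (odeWeight C x)⁻¹ * (‖(1 : 𝔸)‖ + ‖h‖ * (odeWeight C x / 2)) := by
              refine mul_le_mul_of_nonneg_left ((norm_add_le _ _).trans ?_) (by positivity)
              exact add_le_add le_rfl (hbound h x)
          _ = (odeWeight C x)⁻¹ * ‖(1 : 𝔸)‖ + ‖h‖ / 2 := by field_simp
          _ ≤ _ := by gcongr)
  have hTapp : ∀ h x, T h x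
      = (odeWeight C x)⁻¹ • (1 + ∫ y in Set.Iic x, A y * (odeWeight C y • h y)) := fun _ _ => rfl
  have hT : ContractingWith (1 / 2 : NNReal) T := by
    refine ⟨by norm_num, LipschitzWith.of_dist_le_mul fun h k => ?_⟩
    rw [BoundedContinuousFunction.dist_le (by positivity)]
    intro x
    have hw := odeWeight_pos C x
    have e : T h x - T k x = (odeWeight C x)⁻¹ •
        ∫ y in Set.Iic x, A y * (odeWeight C y • (h - k) y) := by
      rw [hTapp, hTapp, ← smul_sub, add_sub_add_left_eq_sub, ← integral_sub
        (hint h).2.2.integrableOn (hint k).2.2.integrableOn]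
      simp [mul_sub, smul_sub]
    rw [dist_eq_norm, e, norm_smul, norm_inv, Real.norm_of_nonneg hw.le, dist_eq_norm]
    calc _ ≤ (odeWeight C x)⁻¹ * (‖h - k‖ * (odeWeight C x / 2)) :=
          mul_le_mul_of_nonneg_left (hbound (h - k) x) (by positivity)
      _ = _ := by
          have : ((1 / 2 : NNReal) : ℝ) = 1 / 2 := by norm_num
          rw [this]; field_simp
  set h := ContractingWith.fixedPoint T hT with hh
  have hfix : T h = h := hT.fixedPoint_isFixedPt
  refine ⟨fun x => odeWeight C x • h x, ?_⟩
  have e : (fun x => odeWeight C x • h x)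
      = fun x => 1 + ∫ y in Set.Iic x, A y * (odeWeight C y • h y) := by
    ext1 x
    have h1 : h x = T h x := by rw [hfix]
    rw [hTapp] at h1
    nth_rewrite 1 [h1]
    rw [smul_smul, mul_inv_cancel₀ (odeWeight_pos C x).ne', one_smul]
  constructor
  · intro x
    have := (hasDerivAt_integral_Iic (hint h).1 (hint h).2.2 x).const_add 1
    rw [← e] at this
    exact this
  · rw [e]
    simpa using (tendsto_integral_Iic_zero (f := fun y => A y * (odeWeight C y • h y)) (μ := volume)
      tendsto_id).const_add 1

/-- Bootstrapping: if `g` is `C^m`, then so is `g' = A g`. -/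
theorem contDiff_of_linearODE {𝔸 : Type*} [NormedRing 𝔸] [NormedAlgebra ℝ 𝔸] {A g : ℝ → 𝔸} (hA : ContDiff ℝ ∞ A)
    (hg : ∀ x, HasDerivAt g (A x * g x) x) : ContDiff ℝ ∞ g := by
  rw [contDiff_infty]
  intro m
  induction m with
  | zero =>
    exact contDiff_zero.2 (continuous_iff_continuousAt.2 fun x => (hg x).continuousAt)
  | succ m ih =>
    have e : deriv g = fun x => A x * g x := funext fun x => (hg x).deriv
    have h : ContDiff ℝ ((m : WithTop ℕ∞) + 1) g := by
      refine contDiff_succ_iff_deriv.2 ⟨fun x => (hg x).differentiableAt, by simp, ?_⟩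
      rw [e]
      exact (contDiff_infty.1 hA m).mul ih
    exact_mod_cast h

end LinearODE

/-! ### Existence and uniqueness of the frame. -/

theorem IsSchwartz.smooth {f : ℝ → Mat n} (h : IsSchwartz f) : ContDiff ℝ ∞ f :=
  (isSchwartz_iff.1 h).1

theorem hasDerivAt_of_smooth {f : ℝ → Mat n} (h : ContDiff ℝ ∞ f) (x : ℝ) :
    HasDerivAt f (deriv f x) x :=
  (ContDiff.differentiable h (by simp) x).hasDerivAt

theorem IsSchwartz.hasDerivAt {f : ℝ → Mat n} (h : IsSchwartz f) (x : ℝ) :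
    HasDerivAt f (deriv f x) x := hasDerivAt_of_smooth h.smooth x

theorem IsSchwartz.deriv {f : ℝ → Mat n} (h : IsSchwartz f) : IsSchwartz (deriv f) :=
  h.rapid.dX.isSchwartz zero_mem_Icc

/-- Integrability with respect to the norm in force, to fix the topology it refers to. -/
abbrev NormIntegrable {E : Type*} [NormedAddCommGroup E] (f : ℝ → E) : Prop := Integrable f

theorem IsSchwartz.integrable {f : ℝ → Mat n} (h : IsSchwartz f) : NormIntegrable f := by
  obtain ⟨s, hs⟩ := h
  obtain rfl : (s : ℝ → Mat n) = f := funext hs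
  exact s.integrable

theorem IsSchwartz.tendsto_cocompact {f : ℝ → Mat n} (h : IsSchwartz f) :
    Tendsto f (cocompact ℝ) (𝓝 0) := by
  obtain ⟨s, hs⟩ := h
  obtain rfl : (s : ℝ → Mat n) = f := funext hs
  exact zero_at_infty s

theorem IsSchwartz.tendsto_atBot {f : ℝ → Mat n} (h : IsSchwartz f) :
    Tendsto f atBot (𝓝 0) := h.tendsto_cocompact.mono_left atBot_le_cocompact

/-- `ad(γ)⁻¹` of the velocity, up to sign: the logarithmic derivative `g_x g⁻¹` of the frame. -/
def logDeriv (d : Fin n → ℝ) (γ : ℝ → Mat n) (x : ℝ) : Mat n := -adY d (γ x) (deriv γ x)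

section LogDeriv

variable {d : Fin n → ℝ} {γ : ℝ → Mat n} (h : InPathSpace d γ)
include h

theorem InPathSpace.hasDerivAt (x : ℝ) : HasDerivAt γ (deriv γ x) x :=
  hasDerivAt_of_smooth h.smooth x

theorem InPathSpace.deriv_skew (x : ℝ) : IsSkew (deriv γ x) := by
  have h1 := hasDerivAt_conjTranspose (h.hasDerivAt x)
  have h2 : (fun x => (γ x)ᴴ) = fun x => -γ x := funext fun x => (h.inOrbit x).isSkew
  rw [h2] at h1
  exact h1.unique (h.hasDerivAt x).neg

theorem InPathSpace.logDeriv_schwartz : IsSchwartz (logDeriv d γ) :=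
  (h.schwartz.rapid.adY h.asym).neg.isSchwartz zero_mem_Icc

theorem InPathSpace.logDeriv_skew (x : ℝ) : IsSkew (logDeriv d γ x) := by
  have := h.deriv_skew x
  unfold IsSkew at *
  rw [logDeriv, Matrix.conjTranspose_neg, (h.inOrbit x).star_adY, this, adY, adI_neg]

theorem InPathSpace.bd_logDeriv (x : ℝ) : bd d (γ x) (logDeriv d γ x) = 0 := by
  rw [logDeriv, bd, blockDiag_neg, (h.spectral x).blockDiag_adI, neg_zero]

theorem InPathSpace.lie_logDeriv (x : ℝ) : ⁅logDeriv d γ x, γ x⁆ = deriv γ x := by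
  rw [ring_lie_skew, Ring.lie_def, logDeriv, mul_neg, neg_mul, ← neg_sub', neg_neg,
    ← Ring.lie_def, (h.spectral x).lie_adI, show blockDiag _ _ = _ from h.bd_deriv x, sub_zero]

/-- The logarithmic derivative is determined by the path. -/
theorem InPathSpace.eq_logDeriv {B : Mat n} {x : ℝ} (hB : bd d (γ x) B = 0)
    (hl : ⁅B, γ x⁆ = deriv γ x) : B = logDeriv d γ x := by
  rw [logDeriv, ← hl, ring_lie_skew, adY, adI_neg, neg_neg, (h.spectral x).adI_lie,
    show blockDiag _ B = _ from hB, sub_zero]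

/-- Solve `g' = A g`, `g(-∞) = 1`, with `A = logDeriv d γ`. Skewness of `A` makes `gᴴ g` constant,
`[A, γ] = γ_x` makes `gᴴ γ g` constant, and both constants are read off at `-∞`. That `A` is
off-diagonal gives the condition on `g⁻¹ g_x`. -/
theorem InPathSpace.exists_frame : ∃ g, IsFrame d γ g ∧
    ∀ x, HasDerivAt g (logDeriv d γ x * g x) x := by
  have hA := h.logDeriv_schwartz
  obtain ⟨C, hC, hb⟩ : ∃ C, 0 ≤ C ∧ ∀ x, ‖logDeriv d γ x‖ ≤ C * (1 + x ^ 2)⁻¹ := by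
    obtain ⟨C0, h0⟩ := (isSchwartz_iff.1 hA).2 0 0
    obtain ⟨C2, h2⟩ := (isSchwartz_iff.1 hA).2 2 0
    simp only [pow_zero, one_mul, iteratedDeriv_zero, sq_abs] at h0 h2
    refine ⟨C0 + C2, add_nonneg ((norm_nonneg _).trans (h0 0))
      (le_trans (by positivity) (h2 0)), fun x => ?_⟩
    rw [← div_eq_mul_inv, le_div_iff₀ (by positivity)]
    nlinarith [h0 x, h2 x]
  obtain ⟨g, hg, hl⟩ := exists_linearODE hA.smooth.continuous hC hb
  have hgs : ContDiff ℝ ∞ g := contDiff_of_linearODE hA.smooth hg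
  have hgH : ∀ x, HasDerivAt (fun x => (g x)ᴴ) (-((g x)ᴴ * logDeriv d γ x)) x := by
    intro x
    have := hasDerivAt_conjTranspose (hg x)
    rwa [Matrix.conjTranspose_mul, h.logDeriv_skew x, mul_neg] at this
  have hlH : Tendsto (fun x => (g x)ᴴ) atBot (𝓝 1) := by
    have := ((starCLM (n := n)).continuous.tendsto 1).comp hl
    have e : starCLM (n := n) 1 = 1 := Matrix.conjTranspose_one
    rw [e] at this
    exact this
  have hu : ∀ x, (g x)ᴴ * g x = 1 := by
    intro x
    refine eq_of_hasDerivAt_zero (f := fun x => (g x)ᴴ * g x) (fun y => ?_) ?_ x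
    · refine ((hgH y).mul (hg y)).congr_deriv ?_
      noncomm_ring
    · have h3 := hlH.mul hl
      rw [one_mul] at h3
      exact h3
  have hU : ∀ x, g x ∈ Matrix.unitaryGroup (Fin n) ℂ := fun x =>
    Matrix.mem_unitaryGroup_iff'.2 (hu x)
  have hc : ∀ x, (g x)ᴴ * γ x * g x = base d := by
    intro x
    refine eq_of_hasDerivAt_zero (f := fun x => (g x)ᴴ * γ x * g x) (fun y => ?_) ?_ x
    · refine (((hgH y).mul (h.hasDerivAt y)).mul (hg y)).congr_deriv ?_
      show (-((g y)ᴴ * logDeriv d γ y) * γ y + (g y)ᴴ * deriv γ y) * g y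
        + (g y)ᴴ * γ y * (logDeriv d γ y * g y) = 0
      rw [← h.lie_logDeriv y, Ring.lie_def]
      noncomm_ring
    · have h3 := (hlH.mul h.lim).mul hl
      rw [one_mul, mul_one] at h3
      exact h3
  have hcj : ∀ x, γ x = g x * base d * (g x)ᴴ := fun x => by rw [← hc x, conj_conj (hU x)]
  refine ⟨g, ⟨hgs, hU, hcj, hl, fun x => ?_⟩, hg⟩
  have hd : deriv g x = logDeriv d γ x * g x := (hg x).deriv
  rw [hd, ← mul_assoc]
  constructor
  · have := (h.logDeriv_skew x).conj (U := (g x)ᴴ)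
    rwa [Matrix.conjTranspose_conjTranspose] at this
  · rw [projC_conj d (hU x), ← hcj x, h.bd_logDeriv]
    simp

end LogDeriv

section Frame

variable {d : Fin n → ℝ} {γ g : ℝ → Mat n}

/-- For any frame, `B = g_x g⁻¹` is off-diagonal with `[B, γ] = γ_x`, which determines `B`. So all
frames solve the same linear equation, and uniqueness follows. -/
theorem IsFrame.hasDerivAt (hg : IsFrame d γ g) (h : InPathSpace d γ) (x : ℝ) :
    HasDerivAt g (logDeriv d γ x * g x) x := by
  have h0 := hasDerivAt_of_smooth hg.smooth x
  have hu : deriv g x = g x * ((g x)ᴴ * deriv g x) := by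
    rw [← mul_assoc, unitary_mul_star (hg.unitary x), one_mul]
  obtain ⟨hs, hp⟩ := hg.perp x
  set u := (g x)ᴴ * deriv g x with hudef
  have h1 : HasDerivAt γ (g x * u * base d * (g x)ᴴ + g x * base d * (g x * u)ᴴ) x := by
    have e : γ = fun x => g x * base d * (g x)ᴴ := funext hg.conj
    rw [e]
    rw [hu] at h0
    exact (h0.mul_const (base d)).mul (hasDerivAt_conjTranspose h0)
  have hγ : deriv γ x = _ := h1.deriv
  have hB : g x * u * (g x)ᴴ = logDeriv d γ x := by
    refine h.eq_logDeriv ?_ ?_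
    · rw [hg.conj x, bd_conj d (hg.unitary x), conj_conj' (hg.unitary x), bd_base, hp]
      simp
    · rw [hγ, Matrix.conjTranspose_mul, hs, Ring.lie_def]
      nth_rewrite 1 2 [hg.conj x]
      have e1 : g x * u * (g x)ᴴ * (g x * base d * (g x)ᴴ)
          = g x * u * ((g x)ᴴ * g x) * base d * (g x)ᴴ := by noncomm_ring
      have e2 : g x * base d * (g x)ᴴ * (g x * u * (g x)ᴴ)
          = g x * base d * ((g x)ᴴ * g x) * u * (g x)ᴴ := by noncomm_ring
      rw [e1, e2, unitary_star_mul (hg.unitary x)]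
      noncomm_ring
  rw [← hB, mul_assoc, unitary_star_mul (hg.unitary x), mul_one, ← hu]
  exact hasDerivAt_of_smooth hg.smooth x

theorem IsFrame.hasDerivAt_star (hg : IsFrame d γ g) (h : InPathSpace d γ) (x : ℝ) :
    HasDerivAt (fun x => (g x)ᴴ) (-((g x)ᴴ * logDeriv d γ x)) x := by
  have := hasDerivAt_conjTranspose (hg.hasDerivAt h x)
  rwa [Matrix.conjTranspose_mul, h.logDeriv_skew x, mul_neg] at this

theorem IsFrame.lim_star (hg : IsFrame d γ g) : Tendsto (fun x => (g x)ᴴ) atBot (𝓝 1) := by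
  have := ((starCLM (n := n)).continuous.tendsto 1).comp hg.lim
  have e : starCLM (n := n) 1 = 1 := Matrix.conjTranspose_one
  rw [e] at this
  exact this

theorem IsFrame.unique {g' : ℝ → Mat n} (h : InPathSpace d γ) (hg : IsFrame d γ g)
    (hg' : IsFrame d γ g') : g' = g := by
  have hk : ∀ x, (g x)ᴴ * g' x = 1 := by
    intro x
    refine eq_of_hasDerivAt_zero (f := fun x => (g x)ᴴ * g' x) (fun y => ?_) ?_ x
    · refine ((hg.hasDerivAt_star h y).mul (hg'.hasDerivAt h y)).congr_deriv ?_
      noncomm_ring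
    · have h3 := hg.lim_star.mul hg'.lim
      rw [one_mul] at h3
      exact h3
  ext1 x
  rw [← one_mul (g' x), ← unitary_mul_star (hg.unitary x), mul_assoc, hk x, mul_one]

theorem InPathSpace.isFrame (h : InPathSpace d γ) : IsFrame d γ (frame d γ) :=
  Classical.epsilon_spec (p := IsFrame d γ) (h.exists_frame.imp fun _ hg => hg.1)

theorem InPathSpace.isFrame_iff (h : InPathSpace d γ) :
    IsFrame d γ g ↔ g = frame d γ :=
  ⟨fun hg => h.isFrame.unique h hg, fun hg => hg ▸ h.isFrame⟩

end Frame

/-! ### Conjugation by the frame. -/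

theorem unitary_norm_le {U : Mat n} (hU : U ∈ Matrix.unitaryGroup (Fin n) ℂ) : ‖U‖ ≤ n := by
  -- The norm is the maximal absolute row sum, for which unitary matrices need not have norm `1`;
  -- their entries have absolute value at most `1`.
  rw [Matrix.linfty_opNorm_def]
  have : (Finset.univ.sup fun i => ∑ j, ‖U i j‖₊) ≤ (n : NNReal) := by
    refine Finset.sup_le fun i _ => ?_
    calc ∑ j, ‖U i j‖₊ ≤ ∑ _j : Fin n, (1 : NNReal) :=
          Finset.sum_le_sum fun j _ => by exact_mod_cast entry_norm_bound_of_unitary hU i j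
      _ = n := by simp
  exact_mod_cast this

/-- `π_a` as a continuous linear map. -/
def projCCLM (d : Fin n → ℝ) : Mat n →L[ℝ] Mat n :=
  matCLM
    { toFun := projC d
      map_add' := fun X Y => by
        ext k l; simp only [projC, Matrix.of_apply, Matrix.add_apply]; split_ifs <;> simp
      map_smul' := fun c X => by
        ext k l; simp only [projC, Matrix.of_apply, Matrix.smul_apply]; split_ifs <;> simp }

theorem projCCLM_apply (d : Fin n → ℝ) (X : Mat n) : projCCLM d X = projC d X := rfl

theorem hasDerivAt_projC (d : Fin n → ℝ) {f : ℝ → Mat n} {f' : Mat n} {x : ℝ}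
    (h : HasDerivAt f f' x) : HasDerivAt (fun x => projC d (f x)) (projC d f') x :=
  (projCCLM d).hasFDerivAt.comp_hasDerivAt x h

theorem projC_sub (d : Fin n → ℝ) (X Y : Mat n) : projC d (X - Y) = projC d X - projC d Y :=
  map_sub (projCCLM d) X Y

theorem projC_projC (d : Fin n → ℝ) (X : Mat n) : projC d (projC d X) = projC d X := by
  ext k l; simp only [projC, Matrix.of_apply]; split_ifs <;> rfl

theorem projC_lie_base (d : Fin n → ℝ) (X : Mat n) : projC d ⁅X, base d⁆ = 0 := by
  rw [← bd_base]; exact (isSpectral_base d).blockDiag_lie' X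

theorem projP_of_lie_base (d : Fin n → ℝ) (X : Mat n) : -adInv d ⁅X, base d⁆ = projP d X := by
  rw [← adY_base, ring_lie_skew, adY, adI_neg, neg_neg, (isSpectral_base d).adI_lie, projP,
    ← bd_base]

/-- Multiplying by a block diagonal element acts blockwise, so no diagonal block can arise from an
`X` that has none. -/
theorem IsSpectral.blockDiag_lie_blockDiag {ι R : Type*} [Fintype ι] [DecidableEq ι] [Ring R]
    [Algebra ℂ R] {c : ι → ℂ} {P : ι → R} {y : R} (h : IsSpectral c P y) {X : R}
    (hX : blockDiag P X = 0) (Y : R) : blockDiag P ⁅X, blockDiag P Y⁆ = 0 := by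
  have h1 : ∀ i, P i * X * P i = 0 := by
    intro i
    rw [← h.blockDiag_proj, hX, zero_mul]
  refine Finset.sum_eq_zero fun i _ => ?_
  have h2 : P i * ⁅X, blockDiag P Y⁆ * P i
      = P i * X * (blockDiag P Y * P i) - P i * blockDiag P Y * (X * P i) := by
    rw [Ring.lie_def]; noncomm_ring
  have h3 : P i * X * (P i * Y * P i) - P i * Y * P i * (X * P i)
      = P i * X * P i * Y * P i - P i * Y * (P i * X * P i) := by noncomm_ring
  rw [h2, h.blockDiag_proj, h.proj_blockDiag, h3, h1]
  simp

theorem projC_lie_projC {d : Fin n → ℝ} {u : Mat n} (hu : projC d u = 0) (X : Mat n) :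
    projC d ⁅u, projC d X⁆ = 0 := by
  rw [← bd_base] at hu ⊢
  rw [← bd_base d X]
  exact (isSpectral_base d).blockDiag_lie_blockDiag hu X

section Conjugation

variable {d : Fin n → ℝ} {γ g : ℝ → Mat n} (h : InPathSpace d γ) (hg : IsFrame d γ g)
include hg

/-- `g⁻¹ f g`. -/
abbrev pull (g f : ℝ → Mat n) : ℝ → Mat n := fun x => (g x)ᴴ * f x * g x

theorem IsFrame.star_smooth : ContDiff ℝ ∞ fun x => (g x)ᴴ :=
  (starCLM (n := n)).contDiff.comp hg.smooth

theorem IsFrame.pull_smooth {f : ℝ → Mat n} (hf : ContDiff ℝ ∞ f) : ContDiff ℝ ∞ (pull g f) :=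
  (hg.star_smooth.mul hf).mul hg.smooth

theorem IsFrame.pull_tendsto {f : ℝ → Mat n} (hf : Tendsto f atBot (𝓝 0)) :
    Tendsto (pull g f) atBot (𝓝 0) := by
  have h3 := (hg.lim_star.mul hf).mul hg.lim
  rw [one_mul, mul_one] at h3
  exact h3

theorem IsFrame.pull_integrable {f : ℝ → Mat n} (hf : IsSchwartz f) :
    NormIntegrable (pull g f) := by
  refine Integrable.mono' ((hf.integrable.norm.const_mul ((n : ℝ) * n)))
    (hg.pull_smooth hf.smooth).continuous.aestronglyMeasurable (Eventually.of_forall fun x => ?_)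
  have h1 := unitary_norm_le (hg.unitary x)
  have h2 : ‖(g x)ᴴ‖ ≤ n := unitary_norm_le (Unitary.star_mem (hg.unitary x))
  calc ‖(g x)ᴴ * f x * g x‖ ≤ ‖(g x)ᴴ * f x‖ * ‖g x‖ := norm_mul_le _ _
    _ ≤ ‖(g x)ᴴ‖ * ‖f x‖ * ‖g x‖ := by gcongr; exact norm_mul_le _ _
    _ ≤ n * ‖f x‖ * n := by gcongr
    _ = _ := by ring

theorem IsFrame.lie_pull (x : ℝ) (X Y : Mat n) :
    ⁅(g x)ᴴ * X * g x, (g x)ᴴ * Y * g x⁆ = (g x)ᴴ * ⁅X, Y⁆ * g x := by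
  have e : ∀ A B : Mat n, (g x)ᴴ * A * g x * ((g x)ᴴ * B * g x)
      = (g x)ᴴ * A * (g x * (g x)ᴴ) * B * g x := by intro A B; noncomm_ring
  rw [Ring.lie_def, e, e, unitary_mul_star (hg.unitary x), Ring.lie_def]
  noncomm_ring

theorem IsFrame.pull_path (x : ℝ) : (g x)ᴴ * γ x * g x = base d := by
  rw [hg.conj x, conj_conj' (hg.unitary x)]

theorem IsFrame.projC_pull (x : ℝ) (X : Mat n) :
    projC d ((g x)ᴴ * X * g x) = (g x)ᴴ * bd d (γ x) X * g x := by
  rw [projC_conj d (hg.unitary x), ← hg.conj x]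

include h

/-- The development map is `g⁻¹ (g_x g⁻¹) g`. -/
theorem IsFrame.dev_eq : (fun x => (g x)ᴴ * deriv g x) = pull g (logDeriv d γ) := by
  ext1 x
  have : deriv g x = _ := (hg.hasDerivAt h x).deriv
  rw [this, pull, mul_assoc]

/-- In other words `∂_x + ad u` acts on `g⁻¹ f g` as `∂_x` acts on `f`. -/
theorem IsFrame.hasDerivAt_pull {f : ℝ → Mat n} {f' : Mat n} {x : ℝ} (hf : HasDerivAt f f' x) :
    HasDerivAt (pull g f) ((g x)ᴴ * f' * g x - ⁅pull g (logDeriv d γ) x, pull g f x⁆) x := by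
  refine (((hg.hasDerivAt_star h x).mul hf).mul (hg.hasDerivAt h x)).congr_deriv ?_
  rw [hg.lie_pull, Ring.lie_def]
  show (-((g x)ᴴ * logDeriv d γ x) * f x + (g x)ᴴ * f') * g x
        + (g x)ᴴ * f x * (logDeriv d γ x * g x) = _
  noncomm_ring

theorem IsFrame.projC_dev (x : ℝ) : projC d (pull g (logDeriv d γ) x) = 0 := by
  rw [pull, hg.projC_pull, h.bd_logDeriv]; simp

omit hg in
theorem InPathSpace.lie_schwartz {f : ℝ → Mat n} (hf : IsSchwartz f) :
    IsSchwartz fun x => ⁅logDeriv d γ x, f x⁆ := by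
  have h1 := h.logDeriv_schwartz.rapid
  have h2 := hf.rapid
  exact ((h1.mul_tame h2.tame).sub (h2.mul_tame h1.tame)).isSchwartz zero_mem_Icc

theorem IsFrame.lie_dev_integrable {f : ℝ → Mat n} (hf : IsSchwartz f) :
    NormIntegrable fun x => projC d ⁅pull g (logDeriv d γ) x, pull g f x⁆ := by
  have h1 := hg.pull_integrable (h.lie_schwartz hf)
  have h2 := (projCCLM d).integrable_comp h1
  have e : (fun x => projC d ⁅pull g (logDeriv d γ) x, pull g f x⁆)
      = fun x => projCCLM d (pull g (fun x => ⁅logDeriv d γ x, f x⁆) x) := by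
    ext1 x
    rw [projCCLM_apply, pull, pull, hg.lie_pull]
  rw [e]
  exact h2

theorem IsFrame.lie_projP (x : ℝ) (X : Mat n) :
    projC d ⁅pull g (logDeriv d γ) x, projP d X⁆ = projC d ⁅pull g (logDeriv d γ) x, X⁆ := by
  have : ⁅pull g (logDeriv d γ) x, projP d X⁆
      = ⁅pull g (logDeriv d γ) x, X⁆ - ⁅pull g (logDeriv d γ) x, projC d X⁆ := by
    simp only [projP, Ring.lie_def]; noncomm_ring
  rw [this, projC_sub, projC_lie_projC (hg.projC_dev h x), sub_zero]

/-- If `ξ_x` has no part in the centralizer, then `T_u` recovers the centralizer part of `ξ` from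
the complementary one. -/
theorem IsFrame.opT_eq {ξ : ℝ → Mat n} (hξ : IsSchwartz ξ)
    (hb : ∀ x, bd d (γ x) (deriv ξ x) = 0) (x : ℝ) :
    opT d (pull g (logDeriv d γ)) (fun x => projP d (pull g ξ x)) x = -projC d (pull g ξ x) := by
  have hd : ∀ y, HasDerivAt (fun x => -projC d (pull g ξ x))
      (projC d ⁅pull g (logDeriv d γ) y, projP d (pull g ξ y)⁆) y := by
    intro y
    refine (hasDerivAt_projC d (hg.hasDerivAt_pull h (hξ.hasDerivAt y))).neg.congr_deriv ?_
    rw [projC_sub, hg.projC_pull, hb, hg.lie_projP h]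
    simp
  have hl : Tendsto (fun x => -projC d (pull g ξ x)) atBot (𝓝 0) := by
    have h1 := (((projCCLM d).continuous.tendsto 0).comp (hg.pull_tendsto hξ.tendsto_atBot)).neg
    rw [map_zero, neg_zero] at h1
    exact h1
  have hi : NormIntegrable fun y => projC d ⁅pull g (logDeriv d γ) y, projP d (pull g ξ y)⁆ := by
    simp only [hg.lie_projP h]
    exact hg.lie_dev_integrable h hξ
  have := integral_Iic_of_hasDerivAt_of_tendsto' (a := x) (fun y _ => hd y) hi.integrableOn hl
  rw [sub_zero] at this
  exact this

end Conjugation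

/-! ### The operator `L_γ` and the sequence `Q_j`. -/

section Operator

variable {d : Fin n → ℝ} {γ : ℝ → Mat n} (h : InPathSpace d γ)
include h

theorem InPathSpace.devMap_eq : devMap d γ = pull (frame d γ) (logDeriv d γ) :=
  h.isFrame.dev_eq h

theorem InPathSpace.projP_pull (ξ : ℝ → Mat n) (x : ℝ) :
    (frame d γ x)ᴴ * (ξ x - bd d (γ x) (ξ x)) * frame d γ x
      = projP d (pull (frame d γ) ξ x) := by
  rw [projP, pull, h.isFrame.projC_pull]; noncomm_ring

/-- `L_γ` maps the off-diagonal part of `ξ` to `ξ_x`, if `ξ_x` is tangent. -/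
theorem InPathSpace.opL_eq {ξ : ℝ → Mat n} (hξ : IsSchwartz ξ)
    (hb : ∀ x, bd d (γ x) (deriv ξ x) = 0) :
    opL d γ (fun x => ξ x - bd d (γ x) (ξ x)) = deriv ξ := by
  ext1 x
  have hg := h.isFrame
  set g := frame d γ with hgdef
  have e : (fun y => (g y)ᴴ * (ξ y - bd d (γ y) (ξ y)) * g y)
      = fun y => projP d (pull g ξ y) := funext fun y => h.projP_pull ξ y
  rw [opL, ← hgdef, e, h.devMap_eq, ← hgdef, opP, hg.opT_eq h hξ hb]
  have hw := hg.hasDerivAt_pull h (hξ.hasDerivAt x)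
  have hd : deriv (fun y => projP d (pull g ξ y)) x
      = projP d ((g x)ᴴ * deriv ξ x * g x - ⁅pull g (logDeriv d γ) x, pull g ξ x⁆) :=
    (hw.sub (hasDerivAt_projC d hw)).deriv
  have h0 : projC d ((g x)ᴴ * deriv ξ x * g x) = 0 := by
    rw [hg.projC_pull, hb]; simp
  have h1 := projC_lie_projC (hg.projC_dev h x) (pull g ξ x)
  set w := pull g ξ x
  set u := pull g (logDeriv d γ) x
  have h2 : ⁅u, projP d w⁆ = ⁅u, w⁆ - ⁅u, projC d w⁆ := by
    simp only [projP, Ring.lie_def]; noncomm_ring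
  have h3 : ⁅u, -projC d w⁆ = -⁅u, projC d w⁆ := by
    simp only [Ring.lie_def]; noncomm_ring
  have h4 : deriv (fun y => projP d (pull g ξ y)) x + projP d ⁅u, projP d w⁆ - ⁅u, -projC d w⁆
      = (g x)ᴴ * deriv ξ x * g x := by
    rw [hd, h2, h3]
    simp only [projP, projC_sub, h0, h1]
    abel
  rw [h4, conj_conj (hg.unitary x)]

/-- `L_γ η` is the derivative of a function with off-diagonal part `η`. -/
theorem InPathSpace.exists_primitive {η : ℝ → Mat n} (hη : IsSchwartz η)
    (hb : ∀ x, bd d (γ x) (η x) = 0) : ∃ ζ : ℝ → Mat n, (∀ x, HasDerivAt ζ (opL d γ η x) x) ∧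
      Tendsto ζ atBot (𝓝 0) ∧ ∀ x, η x = ζ x - bd d (γ x) (ζ x) := by
  have hg := h.isFrame
  set g := frame d γ with hgdef
  set u := pull g (logDeriv d γ) with hu
  set v := pull g η with hv
  have hvd : ∀ x, HasDerivAt v (deriv v x) x := hasDerivAt_of_smooth (hg.pull_smooth hη.smooth)
  have hus : ContDiff ℝ ∞ u := hg.pull_smooth h.logDeriv_schwartz.smooth
  have hvs : ContDiff ℝ ∞ v := hg.pull_smooth hη.smooth
  have hT : ∀ x, HasDerivAt (opT d u v) (projC d ⁅u x, v x⁆) x := by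
    refine hasDerivAt_integral_Iic ?_ (hg.lie_dev_integrable h hη)
    exact (projCCLM d).continuous.comp ((hus.mul hvs).sub (hvs.mul hus)).continuous
  have hTl : Tendsto (opT d u v) atBot (𝓝 0) :=
    tendsto_integral_Iic_zero (f := fun y => projC d ⁅u y, v y⁆) (μ := volume) tendsto_id
  have hpC : ∀ x, projC d (v x) = 0 := by
    intro x; rw [hv, pull, hg.projC_pull, hb]; simp
  have hTC : ∀ x, projC d (opT d u v x) = opT d u v x := by
    intro x
    have h2 : ∫ y in Set.Iic x, projC d (projC d ⁅u y, v y⁆) = projC d (opT d u v x) :=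
      (projCCLM d).integral_comp_comm ((hg.lie_dev_integrable h hη).restrict (s := Set.Iic x))
    simp only [projC_projC] at h2
    exact h2.symm
  -- For `w = v - T_u(v)` the centralizer part of `[u, v]` cancels in `w_x + [u, w]`, which leaves
  -- `P_u(v)`. Since `T_u(v)` lies in the centralizer, `v` is the off-diagonal part of `w`.
  refine ⟨fun x => g x * (v x - opT d u v x) * (g x)ᴴ, fun x => ?_, ?_, fun x => ?_⟩
  · refine (((hg.hasDerivAt h x).mul ((hvd x).sub (hT x))).mul
      (hg.hasDerivAt_star h x)).congr_deriv ?_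
    have e : (fun y => (g y)ᴴ * η y * g y) = v := rfl
    rw [opL, ← hgdef, h.devMap_eq, ← hgdef, ← hu, e, opP, projP]
    have hA : logDeriv d γ x = g x * u x * (g x)ᴴ := (conj_conj (hg.unitary x) _).symm
    show (logDeriv d γ x * g x * (v x - opT d u v x) + g x * (deriv v x - projC d ⁅u x, v x⁆))
      * (g x)ᴴ + g x * (v x - opT d u v x) * -((g x)ᴴ * logDeriv d γ x) = _
    have e1 : logDeriv d γ x * g x = g x * u x := by
      rw [hA, mul_assoc, unitary_star_mul (hg.unitary x), mul_one]
    have e2 : (g x)ᴴ * logDeriv d γ x = u x * (g x)ᴴ := by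
      rw [hA, ← mul_assoc, ← mul_assoc, unitary_star_mul (hg.unitary x), one_mul]
    rw [e1, e2]
    simp only [Ring.lie_def]
    noncomm_ring
  · have h3 := (hg.lim.mul ((hg.pull_tendsto hη.tendsto_atBot).sub hTl)).mul hg.lim_star
    rw [sub_zero, one_mul, mul_one] at h3
    exact h3
  · have h1 : bd d (γ x) (g x * (v x - opT d u v x) * (g x)ᴴ)
        = -(g x * opT d u v x * (g x)ᴴ) := by
      rw [hg.conj x, bd_conj d (hg.unitary x), conj_conj' (hg.unitary x), bd_base, projC_sub, hpC,
        hTC]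
      noncomm_ring
    rw [h1, ← conj_conj (hg.unitary x) (η x)]
    show g x * v x * (g x)ᴴ = _
    noncomm_ring

/-- Primitives with limit `0` at `-∞` are unique, and `η` is the off-diagonal part of its primitive
from `exists_primitive`. -/
theorem InPathSpace.opL_injective {η η' : ℝ → Mat n} (hη : IsSchwartz η) (hη' : IsSchwartz η')
    (hb : ∀ x, bd d (γ x) (η x) = 0) (hb' : ∀ x, bd d (γ x) (η' x) = 0)
    (he : opL d γ η = opL d γ η') : η = η' := by
  obtain ⟨ζ, h1, h2, h3⟩ := h.exists_primitive hη hb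
  obtain ⟨ζ', h1', h2', h3'⟩ := h.exists_primitive hη' hb'
  ext1 x
  have : ζ x - ζ' x = 0 := by
    refine eq_of_hasDerivAt_zero (f := fun x => ζ x - ζ' x) (fun y => ?_) ?_ x
    · refine ((h1 y).sub (h1' y)).congr_deriv ?_
      rw [he, sub_self]
    · have h4 := h2.sub h2'
      rw [sub_zero] at h4
      exact h4
  rw [h3, h3', sub_eq_zero.1 this]

/-- The functions `Q_j`. -/
theorem InPathSpace.Q_eq (j : ℕ) :
    Q d (devMap d γ) j = pull (frame d γ) (localQ d γ j) := by
  have hg := h.isFrame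
  induction j with
  | zero =>
    ext1 x
    rw [Q, pull, h.localQ_zero, hg.pull_path]
  | succ j ih =>
    -- The off-diagonal part: by the induction hypothesis, `(Q_j)_x + [u, Q_j]` is the conjugate of
    -- `[localQ (j + 1), γ]`.
    have hp : ∀ x, -adInv d (deriv (Q d (devMap d γ) j) x + ⁅devMap d γ x, Q d (devMap d γ) j x⁆)
        = projP d (pull (frame d γ) (localQ d γ (j + 1)) x) := by
      intro x
      have h1 : deriv (pull (frame d γ) (localQ d γ j)) x = _ :=
        (hg.hasDerivAt_pull h (h.localQ_hasDerivAt j x)).deriv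
      rw [ih, h1, h.devMap_eq, sub_add_cancel, ← hg.lie_pull, hg.pull_path, projP_of_lie_base]
    -- The next bracket relation makes the derivative off-diagonal, so `opT_eq` identifies the
    -- integral in the definition of `Q` with the centralizer part of a local expression.
    have hb : ∀ x, bd d (γ x) (deriv (localQ d γ (j + 1)) x) = 0 := by
      intro x
      have h1 : deriv (localQ d γ (j + 1)) x = _ := (h.localQ_hasDerivAt (j + 1) x).deriv
      rw [h1]
      exact (h.spectral x).blockDiag_lie' _
    ext1 x
    rw [Q]
    simp only [hp]
    nth_rewrite 1 [h.devMap_eq]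
    rw [hg.opT_eq h (h.localQ_schwartz j) hb, projP]
    abel

theorem InPathSpace.hierarchy_step (j : ℕ) (x : ℝ) :
    HasDerivAt (Q d (devMap d γ) j) (⁅Q d (devMap d γ) (j + 1) x, base d⁆
      - ⁅devMap d γ x, Q d (devMap d γ) j x⁆) x := by
  have hg := h.isFrame
  rw [h.Q_eq, h.Q_eq, h.devMap_eq, ← hg.pull_path x, pull, hg.lie_pull]
  exact hg.hasDerivAt_pull h (h.localQ_hasDerivAt j x)

theorem InPathSpace.isHierarchy : IsHierarchy d (devMap d γ) (Q d (devMap d γ)) where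
  zero x := by rw [Q]
  smooth j := by rw [h.Q_eq]; exact h.isFrame.pull_smooth (h.localQ_smooth j)
  skew j x := by
    rw [h.Q_eq]
    have := (h.localQ_skew j x).conj (U := (frame d γ x)ᴴ)
    rwa [Matrix.conjTranspose_conjTranspose] at this
  step j x := by
    have : deriv (Q d (devMap d γ) j) x = _ := (h.hierarchy_step j x).deriv
    rw [this, sub_add_cancel]
  lim j := by
    rw [h.Q_eq]; exact h.isFrame.pull_tendsto (h.localQ_schwartz j).tendsto_atBot

/-- If two solutions agree up to index `j`, their difference `δ` at `j + 1` commutes with `a`. In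
the next equation `[u, δ]` and the brackets with `a` have no centralizer part, whereas `δ_x` lies in
the centralizer; so `δ_x = 0`, and the limit at `-∞` gives `δ = 0`. -/
theorem InPathSpace.isHierarchy_iff (q : ℕ → ℝ → Mat n) :
    IsHierarchy d (devMap d γ) q ↔ q = Q d (devMap d γ) := by
  refine ⟨fun hq => ?_, fun hq => hq ▸ h.isHierarchy⟩
  have hQ := h.isHierarchy
  ext1 j
  induction j with
  | zero => ext1 x; rw [hq.zero, hQ.zero]
  | succ j ih =>
    set δ : ℝ → Mat n := fun x => q (j + 1) x - Q d (devMap d γ) (j + 1) x with hδ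
    have h1 : ∀ x, projC d (δ x) = δ x := by
      intro x
      have : ⁅base d, δ x⁆ = 0 := by
        have h2 := hq.step j x
        have h3 := hQ.step j x
        rw [ih, h3] at h2
        simp only [Ring.lie_def] at h2 ⊢
        rw [hδ]
        simp only [mul_sub, sub_mul]
        rw [sub_eq_sub_iff_add_eq_add] at h2
        rw [← sub_eq_zero] at h2
        rw [← h2]; abel
      have h4 := (isSpectral_base d).eq_blockDiag_of_lie this
      rw [← bd_base]; exact h4.symm
    have hd : ∀ x, HasDerivAt δ (⁅q (j + 2) x, base d⁆ - ⁅Q d (devMap d γ) (j + 2) x, base d⁆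
        - ⁅devMap d γ x, δ x⁆) x := by
      intro x
      have h2 := hq.step (j + 1) x
      have h3 := hasDerivAt_of_smooth (hq.smooth (j + 1)) x
      refine (h3.sub (h.hierarchy_step (j + 1) x)).congr_deriv ?_
      rw [← h2, hδ]
      simp only [Ring.lie_def]
      noncomm_ring
    have h0 : ∀ x, HasDerivAt δ 0 x := by
      intro x
      have h5 := hasDerivAt_projC d (hd x)
      have h6 : (fun x => projC d (δ x)) = δ := funext h1
      have h7 : projC d ⁅devMap d γ x, δ x⁆ = 0 := by
        rw [← h1 x, h.devMap_eq]
        exact projC_lie_projC (h.isFrame.projC_dev h x) _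
      have h8 : projC d (⁅q (j + 2) x, base d⁆ - ⁅Q d (devMap d γ) (j + 2) x, base d⁆
        - ⁅devMap d γ x, δ x⁆) = 0 := by
        rw [projC_sub, projC_sub, projC_lie_base, projC_lie_base, h7]; simp
      rwa [h8, h6] at h5
    have hl : Tendsto δ atBot (𝓝 0) := by
      have := (hq.lim j).sub (hQ.lim j)
      rw [sub_zero] at this
      exact this
    ext1 x
    exact sub_eq_zero.1 (eq_of_hasDerivAt_zero h0 hl x)

end Operator

/-! ### Formal power series with families as coefficients, and their three derivations. -/

section SeriesFamilies

open PowerSeries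

/-- Families of formal power series with matrix coefficients. -/
abbrev SerFam (n : ℕ) : Type := ℝ → ℝ → PowerSeries (Mat n)

/-- The coefficients of a family of power series. -/
def cf (S : SerFam n) (k : ℕ) : ℝ → ℝ → Mat n := fun ε x => coeff k (S ε x)

/-- The coefficientwise `x`-derivative. -/
def pdX (S : SerFam n) : SerFam n := fun ε x => mk fun k => dX (cf S k) ε x

/-- The coefficientwise derivative in the parameter. -/
def pdE (S : SerFam n) : SerFam n := fun ε x => mk fun k => dE (cf S k) ε x

/-- The formal derivative in the variable of the power series. -/
def pdZ (S : SerFam n) : SerFam n := fun ε x => mk fun k => ((k : ℂ) + 1) • cf S (k + 1) ε x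

theorem cf_pdX (S : SerFam n) (k : ℕ) : cf (pdX S) k = dX (cf S k) := by
  ext1 ε; ext1 x; simp [cf, pdX]

theorem cf_pdE (S : SerFam n) (k : ℕ) : cf (pdE S) k = dE (cf S k) := by
  ext1 ε; ext1 x; simp [cf, pdE]

theorem cf_pdZ (S : SerFam n) (k : ℕ) :
    cf (pdZ S) k = fun ε x => ((k : ℂ) + 1) • cf S (k + 1) ε x := by
  ext1 ε; ext1 x; simp [cf, pdZ]

theorem cf_mul (S T : SerFam n) (k : ℕ) : cf (S * T) k
    = fun ε x => ∑ p ∈ Finset.HasAntidiagonal.antidiagonal k, cf S p.1 ε x * cf T p.2 ε x := by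
  ext1 ε; ext1 x; simp [cf, coeff_mul]

theorem cf_sub (S T : SerFam n) (k : ℕ) : cf (S - T) k = fun ε x => cf S k ε x - cf T k ε x := by
  ext1 ε; ext1 x; simp [cf]

theorem serFam_ext {S T : SerFam n} (h : ∀ k, cf S k = cf T k) : S = T := by
  ext1 ε; ext1 x
  exact PowerSeries.ext fun k => congrFun (congrFun (h k) ε) x

/-- All coefficients of the family are in the class `Ctrl K`. -/
def PCtrl (K : Set ℕ) (S : SerFam n) : Prop := ∀ k, Ctrl K (cf S k)

theorem PCtrl.mul_tame {K : Set ℕ} {S T : SerFam n} (hS : PCtrl K S) (hT : PCtrl {0} T) :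
    PCtrl K (S * T) := fun k => by
  rw [cf_mul]; exact Ctrl.sum _ fun p _ => (hS p.1).mul_tame (hT p.2)

theorem PCtrl.tame_mul {K : Set ℕ} {S T : SerFam n} (hS : PCtrl {0} S) (hT : PCtrl K T) :
    PCtrl K (S * T) := fun k => by
  rw [cf_mul]; exact Ctrl.sum _ fun p _ => (hS p.1).tame_mul (hT p.2)

theorem PCtrl.sub {K : Set ℕ} {S T : SerFam n} (hS : PCtrl K S) (hT : PCtrl K T) :
    PCtrl K (S - T) := fun k => by
  rw [cf_sub]; exact (hS k).sub (hT k)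

/-- All coefficients of the family are smooth. -/
def PSmooth (S : SerFam n) : Prop := ∀ k, SmoothFam (cf S k)

theorem PCtrl.smooth {K : Set ℕ} {S : SerFam n} (hS : PCtrl K S) : PSmooth S :=
  fun k => (hS k).smooth

theorem PSmooth.pdE {S : SerFam n} (hS : PSmooth S) : PSmooth (pdE S) := fun k => by
  rw [cf_pdE]; exact (hS k).dE

theorem SmoothFam.smul {F : ℝ → ℝ → Mat n} (hF : SmoothFam F) (c : ℂ) :
    SmoothFam fun ε x => c • F ε x := by
  have h1 : SmoothFam fun _ _ => c • (1 : Mat n) := contDiff_const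
  simpa using h1.mul hF

theorem SmoothFam.dX_smul {F : ℝ → ℝ → Mat n} (hF : SmoothFam F) (c : ℂ) :
    GNLS.dX (fun ε x => c • F ε x) = fun ε x => c • GNLS.dX F ε x := by
  ext1 ε; ext1 x
  exact ((hF.hasDerivAt_dX ε x).const_smul c).deriv

theorem SmoothFam.dE_smul {F : ℝ → ℝ → Mat n} (hF : SmoothFam F) (c : ℂ) :
    GNLS.dE (fun ε x => c • F ε x) = fun ε x => c • GNLS.dE F ε x := by
  ext1 ε; ext1 x
  exact ((hF.hasDerivAt_dE ε x).const_smul c).deriv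

theorem dX_sum {ι : Type*} (s : Finset ι) {f : ι → ℝ → ℝ → Mat n} (h : ∀ i ∈ s, SmoothFam (f i)) :
    dX (fun ε x => ∑ i ∈ s, f i ε x) = fun ε x => ∑ i ∈ s, dX (f i) ε x := by
  ext1 ε; ext1 x
  exact (HasDerivAt.fun_sum fun i hi => (h i hi).hasDerivAt_dX ε x).deriv

theorem dE_sum {ι : Type*} (s : Finset ι) {f : ι → ℝ → ℝ → Mat n} (h : ∀ i ∈ s, SmoothFam (f i)) :
    dE (fun ε x => ∑ i ∈ s, f i ε x) = fun ε x => ∑ i ∈ s, dE (f i) ε x := by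
  ext1 ε; ext1 x
  exact (HasDerivAt.fun_sum fun i hi => (h i hi).hasDerivAt_dE ε x).deriv

theorem PSmooth.pdZ {S : SerFam n} (hS : PSmooth S) : PSmooth (pdZ S) := fun k => by
  rw [cf_pdZ]; exact (hS (k + 1)).smul _

variable {S T : SerFam n} (hS : PSmooth S) (hT : PSmooth T)

include hS in
theorem PSmooth.pdX_pdZ : GNLS.pdX (GNLS.pdZ S) = GNLS.pdZ (GNLS.pdX S) :=
  serFam_ext fun k => by rw [cf_pdX, cf_pdZ, (hS _).dX_smul, cf_pdZ, cf_pdX]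

include hS in
theorem PSmooth.pdE_pdX : GNLS.pdE (GNLS.pdX S) = GNLS.pdX (GNLS.pdE S) :=
  serFam_ext fun k => by rw [cf_pdE, cf_pdX, (hS k).dE_dX, cf_pdX, cf_pdE]

include hS hT

theorem PSmooth.pdX_mul : GNLS.pdX (S * T) = GNLS.pdX S * T + S * GNLS.pdX T := by
  refine serFam_ext fun k => ?_
  ext1 ε; ext1 x
  have h1 : cf (GNLS.pdX S * T + S * GNLS.pdX T) k ε x
      = cf (GNLS.pdX S * T) k ε x + cf (S * GNLS.pdX T) k ε x := by simp [cf]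
  rw [h1, cf_pdX, cf_mul, cf_mul, cf_mul, dX_sum _ fun p _ => (hS p.1).mul (hT p.2),
    ← Finset.sum_add_distrib]
  refine Finset.sum_congr rfl fun p _ => ?_
  rw [(hS p.1).dX_mul (hT p.2), cf_pdX, cf_pdX]

theorem PSmooth.pdE_mul : GNLS.pdE (S * T) = GNLS.pdE S * T + S * GNLS.pdE T := by
  refine serFam_ext fun k => ?_
  ext1 ε; ext1 x
  have h1 : cf (GNLS.pdE S * T + S * GNLS.pdE T) k ε x
      = cf (GNLS.pdE S * T) k ε x + cf (S * GNLS.pdE T) k ε x := by simp [cf]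
  rw [h1, cf_pdE, cf_mul, cf_mul, cf_mul, dE_sum _ fun p _ => (hS p.1).mul (hT p.2),
    ← Finset.sum_add_distrib]
  refine Finset.sum_congr rfl fun p _ => ?_
  rw [(hS p.1).dE_mul (hT p.2), cf_pdE, cf_pdE]

theorem PSmooth.pdX_sub : GNLS.pdX (S - T) = GNLS.pdX S - GNLS.pdX T := by
  refine serFam_ext fun k => ?_
  ext1 ε; ext1 x
  rw [cf_pdX, cf_sub, cf_sub, cf_pdX, cf_pdX]
  exact (((hS k).hasDerivAt_dX ε x).sub ((hT k).hasDerivAt_dX ε x)).deriv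

omit hS hT

/-- The weight `k + 1` of a product of total degree `k + 1` is split as the sum of the two degrees;
the end terms with weight zero drop out. -/
theorem pdZ_mul : pdZ (S * T) = pdZ S * T + S * pdZ T := by
  refine serFam_ext fun k => ?_
  ext1 ε; ext1 x
  have h1 : cf (pdZ S * T + S * pdZ T) k ε x
      = cf (pdZ S * T) k ε x + cf (S * pdZ T) k ε x := by simp [cf]
  rw [h1, cf_pdZ, cf_mul, cf_mul, cf_mul]
  simp only [cf_pdZ, smul_mul_assoc, mul_smul_comm]
  have h2 := Finset.Nat.sum_antidiagonal_succ (n := k)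
    (f := fun p => (p.1 : ℂ) • (cf S p.1 ε x * cf T p.2 ε x))
  have h3 := Finset.Nat.sum_antidiagonal_succ' (n := k)
    (f := fun p => (p.2 : ℂ) • (cf S p.1 ε x * cf T p.2 ε x))
  simp only [Nat.cast_zero, zero_smul, zero_add, Nat.cast_add, Nat.cast_one] at h2 h3
  rw [← h2, ← h3, ← Finset.sum_add_distrib, Finset.smul_sum]
  refine Finset.sum_congr rfl fun p hp => ?_
  rw [← add_smul]
  congr 1
  have := Finset.HasAntidiagonal.mem_antidiagonal.1 hp
  rw [← Nat.cast_add, this]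
  simp

/-- The trace of a coefficient. -/
def traceCoeff (n k : ℕ) : PowerSeries (Mat n) →+ ℂ :=
  (Matrix.traceAddMonoidHom (Fin n) ℂ).comp (coeff (R := Mat n) k).toAddMonoidHom

theorem traceCoeff_apply (k : ℕ) (S : PowerSeries (Mat n)) :
    traceCoeff n k S = Matrix.trace (coeff k S) := rfl

theorem traceCoeff_mul_comm (k : ℕ) (S T : PowerSeries (Mat n)) :
    traceCoeff n k (S * T) = traceCoeff n k (T * S) := by
  simp only [traceCoeff_apply, coeff_mul, Matrix.trace_sum]
  rw [← Finset.Nat.sum_antidiagonal_swap]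
  exact Finset.sum_congr rfl fun p _ => Matrix.trace_mul_comm _ _

end SeriesFamilies

/-! ### The variational identity for the idempotent series. -/

section Variation

open PowerSeries

variable {d : Fin n → ℝ} {γ : ℝ → Mat n} {Γ : ℝ → ℝ → Mat n} (hΓ : IsVariation d γ Γ)

/-- The series `e` along a family of paths. -/
def serE (d : Fin n → ℝ) (r : Spec d) (Γ : ℝ → ℝ → Mat n) : SerFam n :=
  fun ε x => mk fun k => series d r (Γ ε) k x

theorem cf_serE (r : Spec d) (k : ℕ) :
    cf (serE d r Γ) k = fun ε x => series d r (Γ ε) k x := by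
  ext1 ε; ext1 x; simp [cf, serE]

include hΓ

theorem IsVariation.serE_tame (r : Spec d) : PCtrl {0} (serE d r Γ) := fun k => by
  rw [cf_serE]; exact hΓ.asym.series_tame r k

theorem IsVariation.pdZ_serE_rapid (r : Spec d) : PCtrl Set.univ (pdZ (serE d r Γ)) := fun k => by
  rw [cf_pdZ, cf_serE]; exact (hΓ.asym.series_rapid r k).smul _

/-- `Ctrl` controls a single parameter derivative, and it is used up here; hence only a bound in `x`
is left. -/
theorem IsVariation.pdE_serE_bound (r : Spec d) (k : ℕ) :
    XBound {0} (cf (pdE (serE d r Γ)) k) := by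
  rw [cf_pdE]; exact (hΓ.serE_tame r k).bound_dE

theorem IsVariation.serE_idem (r : Spec d) : serE d r Γ * serE d r Γ = serE d r Γ :=
  serFam_ext fun k => by
    rw [cf_mul, cf_serE]
    ext1 ε; ext1 x
    simp only [cf_serE]
    exact (hΓ.mem ε).series_idem r k x

theorem IsVariation.serE_step (r : Spec d) (k : ℕ) (ε x : ℝ) :
    dX (cf (serE d r Γ) k) ε x
      = cf (serE d r Γ) (k + 1) ε x * Γ ε x - Γ ε x * cf (serE d r Γ) (k + 1) ε x := by
  rw [cf_serE, cf_serE, ← Ring.lie_def, (hΓ.mem ε).series_lie]; rfl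

theorem IsVariation.serE_comm (r : Spec d) (ε x : ℝ) :
    cf (serE d r Γ) 0 ε x * Γ ε x - Γ ε x * cf (serE d r Γ) 0 ε x = 0 := by
  rw [cf_serE]
  simp only [series_zero]
  have h := (hΓ.mem ε).spectral x
  rw [h.proj_mul, h.mul_proj, sub_self]

theorem IsVariation.dE_comm (r : Spec d) (k : ℕ) (ε x : ℝ) :
    dE (fun ε x => cf (serE d r Γ) k ε x * Γ ε x - Γ ε x * cf (serE d r Γ) k ε x) ε x
      = cf (pdE (serE d r Γ)) k ε x * Γ ε x - Γ ε x * cf (pdE (serE d r Γ)) k ε x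
        + (cf (serE d r Γ) k ε x * dE Γ ε x - dE Γ ε x * cf (serE d r Γ) k ε x) := by
  have h1 := (hΓ.serE_tame r k).smooth.hasDerivAt_dE ε x
  have h2 := hΓ.asym.tame.smooth.hasDerivAt_dE ε x
  refine ((h1.mul h2).sub (h2.mul h1)).deriv.trans ?_
  rw [cf_pdE]
  abel

/-- The variational identity, coefficientwise and before integration. -/
theorem IsVariation.trace_series (r : Spec d) (k : ℕ) (ε x : ℝ) :
    Matrix.trace (Γ ε x * cf (pdE (serE d r Γ)) (k + 2) ε x)
      + ((k : ℂ) + 2) * Matrix.trace (cf (serE d r Γ) (k + 2) ε x * dE Γ ε x)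
    = Matrix.trace (dX (cf ((pdZ (serE d r Γ) * serE d r Γ - serE d r Γ * pdZ (serE d r Γ))
        * pdE (serE d r Γ)) k) ε x) := by
  set E := serE d r Γ with hE
  have sE : PSmooth E := (hΓ.serE_tame r).smooth
  have sZ : PSmooth (pdZ E) := sE.pdZ
  have sM : PSmooth (pdZ E * E - E * pdZ E) :=
    (((hΓ.pdZ_serE_rapid r).mul_tame (hΓ.serE_tame r)).sub
      ((hΓ.serE_tame r).tame_mul (hΓ.pdZ_serE_rapid r))).smooth
  have sZE : PSmooth (pdZ E * E) :=
    ((hΓ.pdZ_serE_rapid r).mul_tame (hΓ.serE_tame r)).smooth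
  have sEZ : PSmooth (E * pdZ E) :=
    ((hΓ.serE_tame r).tame_mul (hΓ.pdZ_serE_rapid r)).smooth
  have he : E * E = E := hΓ.serE_idem r
  have hex : pdX E * E + E * pdX E = pdX E := by rw [← sE.pdX_mul sE, he]
  have hed : pdE E * E + E * pdE E = pdE E := by rw [← sE.pdE_mul sE, he]
  have hez : pdZ E * E + E * pdZ E = pdZ E := by rw [← pdZ_mul, he]
  have hezx : pdX (pdZ E) * E + pdZ E * pdX E + pdX E * pdZ E + E * pdX (pdZ E)
      = pdX (pdZ E) := by
    have h1 : pdX (pdZ E * E) = pdX (pdZ E) * E + pdZ E * pdX E := sZ.pdX_mul sE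
    have h2 : pdX (E * pdZ E) = pdX E * pdZ E + E * pdX (pdZ E) := sE.pdX_mul sZ
    have h3 : pdZ E * E = pdZ E - E * pdZ E := eq_sub_of_add_eq hez
    have h4 := congrArg pdX h3
    rw [sZ.pdX_sub sEZ, h1, h2] at h4
    rw [eq_sub_iff_add_eq] at h4
    refine Eq.trans ?_ h4
    abel
  have hY : pdX ((pdZ E * E - E * pdZ E) * pdE E)
      = (pdX (pdZ E) * E - E * pdX (pdZ E) + (pdZ E * pdX E - pdX E * pdZ E)) * pdE E
        + (pdZ E * E - E * pdZ E) * pdX (pdE E) := by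
    rw [sM.pdX_mul sE.pdE, sZE.pdX_sub sEZ, sZ.pdX_mul sE, sE.pdX_mul sZ]
    congr 2
    abel
  -- The central element is the formal variable. Taking the coefficient of order `k + 2` turns `z²`
  -- on the right into a shift to order `k`. The three goals left open are `z e_x = [e, γ]` and its
  -- derivatives in the parameter and in `z`.
  have key := trace_variation (traceCoeff n (k + 2)) (traceCoeff_mul_comm (k + 2))
    (z := PowerSeries.X) (e := E ε x) (ex := pdX E ε x) (ed := pdE E ε x)
    (exd := pdX (pdE E) ε x) (ez := pdZ E ε x) (ezx := pdX (pdZ E) ε x)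
    (γ := PowerSeries.C (Γ ε x)) (γd := PowerSeries.C (dE Γ ε x))
    (fun a => PowerSeries.X_mul)
    (congrFun (congrFun he ε) x) (congrFun (congrFun hex ε) x) (congrFun (congrFun hed ε) x)
    (congrFun (congrFun hez ε) x) (congrFun (congrFun hezx ε) x) ?_ ?_ ?_
  · have h5 := congrFun (congrFun hY ε) x
    simp only [Pi.mul_apply, Pi.add_apply, Pi.sub_apply] at h5
    rw [← h5] at key
    have h6 : traceCoeff n (k + 2) (PowerSeries.X * PowerSeries.X
        * pdX ((pdZ E * E - E * pdZ E) * pdE E) ε x)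
        = Matrix.trace (dX (cf ((pdZ E * E - E * pdZ E) * pdE E) k) ε x) := by
      rw [traceCoeff_apply, mul_assoc, PowerSeries.coeff_succ_X_mul, PowerSeries.coeff_succ_X_mul,
        ← cf_pdX]
      rfl
    have h7 : traceCoeff n (k + 2) (PowerSeries.C (Γ ε x) * pdE E ε x)
        = Matrix.trace (Γ ε x * cf (pdE E) (k + 2) ε x) := by
      rw [traceCoeff_apply, PowerSeries.coeff_C_mul]; rfl
    have h8 : traceCoeff n (k + 2) (PowerSeries.X * pdZ E ε x * PowerSeries.C (dE Γ ε x))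
        = ((k : ℂ) + 2) * Matrix.trace (cf E (k + 2) ε x * dE Γ ε x) := by
      rw [traceCoeff_apply, PowerSeries.coeff_mul_C, PowerSeries.coeff_succ_X_mul]
      have : coeff (k + 1) (pdZ E ε x) = (((k + 1 : ℕ) : ℂ) + 1) • cf E (k + 2) ε x :=
        congrFun (congrFun (cf_pdZ E (k + 1)) ε) x
      rw [this, smul_mul_assoc, Matrix.trace_smul, smul_eq_mul]
      push_cast; ring
    rw [h6, h7, h8] at key
    exact key
  · refine PowerSeries.ext fun m => ?_
    rw [map_sub, PowerSeries.coeff_mul_C, PowerSeries.coeff_C_mul]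
    cases m with
    | zero =>
      rw [PowerSeries.coeff_zero_X_mul]; exact (hΓ.serE_comm r ε x).symm
    | succ m =>
      rw [PowerSeries.coeff_succ_X_mul]
      have h1 : coeff m (pdX E ε x) = dX (cf E m) ε x := congrFun (congrFun (cf_pdX E m) ε) x
      rw [h1]; exact hΓ.serE_step r m ε x
  · refine PowerSeries.ext fun m => ?_
    rw [map_add, map_sub, map_sub, PowerSeries.coeff_mul_C, PowerSeries.coeff_C_mul,
      PowerSeries.coeff_mul_C, PowerSeries.coeff_C_mul]
    have h2 := hΓ.dE_comm r m ε x
    refine Eq.trans ?_ h2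
    cases m with
    | zero =>
      rw [PowerSeries.coeff_zero_X_mul]
      have : (fun ε x => cf (serE d r Γ) 0 ε x * Γ ε x - Γ ε x * cf (serE d r Γ) 0 ε x)
          = fun _ _ => 0 := by
        ext1 ε; ext1 x; exact hΓ.serE_comm r ε x
      rw [this]
      exact (deriv_const _ _).symm
    | succ m =>
      rw [PowerSeries.coeff_succ_X_mul, ← sE.pdE_pdX]
      have : (fun ε x => cf (serE d r Γ) (m + 1) ε x * Γ ε x - Γ ε x * cf (serE d r Γ) (m + 1) ε x)
          = dX (cf E m) := by
        ext1 ε; ext1 x; exact (hΓ.serE_step r m ε x).symm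
      rw [this, ← cf_pdX, ← cf_pdE]
      rfl
  · refine PowerSeries.ext fun m => ?_
    rw [map_add, map_sub, PowerSeries.coeff_mul_C, PowerSeries.coeff_C_mul]
    have h1 : coeff m (pdX E ε x) = dX (cf E m) ε x := congrFun (congrFun (cf_pdX E m) ε) x
    have h2 : coeff m (pdZ E ε x) = ((m : ℂ) + 1) • cf E (m + 1) ε x :=
      congrFun (congrFun (cf_pdZ E m) ε) x
    -- `z ∂_z` multiplies the coefficient of order `m` by `m`; with the extra `e_x` this makes the
    -- factor `m + 1`.
    have h3 : coeff m (PowerSeries.X * pdX (pdZ E) ε x) = (m : ℂ) • dX (cf E m) ε x := by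
      cases m with
      | zero => rw [PowerSeries.coeff_zero_X_mul]; simp
      | succ m =>
        rw [PowerSeries.coeff_succ_X_mul, sE.pdX_pdZ]
        have : coeff m (pdZ (pdX E) ε x) = ((m : ℂ) + 1) • cf (pdX E) (m + 1) ε x :=
          congrFun (congrFun (cf_pdZ (pdX E) m) ε) x
        rw [this, cf_pdX]; push_cast; rfl
    rw [h1, h2, h3, hE, hΓ.serE_step r m ε x, smul_mul_assoc, mul_smul_comm, ← smul_sub, add_smul,
      one_smul, add_comm]

end Variation

/-! ### First variation and gradient of `H_j`. -/

/-- The real part of the trace, as a continuous linear map. -/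
def trCLM (n : ℕ) : Mat n →L[ℝ] ℝ :=
  matCLM
    { toFun := fun X => (Matrix.trace X).re
      map_add' := fun X Y => by simp [Matrix.trace_add]
      map_smul' := fun c X => by simp [Matrix.trace_smul] }

theorem trCLM_apply (X : Mat n) : trCLM n X = (Matrix.trace X).re := rfl

theorem trForm_eq (X Y : Mat n) : trForm X Y = trCLM n (X * Y) := rfl

theorem hasDerivAt_trCLM {f : ℝ → Mat n} {f' : Mat n} {x : ℝ} (h : HasDerivAt f f' x) :
    HasDerivAt (fun x => trCLM n (f x)) (trCLM n f') x :=
  (trCLM n).hasFDerivAt.comp_hasDerivAt x h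

theorem exists_clm_bound {E : Type*} [NormedAddCommGroup E] [NormedSpace ℝ E] (L : E →L[ℝ] ℝ) :
    ∃ C, 0 ≤ C ∧ ∀ X : E, |L X| ≤ C * ‖X‖ :=
  ⟨‖L‖, norm_nonneg _, fun X => L.le_opNorm X⟩

theorem exists_trCLM_bound (n : ℕ) : ∃ C, 0 ≤ C ∧ ∀ X : Mat n, |trCLM n X| ≤ C * ‖X‖ :=
  exists_clm_bound (E := Mat n) (trCLM n)

theorem IsSchwartz.integrable_tr {f : ℝ → Mat n} (h : IsSchwartz f) :
    Integrable fun x => trCLM n (f x) :=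
  (trCLM n).integrable_comp h.integrable

theorem IsSchwartz.integral_tr_deriv {f : ℝ → Mat n} (h : IsSchwartz f) :
    ∫ x, trCLM n (_root_.deriv f x) = 0 := by
  have ht : Tendsto (fun x => trCLM n (f x)) (cocompact ℝ) (𝓝 0) := by
    have := ((trCLM n).continuous.tendsto 0).comp h.tendsto_cocompact
    rw [map_zero] at this
    exact this
  rw [integral_of_hasDerivAt_of_tendsto (fun x => hasDerivAt_trCLM (h.hasDerivAt x))
    h.deriv.integrable_tr (ht.mono_left atBot_le_cocompact) (ht.mono_left atTop_le_cocompact),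
    sub_zero]

theorem XBound.exists_le {F : ℝ → ℝ → Mat n} (h : XBound Set.univ F) :
    ∃ C, 0 ≤ C ∧ ∀ ε ∈ Set.Icc (-1 : ℝ) 1, ∀ x, ‖F ε x‖ ≤ C * (1 + x ^ 2)⁻¹ := by
  obtain ⟨C0, h0⟩ := h 0 trivial 0
  obtain ⟨C2, h2⟩ := h 2 trivial 0
  simp only [pow_zero, one_mul, iteratedDeriv_zero, sq_abs] at h0 h2
  refine ⟨C0 + C2, add_nonneg ((norm_nonneg _).trans (h0 0 zero_mem_Icc 0))
    (le_trans (by positivity) (h2 0 zero_mem_Icc 0)), fun ε hε x => ?_⟩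
  rw [← div_eq_mul_inv, le_div_iff₀ (by positivity)]
  nlinarith [h0 ε hε x, h2 ε hε x]

/-- Differentiation under the integral sign for rapidly decreasing families. -/
theorem Ctrl.hasDerivAt_integral {W : ℝ → ℝ → Mat n} (h : Rapid W) :
    HasDerivAt (fun ε => ∫ x, trCLM n (W ε x)) (∫ x, trCLM n (dE W 0 x)) 0 := by
  obtain ⟨C, hC, hb⟩ := h.bound_dE.exists_le
  obtain ⟨D, hD, ht⟩ := exists_trCLM_bound n
  have hc : ∀ {F : ℝ → ℝ → Mat n}, SmoothFam F → ∀ ε, Continuous fun x => trCLM n (F ε x) :=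
    fun hF ε => (trCLM n).continuous.comp (hF.slice ε).continuous
  refine (hasDerivAt_integral_of_dominated_loc_of_deriv_le (F := fun ε x => trCLM n (W ε x))
    (F' := fun ε x => trCLM n (dE W ε x)) (bound := fun x => D * C * (1 + x ^ 2)⁻¹)
    (Icc_mem_nhds (by norm_num : (-1 : ℝ) < 0) (by norm_num : (0 : ℝ) < 1))
    (Eventually.of_forall fun ε => (hc h.smooth ε).aestronglyMeasurable)
    (h.isSchwartz zero_mem_Icc).integrable_tr (hc h.smooth.dE 0).aestronglyMeasurable
    (Eventually.of_forall fun x ε hε => ?_) (integrable_inv_one_add_sq.const_mul _)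
    (Eventually.of_forall fun x ε _ => hasDerivAt_trCLM (h.smooth.hasDerivAt_dE ε x))).2
  rw [Real.norm_eq_abs, mul_assoc]
  exact (ht _).trans (mul_le_mul_of_nonneg_left (hb ε hε x) hD)

theorem XBound.sum {K : Set ℕ} {ι : Type*} (s : Finset ι) {f : ι → ℝ → ℝ → Mat n}
    (hs : ∀ i ∈ s, SmoothFam (f i)) (h : ∀ i ∈ s, XBound K (f i)) :
    SmoothFam (fun ε x => ∑ i ∈ s, f i ε x) ∧ XBound K fun ε x => ∑ i ∈ s, f i ε x := by
  classical
  induction s using Finset.induction_on with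
  | empty => simpa using And.intro (Ctrl.zero (K := K)).smooth (Ctrl.zero (K := K) (n := n)).bound
  | insert a s ha ih =>
    obtain ⟨h1, h2⟩ := ih (fun i hi => hs i (by simp [hi])) fun i hi => h i (by simp [hi])
    have h3 := hs a (by simp)
    simp only [Finset.sum_insert ha]
    exact ⟨h3.add h1, (h a (by simp)).add h3 h1 h2⟩

section Functional

variable {d : Fin n → ℝ} {γ : ℝ → Mat n} {Γ : ℝ → ℝ → Mat n}

theorem InPathSpace.trForm_Q (h : InPathSpace d γ) (k : ℕ) (x : ℝ) :
    trForm (Q d (devMap d γ) k x) (base d) = trForm (localQ d γ k x) (γ x) := by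
  rw [h.Q_eq, ← h.isFrame.pull_path x, pull, trForm_conj (h.isFrame.unitary x)]

theorem InPathSpace.H_eq (h : InPathSpace d γ) (j : ℕ) :
    H d j γ = -(1 / ((j : ℝ) + 1)) * ∫ x, trCLM n (localQ d γ (j + 2) x * γ x) := by
  rw [H, F]
  simp only [h.trForm_Q, trForm_eq]

theorem InPathSpace.integrable_trForm_Q (h : InPathSpace d γ) (i : ℕ) :
    Integrable fun x => trForm (Q d (devMap d γ) (i + 2) x) (base d) := by
  simp only [h.trForm_Q, trForm_eq]
  exact (((h.asym.localQ_rapid (i + 1)).mul_tame h.asym.tame).isSchwartz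
    zero_mem_Icc).integrable_tr

theorem localQ_eq_sum_cf (d : Fin n → ℝ) (Γ : ℝ → ℝ → Mat n) (k : ℕ) :
    (fun ε x => localQ d (Γ ε) k x) = fun ε x => ∑ r, eig d r • cf (serE d r Γ) k ε x := by
  ext1 ε; ext1 x
  simp only [localQ, cf_serE]

/-- The density of the first variation is, up to a total derivative, a multiple of the trace form
of `g Q_{k+2} g⁻¹` with the variation field. -/
theorem IsVariation.exists_flux (hΓ : IsVariation d γ Γ) (k : ℕ) :
    ∃ Y : ℝ → Mat n, IsSchwartz Y ∧ ∀ x,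
      Matrix.trace (Γ 0 x * dE (fun ε x => localQ d (Γ ε) (k + 2) x) 0 x)
        + ((k : ℂ) + 2) * Matrix.trace (localQ d (Γ 0) (k + 2) x * dE Γ 0 x)
      = Matrix.trace (deriv Y x) := by
  set Z : Spec d → ℝ → ℝ → Mat n := fun r => cf ((pdZ (serE d r Γ) * serE d r Γ
    - serE d r Γ * pdZ (serE d r Γ)) * pdE (serE d r Γ)) k with hZ
  -- The decay comes from `pdZ`, which contains only series coefficients of positive index; `pdE`
  -- contributes a bounded factor.
  have hZb : ∀ r, SmoothFam (Z r) ∧ XBound Set.univ (Z r) := by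
    intro r
    have hM := ((hΓ.pdZ_serE_rapid r).mul_tame (hΓ.serE_tame r)).sub
      ((hΓ.serE_tame r).tame_mul (hΓ.pdZ_serE_rapid r))
    have hE := (hΓ.serE_tame r).smooth.pdE
    rw [hZ]
    simp only [cf_mul _ (pdE _)]
    exact XBound.sum _ (fun p _ => (hM p.1).smooth.mul (hE p.2))
      fun p _ => (hM p.1).bound.mul_left (hM p.1).smooth (hE p.2) (hΓ.pdE_serE_bound r p.2)
  have hZc : ∀ r, SmoothFam (fun ε x => eig d r • Z r ε x)
      ∧ XBound Set.univ fun ε x => eig d r • Z r ε x := by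
    intro r
    refine ⟨(hZb r).1.smul _, ?_⟩
    have h1 := XBound.mul_right (Ctrl.const (eig d r • (1 : Mat n))).smooth (hZb r).1
      (Ctrl.const (eig d r • (1 : Mat n))).bound (hZb r).2
    simpa using h1
  obtain ⟨hs, hb⟩ := XBound.sum Finset.univ (fun r _ => (hZc r).1) fun r _ => (hZc r).2
  refine ⟨fun x => ∑ r, eig d r • Z r 0 x, isSchwartz_iff.2 ⟨hs.slice 0, fun p m => ?_⟩,
    fun x => ?_⟩
  · obtain ⟨C, hC⟩ := hb p trivial m
    exact ⟨C, hC 0 zero_mem_Icc⟩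
  · have h1 : deriv (fun x => ∑ r, eig d r • Z r 0 x) x = ∑ r, eig d r • dX (Z r) 0 x :=
      (HasDerivAt.fun_sum fun r _ => ((hZb r).1.hasDerivAt_dX 0 x).const_smul (eig d r)).deriv
    have h2 : dE (fun ε x => localQ d (Γ ε) (k + 2) x) 0 x
        = ∑ r, eig d r • cf (pdE (serE d r Γ)) (k + 2) 0 x := by
      rw [localQ_eq_sum_cf, dE_sum _ fun r _ => ((hΓ.serE_tame r).smooth (k + 2)).smul _]
      refine Finset.sum_congr rfl fun r _ => ?_
      rw [((hΓ.serE_tame r).smooth (k + 2)).dE_smul, cf_pdE]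
    have h3 : localQ d (Γ 0) (k + 2) x = ∑ r, eig d r • cf (serE d r Γ) (k + 2) 0 x :=
      congrFun (congrFun (localQ_eq_sum_cf d Γ (k + 2)) 0) x
    rw [h1, h2, h3]
    simp only [Finset.mul_sum, Finset.sum_mul, Matrix.trace_sum, mul_smul_comm, smul_mul_assoc,
      Matrix.trace_smul, ← Finset.sum_add_distrib, smul_eq_mul]
    refine Finset.sum_congr rfl fun r _ => ?_
    rw [← hΓ.trace_series r k 0 x]
    ring

/-- The candidate for the gradient of `H_{k-2}`: the part of `g Q_k g⁻¹` tangent to the orbit. -/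
def gradQ (d : Fin n → ℝ) (γ : ℝ → Mat n) (k : ℕ) (x : ℝ) : Mat n :=
  localQ d γ k x - bd d (γ x) (localQ d γ k x)

theorem InPathSpace.isTangent_iff (h : InPathSpace d γ) {X : ℝ → Mat n} :
    IsTangent γ X ↔ IsSchwartz X ∧ ∀ x, IsSkew (X x) ∧ bd d (γ x) (X x) = 0 := by
  constructor
  · rintro ⟨h1, h2⟩
    exact ⟨h1, fun x => (h.inOrbit x).tangent_iff.1 (h2 x)⟩
  · rintro ⟨h1, h2⟩
    exact ⟨h1, fun x => (h.inOrbit x).tangent_iff.2 (h2 x)⟩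

theorem IsSkew.sub {X Y : Mat n} (hX : IsSkew X) (hY : IsSkew Y) : IsSkew (X - Y) := by
  unfold IsSkew at *
  rw [Matrix.conjTranspose_sub, hX, hY]; abel

theorem InPathSpace.isTangent_offDiag (h : InPathSpace d γ) {ξ : ℝ → Mat n} (hξ : IsSchwartz ξ)
    (hs : ∀ x, IsSkew (ξ x)) : IsTangent γ fun x => ξ x - bd d (γ x) (ξ x) := by
  refine h.isTangent_iff.2 ⟨?_, fun x => ⟨(hs x).sub ((h.inOrbit x).skew_bd (hs x)), ?_⟩⟩
  · exact (hξ.rapid.sub (hξ.rapid.bd h.asym)).isSchwartz zero_mem_Icc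
  · rw [bd, blockDiag_sub, (h.spectral x).blockDiag_blockDiag, sub_self]

theorem InPathSpace.isTangent_gradQ (h : InPathSpace d γ) (k : ℕ) :
    IsTangent γ (gradQ d γ (k + 1)) :=
  h.isTangent_offDiag (h.localQ_schwartz k) (h.localQ_skew (k + 1))

theorem IsVariation.path (hΓ : IsVariation d γ Γ) : InPathSpace d γ := hΓ.start ▸ hΓ.mem 0

/-- `γ` is a combination of its spectral projections with constant eigenvalues, and the derivative
of a family of idempotents is off-diagonal; no choice of unitaries depending on the parameter is
needed. -/
theorem IsVariation.bd_velocity (hΓ : IsVariation d γ Γ) (x : ℝ) :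
    bd d (γ x) (velocity Γ x) = 0 := by
  have h1 : dE Γ 0 x = ∑ r, eig d r • cf (pdE (serE d r Γ)) 0 0 x := by
    have h2 : Γ = fun ε x => ∑ r, eig d r • cf (serE d r Γ) 0 ε x := by
      rw [← localQ_eq_sum_cf]
      ext1 ε; ext1 x
      exact ((hΓ.mem ε).localQ_zero x).symm
    nth_rewrite 1 [h2]
    rw [dE_sum _ fun r _ => ((hΓ.serE_tame r).smooth 0).smul _]
    refine Finset.sum_congr rfl fun r _ => ?_
    rw [((hΓ.serE_tame r).smooth 0).dE_smul, cf_pdE]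
  have h3 : ∀ r, bd d (γ x) (cf (pdE (serE d r Γ)) 0 0 x) = 0 := by
    intro r
    refine (hΓ.path.spectral x).blockDiag_eq_zero (r := r) (S := 0) ?_
    have h4 := (hΓ.serE_tame r).smooth.pdE_mul (hΓ.serE_tame r).smooth
    rw [hΓ.serE_idem r] at h4
    have h5 := congrFun (congrFun (congrArg (fun S => cf S 0) h4) 0) x
    have h6 : cf (serE d r Γ) 0 0 x = specProj d (γ x) r := by
      rw [cf_serE]
      show series d r (Γ 0) 0 x = _
      rw [hΓ.start]
      exact series_zero d r γ x
    have h7 : cf (pdE (serE d r Γ) * serE d r Γ + serE d r Γ * pdE (serE d r Γ)) 0 0 x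
        = cf (pdE (serE d r Γ)) 0 0 x * cf (serE d r Γ) 0 0 x
          + cf (serE d r Γ) 0 0 x * cf (pdE (serE d r Γ)) 0 0 x := by
      have h8 := congrFun (congrFun (cf_mul (pdE (serE d r Γ)) (serE d r Γ) 0) 0) x
      have h9 := congrFun (congrFun (cf_mul (serE d r Γ) (pdE (serE d r Γ)) 0) 0) x
      rw [Finset.Nat.antidiagonal_zero, Finset.sum_singleton] at h8 h9
      rw [← h8, ← h9]
      simp [cf]
    simp only [h7, h6] at h5
    simp only [Ring.lie_def, zero_mul, mul_zero, sub_zero, add_zero]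
    exact h5.symm
  have h10 : velocity Γ x = dE Γ 0 x := rfl
  rw [h10, h1]
  simp only [bd, blockDiag, Finset.mul_sum, Finset.sum_mul, mul_smul_comm, smul_mul_assoc]
  rw [Finset.sum_comm]
  refine Finset.sum_eq_zero fun r _ => ?_
  rw [← Finset.smul_sum]
  have := h3 r
  rw [bd, blockDiag] at this
  rw [this, smul_zero]

theorem IsVariation.trForm_offDiag (hΓ : IsVariation d γ Γ) (ξ : Mat n) (x : ℝ) :
    trForm (ξ - bd d (γ x) ξ) (velocity Γ x) = trForm ξ (velocity Γ x) := by
  have h1 := trForm_bd (X := ξ) (hΓ.bd_velocity x)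
  rw [trForm_eq] at h1
  rw [trForm_eq, sub_mul, map_sub, h1, sub_zero, trForm_eq]

/-- The product rule gives `∫ tr (γ δq) + ∫ tr (q δγ)` with `q = localQ (j + 2)`. By `exists_flux`
the first integral is `-(j + 2)` times the second, so the sum is `-(j + 1)` times it, and the
normalization of `H_j` removes this factor. -/
theorem IsVariation.hasDerivAt_H (hΓ : IsVariation d γ Γ) (j : ℕ) :
    HasDerivAt (fun ε => H d j (Γ ε))
      (∫ x, trForm (gradQ d γ (j + 2) x) (velocity Γ x)) 0 := by
  have hq : Rapid fun ε x => localQ d (Γ ε) (j + 2) x := hΓ.asym.localQ_rapid (j + 1)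
  have hW := hq.mul_tame hΓ.asym.tame
  have h1 := hW.hasDerivAt_integral.const_mul (-(1 / ((j : ℝ) + 1)))
  have h2 : (fun ε => H d j (Γ ε)) = fun ε => -(1 / ((j : ℝ) + 1))
      * ∫ x, trCLM n (localQ d (Γ ε) (j + 2) x * Γ ε x) :=
    funext fun ε => (hΓ.mem ε).H_eq j
  rw [h2]
  refine h1.congr_deriv ?_
  obtain ⟨Y, hY, hYx⟩ := hΓ.exists_flux j
  have h3 : ∀ x, trCLM n (dE (fun ε x => localQ d (Γ ε) (j + 2) x * Γ ε x) 0 x)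
      = trCLM n (deriv Y x) - ((j : ℝ) + 1) * trForm (gradQ d γ (j + 2) x) (velocity Γ x) := by
    intro x
    have h4 := congrArg Complex.re (hYx x)
    have h5 : ∀ z : ℂ, (((j : ℂ) + 2) * z).re = ((j : ℝ) + 2) * z.re := by
      intro z
      have : ((j : ℂ) + 2) = (((j : ℝ) + 2 : ℝ) : ℂ) := by push_cast; rfl
      rw [this, Complex.re_ofReal_mul]
    rw [Complex.add_re, h5] at h4
    rw [hq.smooth.dE_mul hΓ.asym.tame.smooth, map_add, gradQ, hΓ.trForm_offDiag, trForm_eq,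
      trCLM_apply, trCLM_apply, trCLM_apply, trCLM_apply, ← h4, hΓ.start,
      Matrix.trace_mul_comm (γ x), show velocity Γ x = dE Γ 0 x from rfl]
    ring
  have hi1 := hY.deriv.integrable_tr
  have hi2 : Integrable fun x => trForm (gradQ d γ (j + 2) x) (velocity Γ x) := by
    have hWs : IsSchwartz fun x => localQ d γ (j + 2) x * dE Γ 0 x := by
      have h6 := XBound.mul_left hq.smooth hΓ.asym.tame.smooth.dE hq.bound hΓ.asym.tame.bound_dE
      refine isSchwartz_iff.2 ⟨?_, fun p m => ?_⟩
      · have := (hq.smooth.mul hΓ.asym.tame.smooth.dE).slice 0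
        simp only [hΓ.start] at this
        exact this
      · obtain ⟨C, hC⟩ := h6 p trivial m
        have := hC 0 zero_mem_Icc
        simp only [hΓ.start] at this
        exact ⟨C, this⟩
    simp only [gradQ, hΓ.trForm_offDiag]
    exact hWs.integrable_tr
  simp only [h3]
  rw [integral_sub hi1 (hi2.const_mul _), hY.integral_tr_deriv, integral_const_mul]
  have : (j : ℝ) + 1 ≠ 0 := by positivity
  field_simp
  ring

theorem InPathSpace.isGradient_gradQ (h : InPathSpace d γ) (j : ℕ) :
    IsGradient d (H d j) γ (gradQ d γ (j + 2)) :=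
  ⟨h.isTangent_gradQ (j + 1), fun _ hΓ => hΓ.hasDerivAt_H j⟩

end Functional

/-! ### Compactly supported variations and uniqueness of gradients. -/

theorem SmoothFam.xBound_of_support {F : ℝ → ℝ → Mat n} (hF : SmoothFam F) {ρ : ℝ}
    (h0 : ∀ ε x, ρ < |x| → F ε x = 0) : XBound Set.univ F := by
  intro k _ m
  induction m generalizing F with
  | zero =>
    obtain ⟨C, hC⟩ := ((isCompact_Icc (a := (-1 : ℝ)) (b := 1)).prod
      (isCompact_Icc (a := -ρ) (b := ρ))).exists_bound_of_continuousOn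
      (f := fun p : ℝ × ℝ => |p.2| ^ k * ‖F p.1 p.2‖)
      (((continuous_snd.abs.pow k).mul (ContDiff.continuous hF).norm).continuousOn)
    refine ⟨max C 0, fun ε hε x => ?_⟩
    rw [iteratedDeriv_zero]
    by_cases hx : ρ < |x|
    · rw [h0 ε x hx, norm_zero, mul_zero]; exact le_max_right _ _
    · have := hC (ε, x) ⟨hε, abs_le.1 (not_lt.1 hx)⟩
      exact (le_abs_self _).trans (this.trans (le_max_left _ _))
  | succ m ih =>
    obtain ⟨C, hC⟩ := ih hF.dX (fun ε x hx => by
      have h1 : F ε =ᶠ[𝓝 x] fun _ => 0 := by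
        filter_upwards [(isOpen_lt continuous_const continuous_abs).mem_nhds hx] with y hy
        exact h0 ε y hy
      exact ((hasDerivAt_const x (0 : Mat n)).congr_of_eventuallyEq h1).deriv)
    refine ⟨C, fun ε hε x => ?_⟩
    rw [iteratedDeriv_succ_mat]
    exact hC ε hε x

theorem SmoothFam.rapid_of_support {F : ℝ → ℝ → Mat n} (hF : SmoothFam F) {ρ : ℝ}
    (h0 : ∀ ε x, ρ < |x| → F ε x = 0) : Rapid F := by
  refine ⟨hF, hF.xBound_of_support h0, hF.dE.xBound_of_support (ρ := ρ) fun ε x hx => ?_⟩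
  have : (fun e => F e x) = fun _ => 0 := funext fun e => h0 e x hx
  show deriv (fun e => F e x) ε = 0
  rw [this]
  exact deriv_const _ _

theorem Asym.isVariation {d : Fin n → ℝ} {Γ : ℝ → ℝ → Mat n} (h : Asym Γ)
    (hm : ∀ ε, InPathSpace d (Γ ε)) : IsVariation d (Γ 0) Γ where
  start := rfl
  mem := hm
  smooth := h.tame.smooth
  decay k m := by
    obtain ⟨C, hC⟩ := h.rapid.bound k trivial m
    refine ⟨C, fun ε hε x => ?_⟩
    rw [iteratedDeriv_succ_mat]
    exact hC ε hε x
  decay_deriv k m := by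
    obtain ⟨C, hC⟩ := h.rapid.bound_dE k trivial m
    refine ⟨C, fun ε hε x => ?_⟩
    rw [iteratedDeriv_succ_mat]
    rw [h.tame.smooth.dE_dX] at hC
    exact hC ε hε x

theorem exists_oneParameter {𝔸 : Type*} [NormedRing 𝔸] [NormedAlgebra ℝ 𝔸] [CompleteSpace 𝔸]
    (Z : 𝔸) : ∃ R : ℝ → 𝔸, (∀ t, HasDerivAt R (Z * R t) t) ∧ R 0 = 1 := by
  let _ : NormedAlgebra ℚ 𝔸 := NormedAlgebra.restrictScalars ℚ ℝ 𝔸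
  exact ⟨fun t => NormedSpace.exp (t • Z), fun t => hasDerivAt_exp_smul_const' Z t, by simp⟩

theorem exists_unitary_oneParameter {Z : Mat n} (hZ : IsSkew Z) : ∃ R : ℝ → Mat n,
    ContDiff ℝ ∞ R ∧ (∀ t, R t ∈ Matrix.unitaryGroup (Fin n) ℂ) ∧ R 0 = 1 ∧ HasDerivAt R Z 0 := by
  obtain ⟨R, hR, h0⟩ := exists_oneParameter Z
  have hS : ContDiff ℝ ∞ R := contDiff_of_linearODE (A := fun _ => Z) contDiff_const hR
  refine ⟨R, hS, fun t => Matrix.mem_unitaryGroup_iff'.2 ?_, h0, ?_⟩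
  · have hd : ∀ t, HasDerivAt (fun t => (R t)ᴴ * R t) 0 t := by
      intro t
      have h1 := hasDerivAt_conjTranspose (hR t)
      rw [Matrix.conjTranspose_mul, hZ] at h1
      refine (h1.mul (hR t)).congr_deriv ?_
      noncomm_ring
    have h2 := is_const_of_deriv_eq_zero (fun t => (hd t).differentiableAt)
      (fun t => (hd t).deriv) t 0
    have h3 : (R t)ᴴ * R t = (R 0)ᴴ * R 0 := h2
    show (R t)ᴴ * R t = 1
    rw [h3, h0]; simp
  · have := hR 0
    rwa [h0, mul_one] at this

section Rotation

variable {d : Fin n → ℝ} {γ : ℝ → Mat n}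

/-- Every compactly supported rotation of a path in a fixed direction is a variation. -/
theorem InPathSpace.exists_variation (h : InPathSpace d γ) {Z : Mat n} (hZ : IsSkew Z)
    {φ : ℝ → ℝ} (hφ : ContDiff ℝ ∞ φ) (hc : HasCompactSupport φ) :
    ∃ Γ, IsVariation d γ Γ ∧ ∀ x, velocity Γ x = φ x • ⁅Z, γ x⁆ := by
  obtain ⟨R, hRs, hRu, hR0, hRd⟩ := exists_unitary_oneParameter hZ
  obtain ⟨ρ, hρ⟩ := hc.isCompact.isBounded.exists_norm_le
  have hφ0 : ∀ x, ρ < |x| → φ x = 0 := fun x hx =>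
    image_eq_zero_of_notMem_tsupport fun hm => absurd (hρ x hm) (not_le.2 hx)
  set Γ : ℝ → ℝ → Mat n := fun ε x => R (ε * φ x) * γ x * (R (ε * φ x))ᴴ with hΓ
  -- The rotated path differs from `γ` only where `φ` may be nonzero, so all decay conditions reduce
  -- to those of `γ` and of a family with common compact support.
  set K : ℝ → ℝ → Mat n := fun ε x => Γ ε x - γ x with hK
  have hR1 : SmoothFam fun ε x => R (ε * φ x) :=
    hRs.comp (contDiff_fst.mul (hφ.comp contDiff_snd))
  have hγ1 : SmoothFam fun _ : ℝ => γ := h.smooth.comp contDiff_snd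
  have hR2 : SmoothFam fun ε x => (R (ε * φ x))ᴴ := (starCLM (n := n)).contDiff.comp hR1
  have hΓs : SmoothFam Γ := (hR1.mul hγ1).mul hR2
  have hKs : SmoothFam K := ContDiff.sub hΓs hγ1
  have hK0 : ∀ ε x, ρ < |x| → K ε x = 0 := by
    intro ε x hx
    simp [hK, hΓ, hφ0 x hx, hR0]
  have hΓK : Γ = fun ε x => γ x + K ε x := by ext1 ε; ext1 x; simp [hK]
  have hKr := hKs.rapid_of_support hK0
  have hA : Asym Γ := by rw [hΓK]; exact h.asym.add ⟨hKr.tame, hKr.dX⟩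
  have hmem : ∀ ε, InPathSpace d (Γ ε) := by
    intro ε
    refine ⟨hΓs.slice ε, fun x => ?_, ?_, ?_⟩
    · obtain ⟨U, hU, hγ⟩ := h.orbit x
      refine ⟨R (ε * φ x) * U, mul_mem (hRu _) hU, ?_⟩
      simp only [hΓ, hγ, Matrix.conjTranspose_mul, mul_assoc]
    · refine Tendsto.congr' ?_ h.lim
      filter_upwards [eventually_lt_atBot (-ρ), eventually_lt_atBot 0] with x hx hx0
      have : ρ < |x| := by rw [abs_of_neg hx0]; linarith
      have h1 := hK0 ε x this
      exact (sub_eq_zero.1 h1).symm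
    · have hKε : Rapid fun _ => K ε :=
        SmoothFam.rapid_of_support (F := fun _ => K ε) (ρ := ρ) ((hKs.slice ε).comp contDiff_snd)
          fun _ x hx => hK0 ε x hx
      have h1 : deriv (Γ ε) = fun x => deriv γ x + deriv (K ε) x := by
        ext1 x
        rw [hΓK]
        exact ((h.hasDerivAt x).add (hKs.hasDerivAt_dX ε x)).deriv
      rw [h1]
      exact (h.schwartz.rapid.add hKε.dX).isSchwartz zero_mem_Icc
  have hstart : Γ 0 = γ := by ext1 x; simp [hΓ, hR0]
  refine ⟨Γ, hstart ▸ hA.isVariation hmem, fun x => ?_⟩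
  have h1 : HasDerivAt (fun ε : ℝ => R (ε * φ x)) (φ x • Z) 0 := by
    have h2 : HasDerivAt (fun ε : ℝ => ε * φ x) (φ x) 0 := by
      simpa using (hasDerivAt_id (0 : ℝ)).mul_const (φ x)
    have h3 : HasDerivAt R Z (0 * φ x) := by rwa [zero_mul]
    exact h3.scomp (0 : ℝ) h2
  have h4 := hasDerivAt_conjTranspose h1
  rw [Matrix.conjTranspose_smul, hZ] at h4
  refine ((h1.mul_const (γ x)).mul h4).deriv.trans ?_
  rw [zero_mul, hR0, Ring.lie_def]
  simp only [one_mul, Matrix.conjTranspose_one, mul_one, star_trivial, smul_mul_assoc,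
    mul_smul_comm, mul_neg, smul_neg]
  rw [smul_sub, sub_eq_add_neg]

/-- On skew-Hermitian matrices the trace form is minus the sum of the squared absolute values of the
entries. -/
theorem trForm_self_eq_zero {X : Mat n} (hX : IsSkew X) (h0 : trForm X X = 0) : X = 0 := by
  have h1 : trForm X X = -∑ i, ∑ k, ‖X i k‖ ^ 2 := by
    have h2 : X * X = -(X * Xᴴ) := by rw [hX]; simp
    rw [trForm_eq, h2, map_neg, trCLM_apply]
    simp only [Matrix.trace, Matrix.diag_apply, Matrix.mul_apply, Matrix.conjTranspose_apply,
      Complex.re_sum, RCLike.star_def, Complex.mul_conj, Complex.normSq_eq_norm_sq]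
    norm_cast
  rw [h1, neg_eq_zero, Finset.sum_eq_zero_iff_of_nonneg (fun i _ => by positivity)] at h0
  ext i k
  have h3 := (Finset.sum_eq_zero_iff_of_nonneg (fun k _ => by positivity)).1 (h0 i (by simp)) k
    (by simp)
  simpa using h3

/-- Tangent vectors are determined by their pairing with variation fields. -/
theorem InPathSpace.tangent_ext (h : InPathSpace d γ) {G G' : ℝ → Mat n} (hG : IsTangent γ G)
    (hG' : IsTangent γ G') (he : ∀ Γ, IsVariation d γ Γ →
      ∫ x, trForm (G x) (velocity Γ x) = ∫ x, trForm (G' x) (velocity Γ x)) : G = G' := by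
  have hGc := hG.schwartz.smooth.continuous
  have hGc' := hG'.schwartz.smooth.continuous
  have hγc : Continuous γ := h.smooth.continuous
  have hcont : ∀ {A : ℝ → Mat n} (Z : Mat n), Continuous A →
      Continuous fun x => trForm (A x) ⁅Z, γ x⁆ := fun Z hA =>
    (trCLM n).continuous.comp (hA.mul ((continuous_const.mul hγc).sub (hγc.mul continuous_const)))
  -- Fundamental lemma of the calculus of variations, with the bump `φ` of a rotation in the fixed
  -- direction `Z` as test function.
  have key : ∀ Z : Mat n, IsSkew Z → ∀ x, trForm (G x - G' x) ⁅Z, γ x⁆ = 0 := by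
    intro Z hZ
    have hDc : Continuous fun x => trForm (G x - G' x) ⁅Z, γ x⁆ := hcont Z (hGc.sub hGc')
    have hae := ae_eq_zero_of_integral_contDiff_smul_eq_zero (μ := volume)
      hDc.locallyIntegrable (fun φ hφ hc => by
        obtain ⟨Γ, hΓ, hv⟩ := h.exists_variation hZ hφ hc
        have h1 := he Γ hΓ
        have h2 : ∀ A : ℝ → Mat n, (fun x => trForm (A x) (velocity Γ x))
            = fun x => φ x * trForm (A x) ⁅Z, γ x⁆ := by
          intro A
          ext1 x
          rw [hv, trForm_eq, mul_smul_comm, map_smul, smul_eq_mul, trForm_eq]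
        have hi : ∀ {A : ℝ → Mat n}, Continuous A →
            Integrable fun x => φ x * trForm (A x) ⁅Z, γ x⁆ := fun hA =>
          (hφ.continuous.mul (hcont Z hA)).integrable_of_hasCompactSupport hc.mul_right
        rw [h2, h2, ← sub_eq_zero, ← integral_sub (hi hGc) (hi hGc')] at h1
        rw [← h1]
        congr 1
        ext1 x
        rw [smul_eq_mul, ← mul_sub, trForm_eq, trForm_eq, trForm_eq, sub_mul, map_sub])
    have h3 := (Continuous.ae_eq_iff_eq volume hDc continuous_const).1 hae
    exact fun x => congrFun h3 x
  ext1 x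
  obtain ⟨hs, hb⟩ := (h.isTangent_iff.1 hG).2 x
  obtain ⟨hs', hb'⟩ := (h.isTangent_iff.1 hG').2 x
  have hsD : IsSkew (G x - G' x) := hs.sub hs'
  have hbD : bd d (γ x) (G x - G' x) = 0 := by
    rw [bd, blockDiag_sub, show blockDiag _ (G x) = _ from hb, show blockDiag _ (G' x) = _ from hb',
      sub_zero]
  -- At the given point the direction is chosen so that the rotation moves `γ x` along `G x - G' x`
  -- itself; definiteness of the trace form concludes.
  obtain ⟨Z, hZ, hZe⟩ := (h.inOrbit x).tangent_iff.2 ⟨hsD, hbD⟩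
  have h4 := key Z hZ x
  rw [← hZe] at h4
  exact sub_eq_zero.1 (trForm_self_eq_zero hsD h4)

theorem InPathSpace.isGradient_unique (h : InPathSpace d γ) {f : (ℝ → Mat n) → ℝ}
    {G G' : ℝ → Mat n} (hG : IsGradient d f γ G) (hG' : IsGradient d f γ G') : G = G' :=
  h.tangent_ext hG.1 hG'.1 fun Γ hΓ => (hG.2 Γ hΓ).unique (hG'.2 Γ hΓ)

theorem InPathSpace.grad_H (h : InPathSpace d γ) (j : ℕ) :
    grad d (H d j) γ = gradQ d γ (j + 2) :=
  h.isGradient_unique (Classical.epsilon_spec (p := IsGradient d (H d j) γ)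
    ⟨_, h.isGradient_gradQ j⟩) (h.isGradient_gradQ j)

theorem InPathSpace.isGradient_H_iff (h : InPathSpace d γ) (j : ℕ) (G : ℝ → Mat n) :
    IsGradient d (H d j) γ G ↔ G = grad d (H d j) γ := by
  rw [h.grad_H]
  exact ⟨fun hG => h.isGradient_unique hG (h.isGradient_gradQ j),
    fun hG => hG ▸ h.isGradient_gradQ j⟩

end Rotation

/-! ### Hamiltonian vectors with respect to `τ_0` and `τ_1`. -/

section Hamiltonian

variable {d : Fin n → ℝ} {γ : ℝ → Mat n} (h : InPathSpace d γ)
include h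

theorem InPathSpace.adPathInv_eq (X : ℝ → Mat n) :
    adPathInv d γ X = fun x => adY d (γ x) (X x) := by
  ext1 x
  have hg := h.isFrame
  have e := adY_conj d (hg.unitary x) (base d) (X x)
  rw [← hg.conj x] at e
  rw [adPathInv, ← adY_base]
  exact e.symm

theorem InPathSpace.isTangent_adPathInv {X : ℝ → Mat n} (hX : IsTangent γ X) :
    IsTangent γ fun x => -adPathInv d γ X x := by
  obtain ⟨h1, h2⟩ := h.isTangent_iff.1 hX
  simp only [h.adPathInv_eq]
  refine h.isTangent_iff.2 ⟨(h1.rapid.adY h.asym).neg.isSchwartz zero_mem_Icc, fun x => ⟨?_, ?_⟩⟩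
  · have := (h2 x).1
    unfold IsSkew at *
    rw [Matrix.conjTranspose_neg, (h.inOrbit x).star_adY, this, adY, adI_neg]
  · rw [bd, blockDiag_neg, (h.spectral x).blockDiag_adI, neg_zero]

theorem InPathSpace.lie_gradQ (k : ℕ) (x : ℝ) :
    ⁅gradQ d γ k x, γ x⁆ = ⁅localQ d γ k x, γ x⁆ := by
  have h1 := (h.spectral x).lie_blockDiag (localQ d γ k x)
  have h2 : ⁅gradQ d γ k x, γ x⁆
      = ⁅localQ d γ k x, γ x⁆ + ⁅γ x, bd d (γ x) (localQ d γ k x)⁆ := by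
    simp only [gradQ, Ring.lie_def]; noncomm_ring
  rw [h2, h1, add_zero]

theorem InPathSpace.deriv_localQ (k : ℕ) :
    deriv (localQ d γ k) = fun x => ⁅gradQ d γ (k + 1) x, γ x⁆ := by
  ext1 x
  have h1 : deriv (localQ d γ k) x = _ := (h.localQ_hasDerivAt k x).deriv
  rw [h1, h.lie_gradQ]

theorem InPathSpace.isTangent_deriv_localQ (k : ℕ) : IsTangent γ (deriv (localQ d γ (k + 1))) := by
  refine ⟨(h.localQ_schwartz k).deriv, fun x => ⟨gradQ d γ (k + 2) x, ?_, ?_⟩⟩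
  · exact ((h.isTangent_iff.1 (h.isTangent_gradQ (k + 1))).2 x).1
  · rw [h.deriv_localQ]

theorem InPathSpace.bd_deriv_localQ (k : ℕ) (x : ℝ) :
    bd d (γ x) (deriv (localQ d γ (k + 1)) x) = 0 :=
  ((h.isTangent_iff.1 (h.isTangent_deriv_localQ k)).2 x).2

theorem InPathSpace.isTangent_lie_grad (j : ℕ) :
    IsTangent γ fun x => ⁅grad d (H d j) γ x, γ x⁆ := by
  rw [h.grad_H, ← h.deriv_localQ]
  exact h.isTangent_deriv_localQ j

/-- The Hamiltonian vector with respect to `τ_0`. -/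
theorem InPathSpace.isHamVec_tauZero_iff (j : ℕ) (X : ℝ → Mat n) :
    IsHamVec d IsTangent (tauZero d) (H d j) γ X ↔
      X = fun x => ⁅grad d (H d j) γ x, γ x⁆ := by
  have h0 : ∀ {Y : ℝ → Mat n}, IsTangent γ Y → ∀ x, Y x = ⁅-adPathInv d γ Y x, γ x⁆ := by
    intro Y hY x
    have h1 := ((h.isTangent_iff.1 hY).2 x).2
    have h2 := (h.spectral x).lie_adI (Y x)
    rw [show blockDiag _ (Y x) = _ from h1, sub_zero] at h2
    nth_rewrite 1 [← h2]
    rw [h.adPathInv_eq]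
    simp only [Ring.lie_def]
    noncomm_ring
  -- By the form of `τ_0`, a tangent `X` is Hamiltonian exactly if `-ad(γ)⁻¹ X` is the gradient; it
  -- remains to invert `ad γ` on tangent fields.
  have hiff : IsHamVec d IsTangent (tauZero d) (H d j) γ X ↔
      IsTangent γ X ∧ IsGradient d (H d j) γ fun x => -adPathInv d γ X x :=
    ⟨fun hX => ⟨hX.1, h.isTangent_adPathInv hX.1, hX.2⟩, fun hX => ⟨hX.1, hX.2.2⟩⟩
  rw [hiff, h.isGradient_H_iff]
  constructor
  · rintro ⟨h1, h2⟩
    ext1 x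
    rw [← h2]
    exact h0 h1 x
  · rintro rfl
    refine ⟨h.isTangent_lie_grad j, ?_⟩
    ext1 x
    have hG : IsTangent γ (grad d (H d j) γ) := by
      rw [h.grad_H]; exact h.isTangent_gradQ (j + 1)
    have h1 := ((h.isTangent_iff.1 hG).2 x).2
    have h2 := (h.spectral x).adI_lie (grad d (H d j) γ x)
    rw [show blockDiag _ (grad d (H d j) γ x) = _ from h1, sub_zero] at h2
    rw [h.adPathInv_eq]
    show -adI (eig d) (specProj d (γ x)) ⁅grad d (H d j) γ x, γ x⁆ = _
    rw [ring_lie_skew, adI_neg, neg_neg, h2]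

/-- Both sides are the derivative of `localQ (j + 2)`: the left by the recursion, the right by
`opL_eq`, since the gradient of `H_j` is the off-diagonal part of that function. -/
theorem InPathSpace.lenard_magri (j : ℕ) :
    (fun x => ⁅grad d (H d (j + 1)) γ x, γ x⁆) = opL d γ (grad d (H d j) γ) := by
  rw [h.grad_H, h.grad_H, ← h.deriv_localQ]
  exact (h.opL_eq (h.localQ_schwartz (j + 1)) (h.bd_deriv_localQ (j + 1))).symm

omit h in
theorem tauOne_eq {ξ X V : ℝ → Mat n} (hξ : IsSchwartz ξ) (hX : IsSchwartz X)
    (hd : ∀ x, HasDerivAt ξ (X x) x) : tauOne γ X V = ∫ x, trForm (ξ x) (V x) := by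
  rw [tauOne]
  congr 1
  ext1 x
  congr 1
  have := integral_Iic_of_hasDerivAt_of_tendsto' (a := x) (fun y _ => hd y)
    hX.integrable.integrableOn hξ.tendsto_atBot
  rw [sub_zero] at this
  exact this

/-- If `X = ξ_x`, then `τ_1` pairs variation fields with the off-diagonal part of `ξ`. So `X` is
Hamiltonian exactly if that part is the gradient, and `L_γ` maps it back to `X`. -/
theorem InPathSpace.isHamVec_tauOne_iff (j : ℕ) (X : ℝ → Mat n) :
    IsHamVec d IsTangentOne tauOne (H d j) γ X ↔
      X = fun x => ⁅grad d (H d (j + 1)) γ x, γ x⁆ := by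
  rw [h.grad_H, ← h.deriv_localQ]
  constructor
  · rintro ⟨⟨hX, ξ, hξ, hξX⟩, hv⟩
    have hd : ∀ x, HasDerivAt ξ (X x) x := fun x => (hξX x).2
    have hXd : deriv ξ = X := funext fun x => (hd x).deriv
    have hη := h.isTangent_offDiag hξ fun x => (hξX x).1
    have hG : IsGradient d (H d j) γ fun x => ξ x - bd d (γ x) (ξ x) := by
      refine ⟨hη, fun Γ hΓ => ?_⟩
      have h1 := hv Γ hΓ
      rw [tauOne_eq hξ hX.schwartz hd] at h1
      simp only [hΓ.trForm_offDiag]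
      exact h1
    have hb : ∀ x, bd d (γ x) (deriv ξ x) = 0 := by
      rw [hXd]; exact fun x => ((h.isTangent_iff.1 hX).2 x).2
    have h2 := h.opL_eq hξ hb
    rw [(h.isGradient_H_iff j _).1 hG, ← h.lenard_magri, h.grad_H, ← h.deriv_localQ, hXd] at h2
    exact h2.symm
  · rintro rfl
    -- The Schwartz primitive required by the domain of `τ_1` is `localQ (j + 2)`.
    refine ⟨⟨h.isTangent_deriv_localQ (j + 1), localQ d γ (j + 2), h.localQ_schwartz (j + 1),
      fun x => ⟨h.localQ_skew _ x, (h.localQ_schwartz (j + 1)).hasDerivAt x⟩⟩, fun Γ hΓ => ?_⟩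
    rw [tauOne_eq (h.localQ_schwartz (j + 1)) (h.localQ_schwartz (j + 1)).deriv
      (h.localQ_schwartz (j + 1)).hasDerivAt]
    have h1 := hΓ.hasDerivAt_H j
    simp only [gradQ, hΓ.trForm_offDiag] at h1
    exact h1

/-- `L_γ` is invertible on the domain of `τ_1`, and its inverse represents `τ_1`. -/
theorem InPathSpace.exists_opL_inv {X : ℝ → Mat n} (hX : IsTangentOne γ X) :
    ∃ η, IsTangent γ η ∧ opL d γ η = X ∧
      (∀ η', IsTangent γ η' → opL d γ η' = X → η' = η) ∧
      ∀ V, IsTangent γ V → tauOne γ X V = ∫ x, trForm (η x) (V x) := by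
  obtain ⟨hT, ξ, hξ, hξX⟩ := hX
  have hd : ∀ x, HasDerivAt ξ (X x) x := fun x => (hξX x).2
  have hXd : deriv ξ = X := funext fun x => (hd x).deriv
  have hη := h.isTangent_offDiag hξ fun x => (hξX x).1
  have hb : ∀ x, bd d (γ x) (deriv ξ x) = 0 := by
    rw [hXd]; exact fun x => ((h.isTangent_iff.1 hT).2 x).2
  have hL := (h.opL_eq hξ hb).trans hXd
  refine ⟨_, hη, hL, fun η' hη' he => ?_, fun V hV => ?_⟩
  · exact h.opL_injective hη'.schwartz hη.schwartz (fun x => ((h.isTangent_iff.1 hη').2 x).2)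
      (fun x => ((h.isTangent_iff.1 hη).2 x).2) (he.trans hL.symm)
  · rw [tauOne_eq hξ hT.schwartz hd]
    congr 1
    ext1 x
    have h1 := trForm_bd (X := ξ x) ((h.isTangent_iff.1 hV).2 x).2
    rw [trForm_eq] at h1
    rw [trForm_eq, trForm_eq, sub_mul, map_sub, h1, sub_zero]

end Hamiltonian

theorem IsFlow.congr {d : Fin n → ℝ} {R R' : (ℝ → Mat n) → (ℝ → Mat n) → Prop} {I : Set ℝ}
    {c : ℝ → ℝ → Mat n} (h : ∀ γ, InPathSpace d γ → ∀ X, R γ X ↔ R' γ X) :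
    IsFlow d R I c ↔ IsFlow d R' I c := by
  refine forall₂_congr fun t _ => and_congr_right fun hc => exists_congr fun X => ?_
  rw [h _ hc]

end GNLS

end

theorem corollary5p4 (n : ℕ) (d : Fin n → ℝ) (j : ℕ) (hj : 1 ≤ j) :
    -- the frame, the sequence `Q`, the functionals, the gradients and `τ_1` are well defined
    (∀ γ, GNLS.InPathSpace d γ →
      (∀ g, GNLS.IsFrame d γ g ↔ g = GNLS.frame d γ) ∧
      (∀ q, GNLS.IsHierarchy d (GNLS.devMap d γ) q ↔ q = GNLS.Q d (GNLS.devMap d γ)) ∧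
      (∀ i, MeasureTheory.Integrable fun x =>
        GNLS.trForm (GNLS.Q d (GNLS.devMap d γ) (i + 2) x) (GNLS.base d)) ∧
      (∀ G, GNLS.IsGradient d (GNLS.H d j) γ G ↔ G = GNLS.grad d (GNLS.H d j) γ) ∧
      (∀ G, GNLS.IsGradient d (GNLS.H d (j - 1)) γ G ↔ G = GNLS.grad d (GNLS.H d (j - 1)) γ) ∧
      (∀ X, GNLS.IsTangentOne γ X → ∃ η, GNLS.IsTangent γ η ∧ GNLS.opL d γ η = X ∧
        (∀ η', GNLS.IsTangent γ η' → GNLS.opL d γ η' = X → η' = η) ∧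
        ∀ V, GNLS.IsTangent γ V →
          GNLS.tauOne γ X V = ∫ x, GNLS.trForm (η x) (V x))) ∧
    -- the Lenard-Magri relation
    (∀ γ, GNLS.InPathSpace d γ →
      (∀ X, GNLS.IsHamVec d GNLS.IsTangent (GNLS.tauZero d) (GNLS.H d j) γ X ↔
        X = fun x => ⁅GNLS.grad d (GNLS.H d j) γ x, γ x⁆) ∧
      (fun x => ⁅GNLS.grad d (GNLS.H d j) γ x, γ x⁆) =
        GNLS.opL d γ (GNLS.grad d (GNLS.H d (j - 1)) γ) ∧
      (∀ X, GNLS.IsHamVec d GNLS.IsTangent (GNLS.tauZero d) (GNLS.H d j) γ X ↔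
        GNLS.IsHamVec d GNLS.IsTangentOne GNLS.tauOne (GNLS.H d (j - 1)) γ X)) ∧
    -- the same for the evolution equations
    (∀ (I : Set ℝ) (c : ℝ → ℝ → GNLS.Mat n), List.TFAE [
      GNLS.IsFlow d (GNLS.IsHamVec d GNLS.IsTangent (GNLS.tauZero d) (GNLS.H d j)) I c,
      GNLS.IsFlow d (fun γ X => X = fun x => ⁅GNLS.grad d (GNLS.H d j) γ x, γ x⁆) I c,
      GNLS.IsFlow d (fun γ X => X = GNLS.opL d γ (GNLS.grad d (GNLS.H d (j - 1)) γ)) I c,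
      GNLS.IsFlow d (GNLS.IsHamVec d GNLS.IsTangentOne GNLS.tauOne (GNLS.H d (j - 1))) I c]) := by
  obtain ⟨j, rfl⟩ : ∃ k, j = k + 1 := ⟨j - 1, by omega⟩
  simp only [Nat.add_sub_cancel]
  refine ⟨fun γ h => ⟨fun g => h.isFrame_iff, h.isHierarchy_iff, h.integrable_trForm_Q,
    h.isGradient_H_iff (j + 1), h.isGradient_H_iff j, fun X hX => h.exists_opL_inv hX⟩,
    fun γ h => ⟨h.isHamVec_tauZero_iff (j + 1), h.lenard_magri j, fun X => ?_⟩, fun I c => ?_⟩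
  · rw [h.isHamVec_tauZero_iff, h.isHamVec_tauOne_iff]
  · tfae_have 1 ↔ 2 := GNLS.IsFlow.congr fun γ h X => h.isHamVec_tauZero_iff (j + 1) X
    tfae_have 2 ↔ 3 := GNLS.IsFlow.congr fun γ h X => by rw [h.lenard_magri]
    tfae_have 4 ↔ 2 := GNLS.IsFlow.congr fun γ h X => h.isHamVec_tauOne_iff j X
    tfae_finish
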